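/- The following is a theorem of homotopy type theory (dependent type theory with $\Pi$, $\Sigma$, $0$, $1$, $+$, $\mathbb{N}$, identity types, a hierarchy of cumulative univalent universes, function extensionality and $n$-truncations): its formal statement, for types in an arbitrary universe $\mathcal{U}_i$, has a closed term. Let $n \ge -1$, let $X, Y$ be types and let $f : X \to Y$ be surjective, i.e. $\prod_{y : Y} \| \mathrm{fib}_f(y) \|_{-1}$, where $\mathrm{fib}_f(y) :\equiv \sum_{x : X} (f(x) = y)$. Then $f$ is a $\|-\|_n$-fibration if and only if for all $y : Y$ and all $(x,p) : \mathrm{fib}_f(y)$ the induced map $$\pi_{n+1}(X, x) \to \pi_{n+1}(Y, y)$$ is surjective. Here $\|A\|_n$ is the $n$-truncation of $A$, with unit $|-|_n : A \to \|A\|_n$, and $\|f\|_n : \|X\|_n \to \|Y\|_n$ is the induced map. For $y : Y$ let $\delta : \mathrm{fib}_f(y) \to \mathrm{fib}_{\|f\|_n}(|y|_n)$ be the map $(x,p) \mapsto (|x|_n, \mathrm{ap}_{|-|_n}(p))$, and let $\gamma : \| \mathrm{fib}_f(y) \|_n \to \mathrm{fib}_{\|f\|_n}(|y|_n)$ be the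 map through which $\delta$ factors along the unit. Then $f$ is a $\|-\|_n$-fibration if $\gamma$ is an equivalence for every $y : Y$. Moreover $\pi_k(A,a) :\equiv \| \Omega^k(A,a) \|_0$ for $k \ge 0$, and the induced map is $\| \Omega^k(f,p) \|_0$ for the pointed map $(f,p) : (X,x) \to (Y,y)$. -/

import Mathlib

/-!
Homotopy type theory as a formal system.  Raw terms are those of the lambda calculus with a
type former `Π`, cumulative Russell universes and primitive constants; each constant has a closed
type, and judgmental equality is convertibility.  This is dependent type theory with `0`, `1`, `+`,
`Σ`, `ℕ`, identity types, function extensionality, univalence and all `n`-truncations.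
A theorem of homotopy type theory is a closed type that has a closed term.
-/

namespace HoTT

/-- The primitive constants.  The constants `trunc`, `tr`, `truncIsType`, `indTrunc` take a natural
number `k` of the theory, which stands for the truncation level `k - 2`. -/
inductive Con : Type
  | empty | indEmpty
  | unit | star | indUnit
  | sum | inl | inr | indSum
  | sig | pair | indSig
  | nat | zero | succ | indNat
  | idt | refl | indId
  | trunc | tr | truncIsType | indTrunc
  | funext (i : ℕ)
  | ua (i : ℕ)

/-- Raw terms, with de Bruijn indices; `lam` binds one variable and so does the second argument
of `pi`. -/
inductive Tm : Type
  | var (n : ℕ)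
  | univ (i : ℕ)
  | pi (A B : Tm)
  | lam (t : Tm)
  | app (t u : Tm)
  | con (c : Con)

namespace Tm

/-- The renaming `r` pushed under a binder. -/
def upRen (r : ℕ → ℕ) : ℕ → ℕ
  | 0 => 0
  | n + 1 => r n + 1

/-- Renaming of variables. -/
def ren : (ℕ → ℕ) → Tm → Tm
  | r, var n => var (r n)
  | _, univ i => univ i
  | r, pi A B => pi (ren r A) (ren (upRen r) B)
  | r, lam t => lam (ren (upRen r) t)
  | r, app t u => app (ren r t) (ren r u)
  | _, con c => con c

/-- Weakening by `k` variables. -/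
def shift (k : ℕ) (t : Tm) : Tm := ren (fun n => n + k) t

/-- The substitution `s` pushed under a binder. -/
def up (s : ℕ → Tm) : ℕ → Tm
  | 0 => var 0
  | n + 1 => shift 1 (s n)

/-- Parallel, capture-avoiding substitution. -/
def subst : (ℕ → Tm) → Tm → Tm
  | s, var n => s n
  | _, univ i => univ i
  | s, pi A B => pi (subst s A) (subst (up s) B)
  | s, lam t => lam (subst (up s) t)
  | s, app t u => app (subst s t) (subst s u)
  | _, con c => con c

/-- `inst t u` is `t` with `u` for the variable `0`. -/
def inst (t u : Tm) : Tm :=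
  subst (fun n => match n with | 0 => u | k + 1 => var k) t

end Tm

/-- A term as a function of the number of binders above it.  It serves only to write terms with
Lean's bound variables in place of de Bruijn indices: the variable of a binder at depth `d`, used
at depth `e`, is the index `e - d - 1`. -/
structure Exp : Type where
  atDepth : ℕ → Tm

namespace Exp

/-- The closed term that a closed expression denotes. -/
def close (e : Exp) : Tm := e.atDepth 0

def univ (i : ℕ) : Exp := ⟨fun _ => .univ i⟩

def con (c : Con) : Exp := ⟨fun _ => .con c⟩

def app (t u : Exp) : Exp := ⟨fun d => .app (t.atDepth d) (u.atDepth d)⟩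

/-- The variable bound at depth `d`. -/
def bound (d : ℕ) : Exp := ⟨fun e => .var (e - d - 1)⟩

/-- `λ x. t x` -/
def lam (t : Exp → Exp) : Exp := ⟨fun d => .lam ((t (bound d)).atDepth (d + 1))⟩

/-- `Π (x : A), B x` -/
def pi (A : Exp) (B : Exp → Exp) : Exp :=
  ⟨fun d => .pi (A.atDepth d) ((B (bound d)).atDepth (d + 1))⟩

/-- `A → B` -/
def arr (A B : Exp) : Exp := pi A fun _ => B

instance : CoeFun Exp (fun _ => Exp → Exp) := ⟨app⟩

end Exp

open Exp

/-! ### The primitive constants as expressions -/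

def empty : Exp := con .empty
def unit : Exp := con .unit
def star : Exp := con .star
def sum : Exp := con .sum
def inl : Exp := con .inl
def inr : Exp := con .inr
/-- `sig A B` is `Σ (x : A), B x`. -/
def sig : Exp := con .sig
/-- `pair A B a b` is `(a, b) : Σ (x : A), B x`. -/
def pair : Exp := con .pair
def indSig : Exp := con .indSig
def nat : Exp := con .nat
def zero : Exp := con .zero
def succ : Exp := con .succ
def indNat : Exp := con .indNat
/-- `idt A a b` is the type of identifications `a =_A b`. -/
def idt : Exp := con .idt
def refl : Exp := con .refl
/-- Path induction. -/
def indId : Exp := con .indId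
/-- `trunc k A` is the truncation `‖A‖` at level `k - 2`. -/
def trunc : Exp := con .trunc
/-- `tr k A` is the unit `A → trunc k A`. -/
def tr : Exp := con .tr
def truncIsType : Exp := con .truncIsType
def indTrunc : Exp := con .indTrunc

/-! ### Pairs and identifications -/

/-- `fst A B w : A` -/
def fst : Exp := lam fun A => lam fun B => lam fun w =>
  indSig A B (lam fun _ => A) (lam fun a => lam fun _ => a) w

/-- `snd A B w : B (fst A B w)` -/
def snd : Exp := lam fun A => lam fun B => lam fun w =>
  indSig A B (lam fun w => B (fst A B w)) (lam fun _ => lam fun b => b) w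

/-- For `p : a = b`, `inv A a b p : b = a`. -/
def inv : Exp := lam fun A => lam fun a => lam fun b => lam fun p =>
  indId A (lam fun x => lam fun y => lam fun _ => idt A y x) (lam fun x => refl A x) a b p

/-- For `p : a = b` and `q : b = c`, `concat A a b c p q : a = c` is `p · q`. -/
def concat : Exp := lam fun A => lam fun a => lam fun b => lam fun c => lam fun p => lam fun q =>
  indId A (lam fun x => lam fun y => lam fun _ => arr (idt A y c) (idt A x c))
    (lam fun _ => lam fun q => q) a b p q

/-- For `f : A → B` and `p : a = a'`, `ap A B f a a' p : f a = f a'`. -/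
def ap : Exp := lam fun A => lam fun B => lam fun f => lam fun a => lam fun a' => lam fun p =>
  indId A (lam fun x => lam fun y => lam fun _ => idt B (f x) (f y))
    (lam fun x => refl B (f x)) a a' p

/-- For `p : a = b`, `invConcat A a b p : p⁻¹ · p = refl`. -/
def invConcat : Exp := lam fun A => lam fun a => lam fun b => lam fun p =>
  indId A
    (lam fun x => lam fun y => lam fun p =>
      idt (idt A y y) (concat A y x y (inv A x y p) p) (refl A y))
    (lam fun x => refl (idt A x x) (refl A x)) a b p

/-! ### Contractibility, fibers, equivalences, truncated types -/

/-- `isContr A` is `Σ (a : A), Π (a' : A), a = a'`. -/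
def isContr : Exp := lam fun A => sig A (lam fun a => pi A fun a' => idt A a a')

/-- `fib A B f b` is `Σ (x : A), f x = b`. -/
def fib : Exp := lam fun A => lam fun B => lam fun f => lam fun b =>
  sig A (lam fun x => idt B (f x) b)

/-- `isEquiv A B f` is `Π (b : B), isContr (fib f b)`. -/
def isEquiv : Exp := lam fun A => lam fun B => lam fun f =>
  pi B fun b => isContr (fib A B f b)

/-- `equiv A B` is `Σ (f : A → B), isEquiv f`. -/
def equiv : Exp := lam fun A => lam fun B =>
  sig (arr A B) (lam fun f => isEquiv A B f)

/-- `isType i k A`, for `A : U_i`, says that `A` is a `(k - 2)`-type: it is contractible for `k = 0`,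
and its identity types are `(k - 3)`-types otherwise. -/
def isType (i : ℕ) : Exp := lam fun k =>
  indNat (lam fun _ => arr (univ i) (univ i)) isContr
    (lam fun _ => lam fun T => lam fun A => pi A fun x => pi A fun y => T (idt A x y)) k

/-- `idIsEquiv A : isEquiv A A (λ x. x)` -/
def idIsEquiv : Exp := lam fun A => lam fun b =>
  let F : Exp → Exp := fun b => fib A A (lam fun x => x) b
  let mk : Exp → Exp → Exp → Exp := fun b x p => pair A (lam fun x => idt A x b) x p
  pair (F b) (lam fun w => pi (F b) fun w' => idt (F b) w w') (mk b b (refl A b))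
    (lam fun w' => indSig A (lam fun x => idt A x b)
      (lam fun w' => idt (F b) (mk b b (refl A b)) w')
      (lam fun x => lam fun p => indId A
        (lam fun x => lam fun b => lam fun p => idt (F b) (mk b b (refl A b)) (mk b x p))
        (lam fun x => refl (F x) (mk x x (refl A x))) x b p) w')

/-- `idToEquiv i A B : (A = B) → equiv A B`, for `A B : U_i`; it sends `refl` to the identity. -/
def idToEquiv (i : ℕ) : Exp := lam fun A => lam fun B => lam fun p =>
  indId (univ i) (lam fun A => lam fun B => lam fun _ => equiv A B)
    (lam fun A => pair (arr A A) (lam fun f => isEquiv A A f) (lam fun x => x) (idIsEquiv A))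
    A B p

/-- `happly A B f g : (f = g) → Π (x : A), f x = g x` -/
def happly : Exp := lam fun A => lam fun B => lam fun f => lam fun g => lam fun p =>
  indId (pi A fun x => B x)
    (lam fun f => lam fun g => lam fun _ => pi A fun x => idt (B x) (f x) (g x))
    (lam fun f => lam fun x => refl (B x) (f x)) f g p

/-! ### The formal system -/

/-- The type of a constant, as an expression.  Formation and introduction constants take types
in `U_i`, and the motives of the induction constants take values in `U_j`. -/
def conTypeExp (i j : ℕ) : Con → Exp
  | .empty => univ i
  | .indEmpty => pi (arr empty (univ j)) fun C => pi empty fun t => C t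
  | .unit => univ i
  | .star => unit
  | .indUnit => pi (arr unit (univ j)) fun C => arr (C star) (pi unit fun t => C t)
  | .sum => arr (univ i) (arr (univ i) (univ i))
  | .inl => pi (univ i) fun A => pi (univ i) fun B => arr A (sum A B)
  | .inr => pi (univ i) fun A => pi (univ i) fun B => arr B (sum A B)
  | .indSum => pi (univ i) fun A => pi (univ i) fun B => pi (arr (sum A B) (univ j)) fun C =>
      arr (pi A fun a => C (inl A B a)) (arr (pi B fun b => C (inr A B b))
        (pi (sum A B) fun s => C s))
  | .sig => pi (univ i) fun A => arr (arr A (univ i)) (univ i)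
  | .pair => pi (univ i) fun A => pi (arr A (univ i)) fun B =>
      pi A fun a => arr (B a) (sig A B)
  | .indSig => pi (univ i) fun A => pi (arr A (univ i)) fun B =>
      pi (arr (sig A B) (univ j)) fun C =>
      arr (pi A fun a => pi (B a) fun b => C (pair A B a b)) (pi (sig A B) fun w => C w)
  | .nat => univ i
  | .zero => nat
  | .succ => arr nat nat
  | .indNat => pi (arr nat (univ j)) fun C => arr (C zero)
      (arr (pi nat fun n => arr (C n) (C (succ n))) (pi nat fun n => C n))
  | .idt => pi (univ i) fun A => arr A (arr A (univ i))
  | .refl => pi (univ i) fun A => pi A fun a => idt A a a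
  | .indId => pi (univ i) fun A =>
      pi (pi A fun x => pi A fun y => arr (idt A x y) (univ j)) fun C =>
      arr (pi A fun x => C x x (refl A x))
        (pi A fun x => pi A fun y => pi (idt A x y) fun p => C x y p)
  | .trunc => arr nat (arr (univ i) (univ i))
  | .tr => pi nat fun k => pi (univ i) fun A => arr A (trunc k A)
  | .truncIsType => pi nat fun k => pi (univ i) fun A => isType i k (trunc k A)
  | .indTrunc => pi nat fun k => pi (univ i) fun A =>
      pi (arr (trunc k A) (univ j)) fun C =>
      arr (pi (trunc k A) fun u => isType j k (C u))
        (arr (pi A fun a => C (tr k A a)) (pi (trunc k A) fun u => C u))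
  | .funext l => pi (univ l) fun A => pi (arr A (univ l)) fun B =>
      pi (pi A fun x => B x) fun f => pi (pi A fun x => B x) fun g =>
      isEquiv (idt (pi A fun x => B x) f g) (pi A fun x => idt (B x) (f x) (g x))
        (happly A B f g)
  | .ua l => pi (univ l) fun A => pi (univ l) fun B =>
      isEquiv (idt (univ l) A B) (equiv A B) (idToEquiv l A B)

/-- The (closed) type of a constant. -/
def Con.type (i j : ℕ) (c : Con) : Tm := (conTypeExp i j c).close

/-- Iterated application of a constant. -/
def Con.ap (c : Con) (ts : List Tm) : Tm := ts.foldl Tm.app (.con c)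

/-- Convertibility: the congruence generated by `β`, `η` and the computation rules of the
induction constants. -/
inductive Conv : Tm → Tm → Prop
  | refl (t) : Conv t t
  | symm {t u} : Conv t u → Conv u t
  | trans {t u v} : Conv t u → Conv u v → Conv t v
  | pi {A A' B B'} : Conv A A' → Conv B B' → Conv (.pi A B) (.pi A' B')
  | lam {t t'} : Conv t t' → Conv (.lam t) (.lam t')
  | app {t t' u u'} : Conv t t' → Conv u u' → Conv (.app t u) (.app t' u')
  | beta (t u) : Conv (.app (.lam t) u) (t.inst u)
  | eta (t) : Conv (.lam (.app (t.shift 1) (.var 0))) t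
  | unit (C c) : Conv (Con.ap .indUnit [C, c, .con .star]) c
  | inl (A B C l r A' B' a) :
      Conv (Con.ap .indSum [A, B, C, l, r, Con.ap .inl [A', B', a]]) (.app l a)
  | inr (A B C l r A' B' b) :
      Conv (Con.ap .indSum [A, B, C, l, r, Con.ap .inr [A', B', b]]) (.app r b)
  | pair (A B C g A' B' a b) :
      Conv (Con.ap .indSig [A, B, C, g, Con.ap .pair [A', B', a, b]]) (.app (.app g a) b)
  | zero (C z s) : Conv (Con.ap .indNat [C, z, s, .con .zero]) z
  | succ (C z s n) : Conv (Con.ap .indNat [C, z, s, Con.ap .succ [n]])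
      (.app (.app s n) (Con.ap .indNat [C, z, s, n]))
  | id (A C d x y A' a) :
      Conv (Con.ap .indId [A, C, d, x, y, Con.ap .refl [A', a]]) (.app d a)
  | trunc (k A C h g k' A' a) :
      Conv (Con.ap .indTrunc [k, A, C, h, g, Con.ap .tr [k', A', a]]) (.app g a)

/-- The typing judgment `Γ ⊢ t : A`; the head of `Γ` is the type of the variable `0`. -/
inductive HasType : List Tm → Tm → Tm → Prop
  | var {Γ n A} : Γ[n]? = some A → HasType Γ (.var n) (A.shift (n + 1))
  | univ {Γ} (i) : HasType Γ (.univ i) (.univ (i + 1))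
  | cumul {Γ A i} : HasType Γ A (.univ i) → HasType Γ A (.univ (i + 1))
  | pi {Γ A B i} : HasType Γ A (.univ i) → HasType (A :: Γ) B (.univ i) →
      HasType Γ (.pi A B) (.univ i)
  | lam {Γ A B t i} : HasType Γ A (.univ i) → HasType (A :: Γ) t B →
      HasType Γ (.lam t) (.pi A B)
  | app {Γ A B f a} : HasType Γ f (.pi A B) → HasType Γ a A → HasType Γ (.app f a) (B.inst a)
  | con {Γ} (c : Con) (i j) : HasType Γ (.con c) (c.type i j)
  | conv {Γ t A B i} : HasType Γ t A → Conv A B → HasType Γ B (.univ i) → HasType Γ t B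

/-- The closed type `A` is a theorem: it has a closed term. -/
def Provable (A : Exp) : Prop := ∃ t : Tm, HasType [] t A.close

/-! ### Surjections and truncation fibrations -/

def one : Exp := succ zero
def two : Exp := succ one

/-- `A × B` -/
def prod : Exp := lam fun A => lam fun B => sig A (lam fun _ => B)

/-- Logical equivalence. -/
def iff : Exp := lam fun A => lam fun B => prod (arr A B) (arr B A)

/-- `isSurj A B f` is `Π (b : B), ‖fib f b‖₋₁`. -/
def isSurj : Exp := lam fun A => lam fun B => lam fun f =>
  pi B fun b => trunc one (fib A B f b)

/-- `truncMap k A B f : trunc k A → trunc k B` is the functorial action of the truncation; it sends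
`tr k A a` to `tr k B (f a)`. -/
def truncMap : Exp := lam fun k => lam fun A => lam fun B => lam fun f => lam fun u =>
  indTrunc k A (lam fun _ => trunc k B) (lam fun _ => truncIsType k B)
    (lam fun a => tr k B (f a)) u

/-- `idIsType i k A h x y : isType i k (x = y)`, for `h : isType i k A` and `x y : A`. -/
def idIsType (i : ℕ) : Exp := lam fun k =>
  indNat
    (lam fun k => pi (univ i) fun A => arr (isType i k A)
      (pi A fun x => pi A fun y => isType i k (idt A x y)))
    (lam fun A => lam fun h => lam fun x => lam fun y =>
      let P : Exp := lam fun a => pi A fun a' => idt A a a'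
      let c : Exp := fst A P h
      let e : Exp := snd A P h
      let r : Exp → Exp → Exp := fun x y => concat A x c y (inv A c x (e x)) (e y)
      pair (idt A x y) (lam fun p => pi (idt A x y) fun q => idt (idt A x y) p q) (r x y)
        (lam fun q => indId A
          (lam fun x => lam fun y => lam fun q => idt (idt A x y) (r x y) q)
          (lam fun x => invConcat A c x (e x)) x y q))
    (lam fun _ => lam fun H => lam fun A => lam fun h => lam fun x => lam fun y =>
      lam fun p => lam fun q => H (idt A x y) (h x y) p q)
    k

/-- `modalFib k X Y f y` is the fiber of `truncMap k X Y f` over `tr k Y y`. -/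
def modalFib : Exp := lam fun k => lam fun X => lam fun Y => lam fun f => lam fun y =>
  fib (trunc k X) (trunc k Y) (truncMap k X Y f) (tr k Y y)

/-- The map `δ : fib f y → modalFib k X Y f y`, `(x, p) ↦ (tr x, ap tr p)`, induced on fibers by
the naturality square of the unit. -/
def delta : Exp := lam fun k => lam fun X => lam fun Y => lam fun f => lam fun y => lam fun w =>
  let P : Exp := lam fun x => idt Y (f x) y
  pair (trunc k X) (lam fun u => idt (trunc k Y) (truncMap k X Y f u) (tr k Y y))
    (tr k X (fst X P w)) (ap Y (trunc k Y) (tr k Y) (f (fst X P w)) y (snd X P w))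

/-- The map `γ : trunc k (fib f y) → modalFib k X Y f y` through which `δ` factors: it is given by
induction on the truncation, and `γ (tr w)` is convertible to `δ w`. The first component is the
functorial action on the projection `fib f y → X`, and the second one exists because the identity
types of `trunc k Y` are `(k - 2)`-types. -/
def gamma (i : ℕ) : Exp := lam fun k => lam fun X => lam fun Y => lam fun f => lam fun y =>
  lam fun u =>
  let P : Exp := lam fun x => idt Y (f x) y
  let F : Exp := fib X Y f y
  let g : Exp → Exp := fun u => truncMap k F X (lam fun w => fst X P w) u
  pair (trunc k X) (lam fun v => idt (trunc k Y) (truncMap k X Y f v) (tr k Y y)) (g u)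
    (indTrunc k F
      (lam fun u => idt (trunc k Y) (truncMap k X Y f (g u)) (tr k Y y))
      (lam fun u => idIsType i k (trunc k Y) (truncIsType k Y)
        (truncMap k X Y f (g u)) (tr k Y y))
      (lam fun w => ap Y (trunc k Y) (tr k Y) (f (fst X P w)) y (snd X P w)) u)

/-- `isTruncFibration i k X Y f`, for `X Y : U_i`, says that `f` is a `‖-‖`-fibration for the
truncation at level `k - 2`: `γ` is an equivalence for every `y : Y`. -/
def isTruncFibration (i : ℕ) : Exp := lam fun k => lam fun X => lam fun Y => lam fun f =>
  pi Y fun y => isEquiv (trunc k (fib X Y f y)) (modalFib k X Y f y) (gamma i k X Y f y)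

/-! ### Homotopy groups -/

/-- The underlying type of the iterated loop space: `Ω⁰(A, a) = A` and
`Ω^(k+1)(A, a) = Ω^k(a = a, refl)`. -/
def loopSpace (i : ℕ) : Exp := lam fun k =>
  indNat (lam fun _ => pi (univ i) fun A => arr A (univ i))
    (lam fun A => lam fun _ => A)
    (lam fun _ => lam fun L => lam fun A => lam fun a => L (idt A a a) (refl A a)) k

/-- `loopMap i k A B a b f p : Ω^k(A, a) → Ω^k(B, b)` is the action of the pointed map given by
`f : A → B` and `p : f a = b`: `Ω⁰(f, p) = f` and `Ω^(k+1)(f, p) = Ω^k(Ω(f, p))`, where `Ω(f, p)` is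
`q ↦ p⁻¹ · (ap f q · p)` with its identification of the image of `refl` with `refl`. -/
def loopMap (i : ℕ) : Exp := lam fun k =>
  indNat
    (lam fun k => pi (univ i) fun A => pi (univ i) fun B => pi A fun a => pi B fun b =>
      pi (arr A B) fun f => arr (idt B (f a) b) (arr (loopSpace i k A a) (loopSpace i k B b)))
    (lam fun _ => lam fun _ => lam fun _ => lam fun _ => lam fun f => lam fun _ => f)
    (lam fun _ => lam fun M => lam fun A => lam fun B => lam fun a => lam fun b => lam fun f =>
      lam fun p =>
      M (idt A a a) (idt B b b) (refl A a) (refl B b)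
        (lam fun q => concat B b (f a) b (inv B (f a) b p)
          (concat B (f a) (f a) b (ap A B f a a q) p))
        (invConcat B (f a) b p))
    k

/-- `homotopyGroup i k A a` is (the underlying set of) `π_k(A, a) = ‖Ω^k(A, a)‖₀`. -/
def homotopyGroup (i : ℕ) : Exp := lam fun k => lam fun A => lam fun a =>
  trunc two (loopSpace i k A a)

/-- `homotopyGroupMap i k A B a b f p : π_k(A, a) → π_k(B, b)` is the map induced by `f : A → B`
and `p : f a = b`. -/
def homotopyGroupMap (i : ℕ) : Exp := lam fun k => lam fun A => lam fun B =>
  lam fun a => lam fun b => lam fun f => lam fun p =>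
  truncMap two (loopSpace i k A a) (loopSpace i k B b) (loopMap i k A B a b f p)

/-- `isSurjOnHomotopyGroups i k X Y f`: for all `y : Y` and `(x, p) : fib f y`, the induced map
`π_k(X, x) → π_k(Y, y)` is surjective. -/
def isSurjOnHomotopyGroups (i : ℕ) : Exp := lam fun k => lam fun X => lam fun Y => lam fun f =>
  pi Y fun y => pi (fib X Y f y) fun w =>
    let P : Exp := lam fun x => idt Y (f x) y
    let x : Exp := fst X P w
    let p : Exp := snd X P w
    isSurj (homotopyGroup i k X x) (homotopyGroup i k Y y) (homotopyGroupMap i k X Y x y f p)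

end HoTT

/-! ### Renaming and substitution -/

namespace HoTT

namespace Tm

/-! The mathematical argument. Let `P` be the pullback of `‖X‖ₙ → ‖Y‖ₙ ← Y`. Since the target of `γ`
is an `n`-type, `γ` is an equivalence for every `y` exactly when the maps `δ = γ ∘ |-|ₙ` are
`n`-connected, and the fibers of `δ` are the fibers of the comparison map `X → P`. So `f` is a
fibration iff `X → P` is `n`-connected (`isTruncFibration_iff_connPull`).

This is generalized to a form that survives passage to path spaces: an `n`-connected map `η : Y →
Y'` to an `n`-type, a family `B` of `n`-types over `Y'`, and an `n`-connected map `X → Σ Y' B` lying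
over `η ∘ f`. Then `X → Σ (y : Y), B (η y)` is `n`-connected iff `f` is surjective on `(n+1)`-fold
path spaces (`connPull_iff`). The proof is by induction on `n`, from the fact that a map is
`(n+1)`-connected iff it is surjective and `n`-connected on all path spaces (`isConnMap_ap`,
`isConnMap_of_ap`). In the inductive step surjectivity is automatic (`toPull_isSurj`), and the path
spaces carry data of the same kind one level lower. At `n = -1` the types over `Y'` are
propositions, and only surjectivity of `f` remains.

Path induction replaces path spaces by loop spaces (`isSurjOnLoops_iff`), and set truncation neither
creates nor destroys surjectivity (`isSurj_truncMap_iff`). Connectedness is controlled through one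
fact on truncations: `‖x = x'‖` is a retract of `|x| = |x'|` one level up (`truncEncode_decode`),
which rests on univalence.

The formal argument. A closed term is wanted, so the proof above is written as annotated terms in
the lowest universe. A type checker is proved sound for `HasType` and is run by the kernel on these
terms (`library_check`, `fibrationCriterion_check`). Typing is invariant under raising all universe
levels (`HasType.lvl`), which yields every `i`. -/

theorem upRen_comp (r r' : ℕ → ℕ) : upRen (r ∘ r') = upRen r ∘ upRen r' := by
  funext n; cases n <;> rfl

theorem upRen_id : upRen id = id := by
  funext n; cases n <;> rfl

theorem ren_id (t : Tm) : ren id t = t := by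
  induction t with
  | pi A B hA hB => simp [ren, upRen_id, hA, hB]
  | lam t ht => simp [ren, upRen_id, ht]
  | app t u ht hu => simp [ren, ht, hu]
  | _ => rfl

theorem ren_ren (r r' : ℕ → ℕ) (t : Tm) : ren r (ren r' t) = ren (r ∘ r') t := by
  induction t generalizing r r' with
  | pi A B hA hB => simp [ren, upRen_comp, hA, hB]
  | lam t ht => simp [ren, upRen_comp, ht]
  | app t u ht hu => simp [ren, ht, hu]
  | _ => rfl

theorem up_comp_upRen (s : ℕ → Tm) (r : ℕ → ℕ) : up (s ∘ r) = up s ∘ upRen r := by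
  funext n; cases n <;> rfl

theorem subst_ren (s : ℕ → Tm) (r : ℕ → ℕ) (t : Tm) : subst s (ren r t) = subst (s ∘ r) t := by
  induction t generalizing s r with
  | pi A B hA hB => simp [ren, subst, up_comp_upRen, hA, hB]
  | lam t ht => simp [ren, subst, up_comp_upRen, ht]
  | app t u ht hu => simp [ren, subst, ht, hu]
  | _ => rfl

theorem shift_ren (r : ℕ → ℕ) (t : Tm) : shift 1 (ren r t) = ren (upRen r) (shift 1 t) := by
  simp only [shift, ren_ren]; rfl

theorem up_ren_comp (r : ℕ → ℕ) (s : ℕ → Tm) :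
    up (ren r ∘ s) = ren (upRen r) ∘ up s := by
  funext n
  cases n with
  | zero => rfl
  | succ n => exact shift_ren r (s n)

theorem ren_subst (r : ℕ → ℕ) (s : ℕ → Tm) (t : Tm) :
    ren r (subst s t) = subst (ren r ∘ s) t := by
  induction t generalizing s r with
  | pi A B hA hB => simp [ren, subst, up_ren_comp, hA, hB]
  | lam t ht => simp [ren, subst, up_ren_comp, ht]
  | app t u ht hu => simp [ren, subst, ht, hu]
  | _ => rfl

theorem shift_subst (s : ℕ → Tm) (t : Tm) : shift 1 (subst s t) = subst (up s) (shift 1 t) := by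
  simp only [shift, ren_subst, subst_ren]; rfl

theorem up_subst_comp (s s' : ℕ → Tm) : up (subst s ∘ s') = subst (up s) ∘ up s' := by
  funext n
  cases n with
  | zero => rfl
  | succ n => exact shift_subst s (s' n)

theorem subst_subst (s s' : ℕ → Tm) (t : Tm) :
    subst s (subst s' t) = subst (subst s ∘ s') t := by
  induction t generalizing s s' with
  | pi A B hA hB => simp [subst, up_subst_comp, hA, hB]
  | lam t ht => simp [subst, up_subst_comp, ht]
  | app t u ht hu => simp [subst, ht, hu]
  | _ => rfl

theorem up_var : up var = var := by
  funext n; cases n <;> rfl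

theorem subst_var (t : Tm) : subst var t = t := by
  induction t with
  | pi A B hA hB => simp [subst, up_var, hA, hB]
  | lam t ht => simp [subst, up_var, ht]
  | app t u ht hu => simp [subst, ht, hu]
  | _ => rfl

theorem up_var_comp (r : ℕ → ℕ) : up (var ∘ r) = var ∘ upRen r := by
  funext n; cases n <;> rfl

theorem ren_eq_subst (r : ℕ → ℕ) (t : Tm) : ren r t = subst (var ∘ r) t := by
  induction t generalizing r with
  | pi A B hA hB => simp [ren, subst, up_var_comp, hA, hB]
  | lam t ht => simp [ren, subst, up_var_comp, ht]
  | app t u ht hu => simp [ren, subst, ht, hu]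
  | _ => rfl

/-- The substitution of `u` for the variable `0`. -/
def single (u : Tm) : ℕ → Tm
  | 0 => u
  | k + 1 => var k

theorem inst_eq (t u : Tm) : t.inst u = subst (single u) t := by
  unfold inst
  congr 1

theorem inst_shift (t u : Tm) : (t.shift 1).inst u = t := by
  rw [inst_eq, shift, subst_ren]
  exact subst_var t

theorem subst_inst (s : ℕ → Tm) (t u : Tm) :
    subst s (t.inst u) = (subst (up s) t).inst (subst s u) := by
  simp only [inst_eq, subst_subst]
  congr 1
  funext n
  cases n with
  | zero => rfl
  | succ n =>
    have h := inst_shift (s n) (subst s u)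
    rw [inst_eq] at h
    exact h.symm

theorem ren_inst (r : ℕ → ℕ) (t u : Tm) :
    ren r (t.inst u) = (ren (upRen r) t).inst (ren r u) := by
  simp only [ren_eq_subst, subst_inst, up_var_comp]

theorem shift_zero (t : Tm) : t.shift 0 = t := ren_id t

theorem shift_shift (j k : ℕ) (t : Tm) : (t.shift j).shift k = t.shift (j + k) := by
  simp only [shift, ren_ren]
  congr 1
  funext n
  simp only [Function.comp_apply]
  omega

/-- Raises all universe levels by `k`. -/
def lvl (k : ℕ) : Tm → Tm
  | var n => var n
  | univ i => univ (k + i)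
  | pi A B => pi (lvl k A) (lvl k B)
  | lam t => lam (lvl k t)
  | app t u => app (lvl k t) (lvl k u)
  | con (.funext i) => con (.funext (k + i))
  | con (.ua i) => con (.ua (k + i))
  | con c => con c

end Tm

/-- Raises the universe level of a constant by `k`. -/
def Con.lvl (k : ℕ) : Con → Con
  | .funext i => .funext (k + i)
  | .ua i => .ua (k + i)
  | c => c

namespace Tm

theorem lvl_con (k : ℕ) (c : Con) : (con c).lvl k = con (c.lvl k) := by
  cases c <;> rfl

theorem lvl_ren (k : ℕ) (r : ℕ → ℕ) (t : Tm) : (ren r t).lvl k = ren r (t.lvl k) := by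
  induction t generalizing r with
  | pi A B hA hB => simp [ren, lvl, hA, hB]
  | lam t ht => simp [ren, lvl, ht]
  | app t u ht hu => simp [ren, lvl, ht, hu]
  | con c => simp [ren, lvl_con]
  | _ => rfl

theorem lvl_up (k : ℕ) (s : ℕ → Tm) : lvl k ∘ up s = up (lvl k ∘ s) := by
  funext n
  cases n with
  | zero => rfl
  | succ n => exact lvl_ren k _ (s n)

theorem lvl_subst (k : ℕ) (s : ℕ → Tm) (t : Tm) :
    (subst s t).lvl k = subst (lvl k ∘ s) (t.lvl k) := by
  induction t generalizing s with
  | pi A B hA hB => simp [subst, lvl, lvl_up, hA, hB]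
  | lam t ht => simp [subst, lvl, lvl_up, ht]
  | app t u ht hu => simp [subst, lvl, ht, hu]
  | con c => simp [subst, lvl_con]
  | _ => rfl

theorem lvl_inst (k : ℕ) (t u : Tm) : (t.inst u).lvl k = (t.lvl k).inst (u.lvl k) := by
  simp only [inst_eq, lvl_subst]
  congr 1
  funext n; cases n <;> rfl

theorem lvl_shift (k n : ℕ) (t : Tm) : (t.shift n).lvl k = (t.lvl k).shift n :=
  lvl_ren k _ t

theorem lvl_lvl (j k : ℕ) (t : Tm) : (t.lvl j).lvl k = t.lvl (k + j) := by
  induction t with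
  | pi A B hA hB => simp [lvl, hA, hB]
  | lam t ht => simp [lvl, ht]
  | app t u ht hu => simp [lvl, ht, hu]
  | con c => cases c <;> simp [lvl, Nat.add_assoc]
  | _ => simp [lvl, Nat.add_assoc]

end Tm

/-! ### Convertibility and typing under substitution and change of level -/

theorem Conv.subst {t u : Tm} (h : Conv t u) (s : ℕ → Tm) : Conv (t.subst s) (u.subst s) := by
  induction h generalizing s with
  | refl t => exact .refl _
  | symm _ ih => exact .symm (ih s)
  | trans _ _ ih ih' => exact .trans (ih s) (ih' s)
  | pi _ _ ih ih' => exact .pi (ih s) (ih' _)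
  | lam _ ih => exact .lam (ih _)
  | app _ _ ih ih' => exact .app (ih s) (ih' s)
  | beta t u => rw [Tm.subst_inst]; exact .beta _ _
  | eta t =>
    have h := Tm.shift_subst s t
    have := Conv.eta (t.subst s)
    rw [h] at this
    exact this
  | unit C c => exact .unit _ _
  | inl => exact .inl ..
  | inr => exact .inr ..
  | pair => exact .pair ..
  | zero => exact .zero ..
  | succ => exact .succ ..
  | id => exact .id ..
  | trunc => exact .trunc ..

theorem Conv.ren {t u : Tm} (h : Conv t u) (r : ℕ → ℕ) : Conv (t.ren r) (u.ren r) := by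
  simp only [Tm.ren_eq_subst]
  exact h.subst _

theorem Conv.lvl {t u : Tm} (h : Conv t u) (k : ℕ) : Conv (t.lvl k) (u.lvl k) := by
  induction h with
  | refl t => exact .refl _
  | symm _ ih => exact .symm ih
  | trans _ _ ih ih' => exact .trans ih ih'
  | pi _ _ ih ih' => exact .pi ih ih'
  | lam _ ih => exact .lam ih
  | app _ _ ih ih' => exact .app ih ih'
  | beta t u => rw [Tm.lvl_inst]; exact .beta _ _
  | eta t =>
    have := Conv.eta (t.lvl k)
    rw [← Tm.lvl_shift] at this
    exact this
  | unit C c => exact .unit _ _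
  | inl => exact .inl ..
  | inr => exact .inr ..
  | pair => exact .pair ..
  | zero => exact .zero ..
  | succ => exact .succ ..
  | id => exact .id ..
  | trunc => exact .trunc ..

theorem Con.subst_type (s : ℕ → Tm) (i j : ℕ) (c : Con) : (c.type i j).subst s = c.type i j := by
  cases c <;> rfl

theorem Con.ren_type (r : ℕ → ℕ) (i j : ℕ) (c : Con) : (c.type i j).ren r = c.type i j := by
  rw [Tm.ren_eq_subst, Con.subst_type]

/-- The levels `i` and `j` enter the types of constants uniformly; only `funext` and `ua` have a
level of their own, which moves along. -/
theorem Con.lvl_type (k i j : ℕ) (c : Con) :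
    (c.type i j).lvl k = (c.lvl k).type (k + i) (k + j) := by
  cases c <;> rfl

/-- Types in a context live over its tail, so `hr` compares them after both are weakened to the full
contexts. This form passes under binders (`hup`). -/
theorem HasType.ren {Γ : List Tm} {t A : Tm} (h : HasType Γ t A) {Δ : List Tm} {r : ℕ → ℕ}
    (hr : ∀ n B, Γ[n]? = some B →
      ∃ B', Δ[r n]? = some B' ∧ B'.shift (r n + 1) = (B.shift (n + 1)).ren r) :
    HasType Δ (t.ren r) (A.ren r) := by
  have hup {Γ Δ : List Tm} {r : ℕ → ℕ} {C : Tm}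
      (hr : ∀ n B, Γ[n]? = some B →
        ∃ B', Δ[r n]? = some B' ∧ B'.shift (r n + 1) = (B.shift (n + 1)).ren r) :
      ∀ n B, (C :: Γ)[n]? = some B → ∃ B', (C.ren r :: Δ)[Tm.upRen r n]? = some B' ∧
        B'.shift (Tm.upRen r n + 1) = (B.shift (n + 1)).ren (Tm.upRen r) := by
    intro n B hB
    cases n with
    | zero =>
      obtain rfl : C = B := by simpa using hB
      exact ⟨_, rfl, Tm.shift_ren r C⟩
    | succ n =>
      obtain ⟨B', h1, h2⟩ := hr n B (by simpa using hB)
      refine ⟨B', by simpa [Tm.upRen] using h1, ?_⟩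
      have h3 := congrArg (Tm.shift 1) h2
      rw [Tm.shift_ren, Tm.shift_shift, Tm.shift_shift] at h3
      exact h3
  induction h generalizing Δ r with
  | var hA =>
    obtain ⟨B', h1, h2⟩ := hr _ _ hA
    rw [← h2]
    exact .var h1
  | univ i => exact .univ i
  | cumul _ ih => exact .cumul (ih hr)
  | pi _ _ ih ih' => exact .pi (ih hr) (ih' (hup hr))
  | lam _ _ ih ih' => exact .lam (ih hr) (ih' (hup hr))
  | app _ _ ih ih' =>
    rw [Tm.ren_inst]
    exact .app (ih hr) (ih' hr)
  | con c i j => rw [Con.ren_type]; exact .con c i j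
  | conv _ hc _ ih ih' => exact .conv (ih hr) (hc.ren r) (ih' hr)

theorem HasType.shift_append {Γ : List Tm} {t A : Tm} (h : HasType Γ t A) (Θ : List Tm) :
    HasType (Θ ++ Γ) (t.shift Θ.length) (A.shift Θ.length) := by
  refine h.ren fun n B hB => ⟨B, ?_, ?_⟩
  · rw [List.getElem?_append_right (by omega)]
    simpa using hB
  · rw [← Tm.shift, Tm.shift_shift]
    congr 1
    omega

theorem HasType.subst {Γ : List Tm} {t A : Tm} (h : HasType Γ t A) {Δ : List Tm} {s : ℕ → Tm}
    (hs : ∀ n B, Γ[n]? = some B → HasType Δ (s n) ((B.shift (n + 1)).subst s)) :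
    HasType Δ (t.subst s) (A.subst s) := by
  have hup {Γ Δ : List Tm} {s : ℕ → Tm} {C : Tm}
      (hs : ∀ n B, Γ[n]? = some B → HasType Δ (s n) ((B.shift (n + 1)).subst s)) :
      ∀ n B, (C :: Γ)[n]? = some B →
        HasType (C.subst s :: Δ) (Tm.up s n) ((B.shift (n + 1)).subst (Tm.up s)) := by
    intro n B hB
    cases n with
    | zero =>
      obtain rfl : C = B := by simpa using hB
      rw [← Tm.shift_subst]
      exact .var rfl
    | succ n =>
      have h1 := (hs n B (by simpa using hB)).shift_append [C.subst s]
      rw [List.length_singleton, Tm.shift_subst, Tm.shift_shift] at h1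
      exact h1
  induction h generalizing Δ s with
  | var hA => exact hs _ _ hA
  | univ i => exact .univ i
  | cumul _ ih => exact .cumul (ih hs)
  | pi _ _ ih ih' => exact .pi (ih hs) (ih' (hup hs))
  | lam _ _ ih ih' => exact .lam (ih hs) (ih' (hup hs))
  | app _ _ ih ih' => rw [Tm.subst_inst]; exact .app (ih hs) (ih' hs)
  | con c i j => rw [Con.subst_type]; exact .con c i j
  | conv _ hc _ ih ih' => exact .conv (ih hs) (hc.subst s) (ih' hs)

theorem HasType.inst {Γ : List Tm} {t u A B : Tm} (h : HasType (A :: Γ) t B)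
    (hu : HasType Γ u A) : HasType Γ (t.inst u) (B.inst u) := by
  simp only [Tm.inst_eq]
  refine h.subst fun n C hC => ?_
  cases n with
  | zero =>
    obtain rfl : A = C := by simpa using hC
    rw [← Tm.inst_eq, Tm.inst_shift]
    exact hu
  | succ n =>
    have h1 : (C.shift (n + 1 + 1)).subst (Tm.single u) = C.shift (n + 1) := by
      rw [← Tm.shift_shift, ← Tm.inst_eq, Tm.inst_shift]
    rw [h1]
    exact .var (by simpa using hC)

/-- No typing rule singles out an absolute universe level, so a uniform shift maps derivations to
derivations. It gives universe polymorphism: a library entry can be reused one universe higher, and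
the main term is moved to level `i`. -/
theorem HasType.lvl {Γ : List Tm} {t A : Tm} (h : HasType Γ t A) (k : ℕ) :
    HasType (Γ.map (Tm.lvl k)) (t.lvl k) (A.lvl k) := by
  induction h with
  | var hA => rw [Tm.lvl_shift]; exact .var (by simp [hA])
  | univ i => exact .univ (k + i)
  | cumul _ ih => exact .cumul ih
  | pi _ _ ih ih' => exact .pi ih ih'
  | lam _ _ ih ih' => exact .lam ih ih'
  | app _ _ ih ih' => rw [Tm.lvl_inst]; exact .app ih ih'
  | con c i j => rw [Tm.lvl_con, Con.lvl_type]; exact .con _ _ _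
  | conv _ hc _ ih ih' => exact .conv ih (hc.lvl k) ih'

/-- A typed term has no free variables beyond its context. For the empty context, closed terms are
fixed by every substitution. -/
theorem HasType.subst_eq {Γ : List Tm} {t A : Tm} (h : HasType Γ t A) {s : ℕ → Tm}
    (hs : ∀ n < Γ.length, s n = .var n) : t.subst s = t := by
  have hup {Γ : List Tm} {s : ℕ → Tm} {C : Tm} (hs : ∀ n < Γ.length, s n = .var n) :
      ∀ n < (C :: Γ).length, Tm.up s n = .var n := by
    intro n hn
    cases n with
    | zero => rfl
    | succ n => simp [Tm.up, hs n (by simpa using hn), Tm.shift, Tm.ren]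
  induction h generalizing s with
  | var hA => exact hs _ (List.getElem?_eq_some_iff.mp hA).1
  | pi _ _ ih ih' => simp [Tm.subst, ih hs, ih' (hup hs)]
  | lam _ _ _ ih' => simp [Tm.subst, ih' (hup hs)]
  | app _ _ ih ih' => simp [Tm.subst, ih hs, ih' hs]
  | cumul _ ih => exact ih hs
  | conv _ _ _ ih _ => exact ih hs
  | _ => rfl

theorem HasType.closed {t A : Tm} (h : HasType [] t A) (s : ℕ → Tm) : t.subst s = t :=
  h.subst_eq fun _ hn => absurd hn (Nat.not_lt_zero _)

theorem HasType.closed_ren {t A : Tm} (h : HasType [] t A) (r : ℕ → ℕ) : t.ren r = t := by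
  rw [Tm.ren_eq_subst, h.closed]

/-- Cumulativity and conversion keep the subject of the judgment, so a derivation for a product
always goes back to the formation rule. -/
theorem HasType.pi_inv {Γ : List Tm} {A B T : Tm} (h : HasType Γ (.pi A B) T) :
    ∃ i, HasType Γ A (.univ i) ∧ HasType (A :: Γ) B (.univ i) := by
  generalize ht : Tm.pi A B = t at h
  induction h with
  | pi h h' => cases ht; exact ⟨_, h, h'⟩
  | cumul _ ih => exact ih ht
  | conv _ _ _ ih _ => exact ih ht
  | _ => cases ht

theorem HasType.cumul_le {Γ : List Tm} {A : Tm} {i j : ℕ} (h : HasType Γ A (.univ i))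
    (hij : i ≤ j) : HasType Γ A (.univ j) := by
  induction hij with
  | refl => exact h
  | step _ ih => exact ih.cumul

end HoTT

/-! ### A type checker for annotated terms -/

namespace HoTT

/-- Terms in which the constants carry their levels and closed terms may be referred to by name:
`con c n l` and `glob n l` stand for the `n`-th entry of an environment, with its universe levels
raised by `l`. -/
inductive Pre : Type
  | var (n : ℕ)
  | univ (i : ℕ)
  | pi (A B : Pre)
  | lam (t : Pre)
  | app (t u : Pre)
  | con (c : Con) (n l : ℕ)
  | glob (n l : ℕ)

namespace Con

/-- The number of a constant, without its level. -/
def code : Con → ℕ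
  | empty => 0 | indEmpty => 1 | unit => 2 | star => 3 | indUnit => 4 | sum => 5 | inl => 6
  | inr => 7 | indSum => 8 | sig => 9 | pair => 10 | indSig => 11 | nat => 12 | zero => 13
  | succ => 14 | indNat => 15 | idt => 16 | refl => 17 | indId => 18 | trunc => 19 | tr => 20
  | truncIsType => 21 | indTrunc => 22 | funext _ => 23 | ua _ => 24

/-- The level of a constant. -/
def level : Con → ℕ
  | funext i => i
  | ua i => i
  | _ => 0

/-- The constant with a given number and level. -/
def decode : ℕ → ℕ → Con
  | 0, _ => empty | 1, _ => indEmpty | 2, _ => unit | 3, _ => star | 4, _ => indUnit | 5, _ => sum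
  | 6, _ => inl | 7, _ => inr | 8, _ => indSum | 9, _ => sig | 10, _ => pair | 11, _ => indSig
  | 12, _ => nat | 13, _ => zero | 14, _ => succ | 15, _ => indNat | 16, _ => idt | 17, _ => refl
  | 18, _ => indId | 19, _ => trunc | 20, _ => tr | 21, _ => truncIsType | 22, _ => indTrunc
  | 23, i => funext i | _, i => ua i

/-- A left inverse of the numbering makes the Boolean test on numbers and levels sound, without
comparing constructors pairwise. -/
theorem decode_code (c : Con) : decode c.code c.level = c := by
  cases c <;> rfl

/-- Boolean equality of constants. -/
def beq (c d : Con) : Bool := Nat.beq c.code d.code && Nat.beq c.level d.level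

theorem eq_of_beq {c d : Con} (h : c.beq d = true) : c = d := by
  rw [beq, Bool.and_eq_true] at h
  rw [← decode_code c, ← decode_code d, Nat.eq_of_beq_eq_true h.1, Nat.eq_of_beq_eq_true h.2]

end Con

/-- Boolean equality of terms. -/
def Tm.beq : Tm → Tm → Bool
  | var n, var m => Nat.beq n m
  | univ i, univ j => Nat.beq i j
  | pi A B, pi A' B' => beq A A' && beq B B'
  | lam t, lam t' => beq t t'
  | app t u, app t' u' => beq t t' && beq u u'
  | con c, con c' => c.beq c'
  | _, _ => false

theorem Tm.eq_of_beq {t u : Tm} (h : t.beq u = true) : t = u := by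
  induction t generalizing u <;> cases u <;> simp [beq] at h
  · rw [h]
  · rw [h]
  · rename_i ih ih' _ _; rw [ih h.1, ih' h.2]
  · rename_i ih _; rw [ih h]
  · rename_i ih ih' _ _; rw [ih h.1, ih' h.2]
  · rw [Con.eq_of_beq h]

namespace Pre

/-- Adds `k` to the variables from `c` on. -/
def lift (k : ℕ) : ℕ → Pre → Pre
  | c, var n => bif Nat.blt n c then var n else var (n + k)
  | _, univ i => univ i
  | c, pi A B => pi (lift k c A) (lift k (c + 1) B)
  | c, lam t => lam (lift k (c + 1) t)
  | c, app t u => app (lift k c t) (lift k c u)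
  | _, con c n l => con c n l
  | _, glob n l => glob n l

/-- Puts `u` for the variable `d`. -/
def instAt (u : Pre) : ℕ → Pre → Pre
  | d, var n => bif Nat.blt n d then var n else bif Nat.beq n d then lift d 0 u else var (n - 1)
  | _, univ i => univ i
  | d, pi A B => pi (instAt u d A) (instAt u (d + 1) B)
  | d, lam t => lam (instAt u (d + 1) t)
  | d, app t v => app (instAt u d t) (instAt u d v)
  | _, con c n l => con c n l
  | _, glob n l => glob n l

/-- Puts `u` for the variable `0`. -/
def inst (t u : Pre) : Pre := instAt u 0 t

/-- Raises all universe levels by `k`. -/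
def lvl (k : ℕ) : Pre → Pre
  | var n => var n
  | univ i => univ (k + i)
  | pi A B => pi (lvl k A) (lvl k B)
  | lam t => lam (lvl k t)
  | app t u => app (lvl k t) (lvl k u)
  | con c n l => con (c.lvl k) n (k + l)
  | glob n l => glob n (k + l)

/-- Boolean equality, up to the annotations of constants. -/
def beq : Pre → Pre → Bool
  | var n, var m => Nat.beq n m
  | univ i, univ j => Nat.beq i j
  | pi A B, pi A' B' => beq A A' && beq B B'
  | lam t, lam t' => beq t t'
  | app t u, app t' u' => beq t t' && beq u u'
  | con c _ _, con c' _ _ => c.beq c'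
  | glob n l, glob n' l' => Nat.beq n n' && Nat.beq l l'
  | _, _ => false

/-- Only the first `k` entries of an environment occur. -/
def bounded (k : ℕ) : Pre → Bool
  | pi A B => bounded k A && bounded k B
  | lam t => bounded k t
  | app t u => bounded k t && bounded k u
  | glob n _ => Nat.blt n k
  | _ => true

/-- Iterated application. -/
def apps (t : Pre) (ts : List Pre) : Pre := ts.foldl app t

end Pre

/-- A closed term `tm` of type `ty`; `unf` is the term with annotations if it may be unfolded. -/
structure Entry where
  ty : Pre
  tm : Tm
  unf : Option Pre

/-- A finite sequence of entries, as a binary trie. -/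
inductive Env : Type
  | leaf
  | node (e : Entry) (l r : Env)

namespace Env

def get : Env → ℕ → Option Entry
  | leaf, _ => none
  | node e l r, n =>
    bif Nat.beq n 0 then some e
    else bif Nat.beq (n % 2) 1 then get l (n / 2) else get r (n / 2 - 1)

/-- Puts `e` at position `n`, if all smaller positions are occupied and `n` is not. -/
def insert (e : Entry) : Env → ℕ → Env
  | leaf, n => bif Nat.beq n 0 then node e leaf leaf else leaf
  | node e' l r, n =>
    bif Nat.beq n 0 then node e' l r
    else bif Nat.beq (n % 2) 1 then node e' (insert e l (n / 2)) r
    else node e' l (insert e r (n / 2 - 1))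

theorem beq_eq_decide (n m : ℕ) : Nat.beq n m = decide (n = m) := by
  rw [Bool.eq_iff_iff, decide_eq_true_iff]
  exact ⟨Nat.eq_of_beq_eq_true, fun h => h ▸ Nat.beq_refl n⟩

theorem get_insert (e : Entry) (E : Env) {m n : ℕ} (h : m ≠ n) :
    (E.insert e n).get m = E.get m := by
  induction E generalizing m n with
  | leaf =>
    by_cases hn : n = 0
    · subst hn
      simp [insert, get, beq_eq_decide, h]
    · simp [insert, beq_eq_decide, hn]
  | node e' l r hl hr =>
    by_cases hn : n = 0
    · simp [insert, beq_eq_decide, hn]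
    by_cases hn2 : n % 2 = 1 <;> by_cases hm : m = 0 <;> by_cases hm2 : m % 2 = 1 <;>
      simp [insert, get, beq_eq_decide, hn, hn2, hm, hm2, -Nat.mod_two_not_eq_one]
    · exact hl (by omega)
    · exact hr (by omega)

/-- The alternative is needed because insertion never overwrites an occupied position. -/
theorem get_insert_self (e : Entry) (E : Env) {n : ℕ} {e' : Entry}
    (h : (E.insert e n).get n = some e') : e' = e ∨ E.get n = some e' := by
  induction E generalizing n with
  | leaf =>
    by_cases hn : n = 0
    · subst hn
      left; simpa [insert, get, beq_eq_decide, eq_comm] using h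
    · simp [insert, beq_eq_decide, hn, get] at h
  | node e'' l r hl hr =>
    by_cases hn : n = 0
    · right; simpa [insert, beq_eq_decide, hn] using h
    by_cases hn2 : n % 2 = 1 <;>
      simp [insert, get, beq_eq_decide, hn, hn2, -Nat.mod_two_not_eq_one] at h ⊢
    · exact hl h
    · exact hr h

/-- The annotated form of the entry `n` at level `l`, if it may be unfolded. -/
def unfold (E : Env) (n l : ℕ) : Option Pre :=
  match E.get n with
  | some e => match e.unf with
    | some v => some (v.lvl l)
    | none => none
  | none => none

/-- The term with the annotations removed and the entries inserted. -/
def erase (E : Env) : Pre → Tm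
  | .var n => .var n
  | .univ i => .univ i
  | .pi A B => .pi (erase E A) (erase E B)
  | .lam t => .lam (erase E t)
  | .app t u => .app (erase E t) (erase E u)
  | .con c _ _ => .con c
  | .glob n l => match E.get n with
    | some e => e.tm.lvl l
    -- An arbitrary closed value: type inference rejects a reference to a missing entry.
    | none => .con .star

end Env

/-- The `n`-fold iterate of `F`, as a function on fuel. -/
def iter {α : Type} (F : α → α) (a : α) : ℕ → α
  | 0 => a
  | n + 1 => F (iter F a n)

/-- An invariant of one step holds at every amount of fuel, so soundness needs no termination
argument. -/
theorem iter_induction {α : Type} {F : α → α} {a : α} (P : α → Prop) (h0 : P a)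
    (hs : ∀ b, P b → P (F b)) : ∀ n, P (iter F a n)
  | 0 => h0
  | n + 1 => hs _ (iter_induction P h0 hs n)

/-- The head and the arguments of a term whose head is a constant. -/
def constView : Pre × List Pre → Option (Con × List Pre)
  | (.con c _ _, ts) => some (c, ts)
  | _ => none

/-- The computation rule of the constant `c`, if one applies; `t` is `c` with its annotations,
`w` reduces a term to weak head normal form. -/
def iota (w : Pre → Pre × List Pre) (t : Pre) (c : Con) (st : List Pre) :
    Option (Pre × List Pre) :=
  match c with
  | .indUnit => match st with
    | _ :: x :: u :: st => match constView (w u) with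
      | some (.star, []) => some (x, st)
      | _ => none
    | _ => none
  | .indSum => match st with
    | _ :: _ :: _ :: l :: r :: s :: st => match constView (w s) with
      | some (.inl, [_, _, a]) => some (l, a :: st)
      | some (.inr, [_, _, b]) => some (r, b :: st)
      | _ => none
    | _ => none
  | .indSig => match st with
    | _ :: _ :: _ :: g :: s :: st => match constView (w s) with
      | some (.pair, [_, _, a, b]) => some (g, a :: b :: st)
      | _ => none
    | _ => none
  | .indNat => match st with
    | C :: z :: s :: n :: st => match constView (w n) with
      | some (.zero, []) => some (z, st)
      | some (.succ, [m]) => some (s, m :: t.apps [C, z, s, m] :: st)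
      | _ => none
    | _ => none
  | .indId => match st with
    | _ :: _ :: d :: _ :: _ :: p :: st => match constView (w p) with
      | some (.refl, [_, a]) => some (d, a :: st)
      | _ => none
    | _ => none
  | .indTrunc => match st with
    | _ :: _ :: _ :: _ :: g :: u :: st => match constView (w u) with
      | some (.tr, [_, _, a]) => some (g, a :: st)
      | _ => none
    | _ => none
  | _ => none

/-- One step of weak head reduction of `t` applied to `st`; entries are unfolded if `δ`. -/
def whnfStep (E : Env) (red : Bool → Pre → List Pre → Pre × List Pre) (δ : Bool) (t : Pre)
    (st : List Pre) : Pre × List Pre :=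
  match t with
  | .app f a => red δ f (a :: st)
  | .lam b => match st with
    | [] => (.lam b, [])
    | a :: st => red δ (b.inst a) st
  | .con c n l => match iota (fun u => red true u []) (.con c n l) c st with
    | some (h, st) => red δ h st
    | none => (.con c n l, st)
  | .glob n l => match δ with
    | true => match E.unfold n l with
      | some v => red δ v st
      | none => (.glob n l, st)
    | false => (.glob n l, st)
  | t => (t, st)

/-- Weak head reduction: a term applied to a list of terms becomes a head and its arguments. -/
def whnf (E : Env) : Bool → Pre → List Pre → Pre × List Pre :=
  -- Fuel bounds the depth of recursion. When it runs out the term is returned unreduced, which is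
  -- still sound.
  iter (whnfStep E) (fun _ t st => (t, st)) 10000

/-- Pairwise convertibility of lists. -/
def convList (cv : Pre → Pre → Bool) : List Pre → List Pre → Bool
  | [], [] => true
  | t :: ts, u :: us => cv t u && convList cv ts us
  | _, _ => false

/-- The name and the unfolding of an entry. -/
def unfoldHead (E : Env) : Pre → Option (ℕ × Pre)
  | .glob n l => match E.unfold n l with
    | some v => some (n, v)
    | none => none
  | _ => none

/-- Convertibility after the unfolding of a head; of two entries the later one is unfolded. -/
def convUnfold (E : Env) (cv : Pre → Pre → Bool) (t u : Pre) (ts us : List Pre) : Bool :=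
  match unfoldHead E t, unfoldHead E u with
  | some (n, v), some (m, w) =>
    bif Nat.blt m n then cv (v.apps ts) (u.apps us)
    else bif Nat.blt n m then cv (t.apps ts) (w.apps us)
    else cv (v.apps ts) (w.apps us)
  | some (_, v), none => cv (v.apps ts) (u.apps us)
  | none, some (_, w) => cv (t.apps ts) (w.apps us)
  | none, none => false

/-- Convertibility of terms in weak head normal form. -/
def convHead (E : Env) (cv : Pre → Pre → Bool) : Pre × List Pre → Pre × List Pre → Bool
  | (.pi A B, []), (.pi A' B', []) => cv A A' && cv B B'
  | (.lam t, []), (.lam t', []) => cv t t'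
  | (.lam t, []), (u, us) => cv t (.app ((u.apps us).lift 1 0) (.var 0))
  | (t, ts), (.lam u, []) => cv (.app ((t.apps ts).lift 1 0) (.var 0)) u
  | (t, ts), (u, us) => (t.beq u && convList cv ts us) || convUnfold E cv t u ts us

/-- The test for convertibility. -/
def conv (E : Env) : Pre → Pre → Bool :=
  -- Heads are not unfolded here, so that two applications of one entry are compared by their
  -- arguments before any definition is opened.
  iter (fun cv t u => t.beq u || convHead E cv (whnf E false t []) (whnf E false u []))
    (fun _ _ => false) 10000

/-- The level of a term that reduces to a universe. -/
def asUniv (E : Env) : Pre → Option ℕ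
  | .univ i => some i
  | t => match whnf E true t [] with
    | (.univ i, []) => some i
    | _ => none

/-- Subtyping: convertibility and inclusion of universes. -/
def fits (E : Env) (A B : Pre) : Bool :=
  conv E A B || match asUniv E A, asUniv E B with
    | some i, some j => Nat.ble i j
    | _, _ => false

/-- The domain and the codomain of a type that reduces to a product. -/
def asPi (E : Env) (inf : List Pre → Pre → Option Pre → Option Pre) (Γ : List Pre) :
    Pre → Option (Pre × Pre)
  | .pi A B => some (A, B)
  | t => match whnf E true t [] with
    -- The reduct is inferred anew, which shows directly that it is a type; this takes the place of
    -- subject reduction.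
    | (.pi A B, []) => match inf Γ (.pi A B) none with
      | some _ => some (A, B)
      | none => none
    | _ => none

/-- Compares an inferred type with the expected one, if there is one. -/
def expect (E : Env) (A : Pre) : Option Pre → Option Pre
  | none => some A
  | some B => bif fits E A B then some B else none

/-- One step of type inference. -/
def inferStep (E : Env) (inf : List Pre → Pre → Option Pre → Option Pre) (Γ : List Pre) (t : Pre)
    (ex : Option Pre) : Option Pre :=
  match t with
  | .var n => match Γ[n]? with
    | some A => expect E (A.lift (n + 1) 0) ex
    | none => none
  | .univ i => expect E (.univ (i + 1)) ex
  | .pi A B => match inf Γ A none with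
    | some U => match asUniv E U with
      | some i => match inf (A :: Γ) B none with
        | some V => match asUniv E V with
          | some j => expect E (.univ (max i j)) ex
          | none => none
        | none => none
      | none => none
    | none => none
  | .lam b => match ex with
    | some P => match asPi E inf Γ P with
      | some (A, B) => match inf (A :: Γ) b (some B) with
        | some _ => some P
        | none => none
      | none => none
    | none => none
  | .app f a => match inf Γ f none with
    | some F => match asPi E inf Γ F with
      | some (A, B) => match inf Γ a (some A) with
        | some _ => expect E (B.inst a) ex
        | none => none
      | none => none
    | none => none
  | .con c n l => match E.get n with
    -- One constant has a type for each pair of levels. The annotation selects an entry that fixes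
    -- the pair, and this test confirms that the entry is that constant.
    | some e => bif (e.tm.lvl l).beq (.con c) then expect E (e.ty.lvl l) ex else none
    | none => none
  | .glob n l => match E.get n with
    | some e => expect E (e.ty.lvl l) ex
    | none => none

/-- The type of a term, which is the expected type if there is one. -/
def infer (E : Env) : List Pre → Pre → Option Pre → Option Pre :=
  iter (inferStep E) (fun _ _ _ => none) 10000

end HoTT

/-! ### Soundness of the type checker -/

namespace HoTT

/-- The checker branches on `Nat.blt` and `Nat.beq` for evaluation in the kernel; the proofs use the
propositional form. -/
theorem bif_eq_ite {α : Type} {n m : ℕ} {a b : α} :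
    (bif Nat.blt n m then a else b) = if n < m then a else b := by
  have h : Nat.blt n m = decide (n < m) := by
    rw [Bool.eq_iff_iff, decide_eq_true_iff]
    exact Iff.of_eq Nat.ble_eq
  rw [h, Bool.cond_decide]

theorem bif_beq_eq_ite {α : Type} {n m : ℕ} {a b : α} :
    (bif Nat.beq n m then a else b) = if n = m then a else b := by
  rw [Env.beq_eq_decide, Bool.cond_decide]

/-! ### Erasure of annotations and syntactic operations -/

namespace Env

/-- The terms of the environment are closed. -/
def Closed (E : Env) : Prop := ∀ n e, E.get n = some e → ∀ s, e.tm.subst s = e.tm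

/-- The annotated forms of the entries are correct. -/
def UnfoldsTo (E : Env) : Prop :=
  ∀ n e v, E.get n = some e → e.unf = some v → E.erase v = e.tm

variable {E : Env}

theorem erase_lvl (k : ℕ) (t : Pre) : E.erase (t.lvl k) = (E.erase t).lvl k := by
  induction t with
  | pi A B hA hB => simp [Pre.lvl, erase, Tm.lvl, hA, hB]
  | lam t ht => simp [Pre.lvl, erase, Tm.lvl, ht]
  | app t u ht hu => simp [Pre.lvl, erase, Tm.lvl, ht, hu]
  | con c n l => exact (Tm.lvl_con k c).symm
  | glob n l =>
    simp only [Pre.lvl, erase]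
    cases E.get n with
    | none => rfl
    | some e => exact (Tm.lvl_lvl l k e.tm).symm
  | _ => rfl

theorem Closed.lvl_subst (hE : E.Closed) {n : ℕ} {e : Entry} (he : E.get n = some e) (l : ℕ)
    (s : ℕ → Tm) : (e.tm.lvl l).subst s = e.tm.lvl l := by
  have h1 : ∀ (t : Tm) (k : ℕ), (t.ren fun n => n + k) = t.subst (fun n => .var (n + k)) :=
    fun t k => Tm.ren_eq_subst _ t
  -- A closed term equals its instance at a constant closed substitution. After the level shift that
  -- substitution is still constant and closed, hence it absorbs `s`.
  have h2 : e.tm.subst (fun _ => .univ 0) = e.tm := hE n e he _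
  rw [← h2, Tm.lvl_subst, Tm.subst_subst]
  rfl

theorem erase_lift (hE : E.Closed) (k c : ℕ) (t : Pre) :
    E.erase (t.lift k c) = (E.erase t).ren (fun n => if n < c then n else n + k) := by
  have hup (c : ℕ) : Tm.upRen (fun n => if n < c then n else n + k) =
      fun n => if n < c + 1 then n else n + k := by
    funext n
    cases n with
    | zero => simp [Tm.upRen]
    | succ n =>
      simp only [Tm.upRen, Nat.add_lt_add_iff_right]
      split <;> omega
  induction t generalizing c with
  | var n => simp only [Pre.lift, bif_eq_ite, erase, Tm.ren]; split <;> rfl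
  | univ i => rfl
  | pi A B hA hB => simp only [Pre.lift, erase, Tm.ren, hup, hA, hB]
  | lam t ht => simp only [Pre.lift, erase, Tm.ren, hup, ht]
  | app t u ht hu => simp only [Pre.lift, erase, Tm.ren, ht, hu]
  | con c n l => rfl
  | glob n l =>
    rw [Tm.ren_eq_subst]
    simp only [Pre.lift, erase]
    split
    · rename_i e he; exact (hE.lvl_subst he l _).symm
    · rfl

theorem erase_lift_zero (hE : E.Closed) (k : ℕ) (t : Pre) :
    E.erase (t.lift k 0) = (E.erase t).shift k := by
  simp [erase_lift hE, Tm.shift]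

theorem erase_instAt (hE : E.Closed) (u : Pre) (d : ℕ) (t : Pre) :
    E.erase (Pre.instAt u d t) = (E.erase t).subst (fun n =>
      if n < d then .var n else if n = d then (E.erase u).shift d else .var (n - 1)) := by
  have hup (d : ℕ) : Tm.up (fun n =>
      if n < d then .var n else if n = d then (E.erase u).shift d else .var (n - 1)) =
      fun n => if n < d + 1 then .var n else
        if n = d + 1 then (E.erase u).shift (d + 1) else .var (n - 1) := by
    funext n
    cases n with
    | zero => simp [Tm.up]
    | succ n =>
      simp only [Tm.up, Nat.add_lt_add_iff_right, Nat.add_right_cancel_iff]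
      split
      · rfl
      split
      · exact Tm.shift_shift d 1 _
      · simp only [Tm.shift, Tm.ren]; congr 1; omega
  induction t generalizing d with
  | var n =>
    simp only [Pre.instAt, bif_eq_ite, bif_beq_eq_ite, erase, Tm.subst]
    split
    · rfl
    split
    · exact erase_lift_zero hE d u
    · rfl
  | univ i => rfl
  | pi A B hA hB => simp only [Pre.instAt, erase, Tm.subst, hup, hA, hB]
  | lam t ht => simp only [Pre.instAt, erase, Tm.subst, hup, ht]
  | app t u ht hu => simp only [Pre.instAt, erase, Tm.subst, ht, hu]
  | con c n l => rfl
  | glob n l =>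
    simp only [Pre.instAt, erase]
    split
    · rename_i e he; exact (hE.lvl_subst he l _).symm
    · rfl

theorem erase_inst (hE : E.Closed) (t u : Pre) :
    E.erase (t.inst u) = (E.erase t).inst (E.erase u) := by
  rw [Pre.inst, erase_instAt hE, Tm.inst_eq]
  congr 1
  funext n
  cases n with
  | zero => simp [Tm.single, Tm.shift_zero]
  | succ n => simp [Tm.single]

theorem erase_apps (t : Pre) (ts : List Pre) :
    E.erase (t.apps ts) = (ts.map E.erase).foldl .app (E.erase t) := by
  induction ts generalizing t with
  | nil => rfl
  | cons u us ih => exact ih (t.app u)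

theorem erase_eq_of_beq {t u : Pre} (h : t.beq u = true) : E.erase t = E.erase u := by
  induction t generalizing u <;> cases u <;> simp only [Pre.beq, Bool.and_eq_true, reduceCtorEq] at h
  · rw [Nat.eq_of_beq_eq_true h]
  · rw [Nat.eq_of_beq_eq_true h]
  · rename_i ih ih' _ _; simp only [erase, ih h.1, ih' h.2]
  · rename_i ih _; simp only [erase, ih h]
  · rename_i ih ih' _ _; simp only [erase, ih h.1, ih' h.2]
  · simp only [erase, Con.eq_of_beq h]
  · rw [Nat.eq_of_beq_eq_true h.1, Nat.eq_of_beq_eq_true h.2]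

theorem erase_unfold (hE : E.UnfoldsTo) {n l : ℕ} {v : Pre} (h : E.unfold n l = some v) :
    E.erase v = E.erase (.glob n l) := by
  unfold unfold at h
  split at h
  · rename_i e he
    split at h
    · rename_i w hw
      cases h
      simp only [erase_lvl, hE n e w he hw, erase, he]
    · cases h
  · cases h

end Env

/-! ### Soundness of reduction and of the convertibility test -/

theorem Conv.apps {ts us : List Tm} (h : List.Forall₂ Conv ts us) {t u : Tm} (h0 : Conv t u) :
    Conv (ts.foldl .app t) (us.foldl .app u) := by
  induction h generalizing t u with
  | nil => exact h0
  | cons h _ ih => exact ih (h0.app h)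

theorem Conv.apps_left {t u : Tm} (h0 : Conv t u) (ts : List Tm) :
    Conv (ts.foldl .app t) (ts.foldl .app u) :=
  .apps (List.forall₂_same.mpr fun _ _ => .refl _) h0

variable {E : Env}

/-- The erasure of a head and its arguments. -/
def Env.eraseApps (E : Env) (p : Pre × List Pre) : Tm := (p.2.map E.erase).foldl .app (E.erase p.1)

theorem constView_sound {p : Pre × List Pre} {c : Con} {ts : List Pre}
    (h : constView p = some (c, ts)) : E.eraseApps p = c.ap (ts.map E.erase) := by
  unfold constView at h
  split at h
  · cases h; rfl
  · cases h

theorem iota_sound {w : Pre → Pre × List Pre} (hw : ∀ u, Conv (E.erase u) (E.eraseApps (w u)))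
    {t : Pre} {c : Con} (ht : E.erase t = .con c) {st : List Pre} {p : Pre × List Pre}
    (h : iota w t c st = some p) : Conv ((st.map E.erase).foldl .app (.con c)) (E.eraseApps p) := by
  have key {u : Pre} {c' : Con} {ts : List Pre} (h : constView (w u) = some (c', ts)) :
      Conv (E.erase u) (c'.ap (ts.map E.erase)) := constView_sound (E := E) h ▸ hw u
  unfold iota at h
  split at h
  case h_7 => cases h
  all_goals
    split at h
    case h_2 => cases h
    split at h
    all_goals first
      | (cases h; done)
      | rename_i hv
        have hc := key hv
        cases h
  · exact .apps_left (.trans (.app (.refl _) hc) (.unit _ _)) _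
  · exact .apps_left (.trans (.app (.refl _) hc) (.inl ..)) _
  · exact .apps_left (.trans (.app (.refl _) hc) (.inr ..)) _
  · exact .apps_left (.trans (.app (.refl _) hc) (.pair ..)) _
  · exact .apps_left (.trans (.app (.refl _) hc) (.zero ..)) _
  · refine .trans (.apps_left (.trans (.app (.refl _) hc) (.succ ..)) _) ?_
    simp only [Env.eraseApps, List.map_cons, List.foldl_cons, Env.erase_apps, ht]
    exact .refl _
  · exact .apps_left (.trans (.app (.refl _) hc) (.id ..)) _
  · exact .apps_left (.trans (.app (.refl _) hc) (.trunc ..)) _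

/-- `Conv` is a relation on raw terms, so each reduction step is justified without reference to
typing. -/
theorem whnf_sound (hE : E.Closed) (hU : E.UnfoldsTo) (δ : Bool) (t : Pre) (st : List Pre) :
    Conv (E.eraseApps (t, st)) (E.eraseApps (whnf E δ t st)) := by
  refine iter_induction (fun red : Bool → Pre → List Pre → Pre × List Pre =>
    ∀ δ t st, Conv (E.eraseApps (t, st)) (E.eraseApps (red δ t st)))
    (fun _ _ _ => .refl _) (fun red ih δ t st => ?_) 10000 δ t st
  unfold whnfStep
  split
  · rename_i f a
    exact ih δ f (a :: st)
  · split
    · exact .refl _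
    · rename_i b _ a st
      refine .trans (.apps_left (.beta (E.erase b) (E.erase a)) _) ?_
      rw [← Env.erase_inst hE]
      exact ih _ _ _
  · split
    · rename_i h
      exact .trans (iota_sound (E := E) (fun u => ih true u []) rfl h) (ih _ _ _)
    · exact .refl _
  · split
    · split
      · rename_i v hv
        have := ih true v st
        rw [Env.eraseApps, Env.erase_unfold hU hv] at this
        exact this
      · exact .refl _
    · exact .refl _
  · exact .refl _

theorem convList_sound {cv : Pre → Pre → Bool}
    (hcv : ∀ t u, cv t u = true → Conv (E.erase t) (E.erase u)) {ts us : List Pre}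
    (h : convList cv ts us = true) :
    List.Forall₂ Conv (ts.map E.erase) (us.map E.erase) := by
  induction ts generalizing us with
  | nil => cases us with
    | nil => exact .nil
    | cons => cases h
  | cons t ts ih => cases us with
    | nil => cases h
    | cons u us =>
      rw [convList, Bool.and_eq_true] at h
      exact .cons (hcv _ _ h.1) (ih h.2)

theorem unfoldHead_sound (hU : E.UnfoldsTo) {t v : Pre} {n : ℕ}
    (h : unfoldHead E t = some (n, v)) : E.erase t = E.erase v := by
  unfold unfoldHead at h
  split at h
  · split at h
    · rename_i hv; cases h; exact (Env.erase_unfold hU hv).symm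
    · cases h
  · cases h

theorem convUnfold_sound (hU : E.UnfoldsTo) {cv : Pre → Pre → Bool}
    (hcv : ∀ t u, cv t u = true → Conv (E.erase t) (E.erase u)) {t u : Pre} {ts us : List Pre}
    (h : convUnfold E cv t u ts us = true) :
    Conv (E.eraseApps (t, ts)) (E.eraseApps (u, us)) := by
  simp only [Env.eraseApps, ← Env.erase_apps]
  unfold convUnfold at h
  split at h
  · rename_i h1 h2
    rw [Env.erase_apps, unfoldHead_sound hU h1, ← Env.erase_apps]
    rw [bif_eq_ite, bif_eq_ite] at h
    split at h
    · exact hcv _ _ h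
    split at h
    · have := hcv _ _ h
      rw [Env.erase_apps, ← unfoldHead_sound hU h1, ← Env.erase_apps] 
      rw [Env.erase_apps u, unfoldHead_sound hU h2, ← Env.erase_apps]
      exact this
    · rw [Env.erase_apps u, unfoldHead_sound hU h2, ← Env.erase_apps]
      exact hcv _ _ h
  · rename_i h1 _
    rw [Env.erase_apps, unfoldHead_sound hU h1, ← Env.erase_apps]
    exact hcv _ _ h
  · rename_i h2
    rw [Env.erase_apps u, unfoldHead_sound hU h2, ← Env.erase_apps]
    exact hcv _ _ h
  · cases h

theorem convHead_sound (hE : E.Closed) (hU : E.UnfoldsTo) {cv : Pre → Pre → Bool}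
    (hcv : ∀ t u, cv t u = true → Conv (E.erase t) (E.erase u)) {p q : Pre × List Pre}
    (h : convHead E cv p q = true) : Conv (E.eraseApps p) (E.eraseApps q) := by
  -- A term that is not an abstraction is compared with one through its `η`-expansion.
  have heta {t : Pre} {p : Pre × List Pre}
      (h : Conv (E.erase t) (E.erase (.app ((p.1.apps p.2).lift 1 0) (.var 0)))) :
      Conv (.lam (E.erase t)) (E.eraseApps p) := by
    refine .trans (.lam h) ?_
    rw [Env.erase, Env.erase_lift_zero hE, Env.erase_apps]
    exact .eta _
  unfold convHead at h
  split at h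
  · rw [Bool.and_eq_true] at h
    exact .pi (hcv _ _ h.1) (hcv _ _ h.2)
  · exact .lam (hcv _ _ h)
  · exact heta (p := (_, _)) (hcv _ _ h)
  · exact .symm (heta (p := (_, _)) (hcv _ _ h).symm)
  · rw [Bool.or_eq_true, Bool.and_eq_true] at h
    rcases h with ⟨h1, h2⟩ | h
    · simp only [Env.eraseApps, Env.erase_eq_of_beq (E := E) h1]
      exact .apps (convList_sound hcv h2) (.refl _)
    · exact convUnfold_sound hU hcv h

theorem conv_sound (hE : E.Closed) (hU : E.UnfoldsTo) {t u : Pre} (h : conv E t u = true) :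
    Conv (E.erase t) (E.erase u) := by
  refine iter_induction (a := fun _ _ => false) (fun cv : Pre → Pre → Bool => ∀ t u,
    cv t u = true → Conv (E.erase t) (E.erase u)) (fun _ _ h => nomatch h)
    (fun cv ih t u h => ?_) 10000 t u h
  rw [Bool.or_eq_true] at h
  rcases h with h | h
  · rw [Env.erase_eq_of_beq h]; exact .refl _
  · exact (whnf_sound hE hU false t []).trans
      ((convHead_sound hE hU ih h).trans (whnf_sound hE hU false u []).symm)

theorem asUniv_sound (hE : E.Closed) (hU : E.UnfoldsTo) {t : Pre} {i : ℕ}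
    (h : asUniv E t = some i) : Conv (E.erase t) (.univ i) := by
  unfold asUniv at h
  split at h
  · cases h; exact .refl _
  · split at h
    · rename_i h1
      cases h
      have := whnf_sound hE hU true t []
      rw [h1] at this
      exact this
    · cases h

/-- `A` is a type in context `Γ`. -/
def IsTy (E : Env) (Γ : List Pre) (A : Pre) : Prop :=
  ∃ i, HasType (Γ.map E.erase) (E.erase A) (.univ i)

/-- `Γ` is a context. -/
def IsCtx (E : Env) : List Pre → Prop
  | [] => True
  | A :: Γ => IsTy E Γ A ∧ IsCtx E Γ

theorem IsCtx.isTy (hE : E.Closed) {Γ : List Pre} (hΓ : IsCtx E Γ) {n : ℕ} {A : Pre}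
    (h : Γ[n]? = some A) : IsTy E Γ (A.lift (n + 1) 0) := by
  induction Γ generalizing n with
  | nil => simp at h
  | cons B Γ ih =>
    have hs {C : Pre} {k : ℕ} (hC : IsTy E Γ (C.lift k 0)) : IsTy E (B :: Γ) (C.lift (k + 1) 0) := by
      obtain ⟨i, hi⟩ := hC
      have := hi.shift_append [E.erase B]
      rw [Env.erase_lift_zero hE, List.length_singleton, Tm.shift_shift,
        ← Env.erase_lift_zero hE] at this
      exact ⟨i, this⟩
    cases n with
    | zero =>
      obtain rfl : B = A := by simpa using h
      refine hs ?_
      obtain ⟨i, hi⟩ := hΓ.1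
      exact ⟨i, by rwa [Env.erase_lift_zero hE, Tm.shift_zero]⟩
    | succ n => exact hs (ih hΓ.2 (by simpa using h))

/-- The correctness of the result of type inference. -/
def InferSound (E : Env) (inf : List Pre → Pre → Option Pre → Option Pre) : Prop :=
  ∀ {Γ t ex A}, inf Γ t ex = some A → IsCtx E Γ → (∀ B, ex = some B → IsTy E Γ B) →
    HasType (Γ.map E.erase) (E.erase t) (E.erase A) ∧ IsTy E Γ A ∧ ∀ B, ex = some B → A = B

theorem asPi_sound (hE : E.Closed) (hU : E.UnfoldsTo)
    {inf : List Pre → Pre → Option Pre → Option Pre} (hinf : InferSound E inf) {Γ : List Pre}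
    (hΓ : IsCtx E Γ) {P A B : Pre} (hP : IsTy E Γ P) (h : asPi E inf Γ P = some (A, B)) :
    Conv (E.erase P) (E.erase (.pi A B)) ∧ IsTy E Γ (.pi A B) ∧ IsTy E Γ A ∧
      IsTy E (A :: Γ) B := by
  have key (hc : Conv (E.erase P) (E.erase (.pi A B))) (h : IsTy E Γ (.pi A B)) :
      Conv (E.erase P) (E.erase (.pi A B)) ∧ IsTy E Γ (.pi A B) ∧ IsTy E Γ A ∧
        IsTy E (A :: Γ) B := by
    obtain ⟨i, hi⟩ := h
    obtain ⟨j, h1, h2⟩ := hi.pi_inv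
    exact ⟨hc, ⟨i, hi⟩, ⟨j, h1⟩, ⟨j, h2⟩⟩
  unfold asPi at h
  split at h
  · cases h; exact key (.refl _) hP
  · split at h
    · rename_i h1
      split at h
      · rename_i h2
        cases h
        have hc := whnf_sound hE hU true P []
        rw [h1] at hc
        have h3 := (hinf h2 hΓ nofun).1
        obtain ⟨i, hA, hB⟩ := h3.pi_inv
        exact key hc ⟨i, .pi hA hB⟩
      · cases h
    · cases h

theorem expect_sound (hE : E.Closed) (hU : E.UnfoldsTo) {Γ : List Pre} {t A A' : Pre}
    {ex : Option Pre} (h : expect E A ex = some A')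
    (ht : HasType (Γ.map E.erase) (E.erase t) (E.erase A)) (hA : IsTy E Γ A)
    (hex : ∀ B, ex = some B → IsTy E Γ B) :
    HasType (Γ.map E.erase) (E.erase t) (E.erase A') ∧ IsTy E Γ A' ∧ ∀ B, ex = some B → A' = B := by
  unfold expect at h
  split at h
  · cases h; exact ⟨ht, hA, nofun⟩
  · rename_i B
    cases hf : fits E A B with
    | false => rw [hf] at h; cases h
    | true =>
      rw [hf] at h
      cases h
      obtain ⟨i, hB⟩ := hex _ rfl
      refine ⟨?_, ⟨i, hB⟩, fun _ h => Option.some.inj h⟩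
      rw [fits, Bool.or_eq_true] at hf
      rcases hf with hf | hf
      · exact .conv ht (conv_sound hE hU hf) hB
      · split at hf
        · rename_i h1 h2
          have h3 : HasType _ _ (.univ _) := .conv ht (asUniv_sound hE hU h1) (.univ _)
          exact .conv (h3.cumul_le (Nat.le_of_ble_eq_true hf)) (asUniv_sound hE hU h2).symm hB
        · cases hf

/-- The entries of the environment are closed terms of their types, in which only the first `k`
entries occur. -/
structure Env.Valid (E : Env) (k : ℕ) : Prop where
  lt : ∀ {n e}, E.get n = some e → n < k
  bounded_ty : ∀ {n e}, E.get n = some e → e.ty.bounded k = true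
  bounded_unf : ∀ {n e v}, E.get n = some e → e.unf = some v → v.bounded k = true
  unfoldsTo : E.UnfoldsTo
  hasType : ∀ {n e}, E.get n = some e → HasType [] e.tm (E.erase e.ty)
  isTy : ∀ {n e}, E.get n = some e → IsTy E [] e.ty

theorem Env.Valid.closed {k : ℕ} (h : E.Valid k) : E.Closed :=
  fun _ _ he s => (h.hasType he).closed s

theorem Env.Valid.entry {k : ℕ} (h : E.Valid k) {n l : ℕ} {e : Entry} (he : E.get n = some e)
    (Γ : List Pre) :
    HasType (Γ.map E.erase) (e.tm.lvl l) (E.erase (e.ty.lvl l)) ∧ IsTy E Γ (e.ty.lvl l) := by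
  have hc {t A : Tm} (ht : HasType [] t A) (hA : ∀ s, A.subst s = A) :
      HasType (Γ.map E.erase) (t.lvl l) (A.lvl l) := by
    -- Weakening from the empty context to `Γ` shifts both term and type, and closedness then
    -- removes the shifts.
    have h1 := (ht.lvl l).shift_append (Γ.map E.erase)
    rw [List.map_nil, List.append_nil, Tm.shift, Tm.shift, ← Tm.lvl_ren, ← Tm.lvl_ren,
      ht.closed_ren, Tm.ren_eq_subst, hA] at h1
    exact h1
  obtain ⟨i, hi⟩ := h.isTy he
  rw [Env.erase_lvl]
  exact ⟨hc (h.hasType he) hi.closed, l + i, by rw [Env.erase_lvl]; exact hc hi fun _ => rfl⟩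

/-- The conversion rule demands that its target be a type. The invariant therefore assumes that the
context and the expected type are well formed, and returns that the result is a type. -/
theorem inferStep_sound {k : ℕ} (hV : E.Valid k)
    {inf : List Pre → Pre → Option Pre → Option Pre} (hinf : InferSound E inf) :
    InferSound E (inferStep E inf) := by
  intro Γ t ex A h hΓ hex
  have hE := hV.closed
  have hU := hV.unfoldsTo
  unfold inferStep at h
  split at h
  · split at h
    · rename_i n _ B hB
      refine expect_sound hE hU h ?_ (hΓ.isTy hE hB) hex
      rw [Env.erase_lift_zero hE]
      exact .var (by simp [hB])
    · cases h
  · exact expect_sound hE hU h (.univ _) ⟨_, .univ _⟩ hex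
  · split at h
    swap; · cases h
    rename_i hA
    split at h
    swap; · cases h
    rename_i hi
    split at h
    swap; · cases h
    rename_i hB
    split at h
    swap; · cases h
    rename_i hj
    have hA' := HasType.conv (hinf hA hΓ nofun).1 (asUniv_sound hE hU hi) (.univ _)
    have hB' := HasType.conv (hinf hB ⟨⟨_, hA'⟩, hΓ⟩ nofun).1 (asUniv_sound hE hU hj) (.univ _)
    exact expect_sound hE hU h
      (.pi (hA'.cumul_le (Nat.le_max_left _ _)) (hB'.cumul_le (Nat.le_max_right _ _)))
      ⟨_, .univ _⟩ hex
  · split at h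
    swap; · cases h
    rename_i P
    split at h
    swap; · cases h
    rename_i hPi
    split at h
    swap; · cases h
    rename_i hb
    cases h
    have hP := hex _ rfl
    obtain ⟨hc, -, ⟨i, hA⟩, hB⟩ := asPi_sound hE hU hinf hΓ hP hPi
    obtain ⟨hb1, -, hb3⟩ := hinf hb ⟨⟨i, hA⟩, hΓ⟩ fun _ h => Option.some.inj h ▸ hB
    rw [hb3 _ rfl] at hb1
    obtain ⟨j, hj⟩ := hP
    exact ⟨.conv (.lam hA hb1) hc.symm hj, ⟨j, hj⟩, fun _ h => Option.some.inj h⟩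
  · split at h
    swap; · cases h
    rename_i hf
    split at h
    swap; · cases h
    rename_i hPi
    split at h
    swap; · cases h
    rename_i ha
    obtain ⟨hf1, hF, -⟩ := hinf hf hΓ nofun
    obtain ⟨hc, ⟨l, hl⟩, hA, ⟨j, hB⟩⟩ := asPi_sound hE hU hinf hΓ hF hPi
    obtain ⟨ha1, -, ha3⟩ := hinf ha hΓ fun _ h => Option.some.inj h ▸ hA
    rw [ha3 _ rfl] at ha1
    refine expect_sound hE hU h ?_ ⟨j, ?_⟩ hex
    · rw [Env.erase_inst hE]
      exact .app (.conv hf1 hc hl) ha1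
    · rw [Env.erase_inst hE]
      exact hB.inst ha1
  · split at h
    swap; · cases h
    rename_i c n l _ e he
    cases hc : (e.tm.lvl l).beq (.con c) with
    | false => rw [hc] at h; cases h
    | true =>
      rw [hc] at h
      have h1 := hV.entry (l := l) he Γ
      rw [Tm.eq_of_beq hc] at h1
      exact expect_sound hE hU h h1.1 h1.2 hex
  · split at h
    swap; · cases h
    rename_i n l _ e he
    have h1 := hV.entry (l := l) he Γ
    refine expect_sound hE hU h ?_ h1.2 hex
    simp only [Env.erase, he]
    exact h1.1

theorem infer_sound {k : ℕ} (hV : E.Valid k) : InferSound E (infer E) :=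
  iter_induction (a := fun _ _ _ => none) (InferSound E) (fun h => nomatch h)
    (fun _ ih => inferStep_sound hV ih) 10000

/-! ### Declarations -/

/-- A declaration: a constant, a definition that may be unfolded, or a theorem. -/
inductive Decl : Type
  | const (c : Con) (i j : ℕ) (ty : Pre)
  | defn (ty val : Pre)
  | thm (ty val : Pre)

namespace Decl

/-- The entry that a declaration adds to the environment. -/
def entry (E : Env) : Decl → Entry
  | const c _ _ ty => ⟨ty, .con c, none⟩
  | defn ty val => ⟨ty, E.erase val, some val⟩
  | thm ty val => ⟨ty, E.erase val, none⟩

/-- Checks that `A` is a type. -/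
def checkType (E : Env) (A : Pre) : Bool :=
  match infer E [] A none with
  | some U => (asUniv E U).isSome
  | none => false

/-- Checks the `k`-th declaration. -/
def check (E : Env) (k : ℕ) : Decl → Bool
  | const c i j ty => ty.bounded k && checkType E ty && (E.erase ty).beq (c.type i j)
  | defn ty val =>
    val.bounded k && (ty.bounded k && checkType E ty && (infer E [] val (some ty)).isSome)
  | thm ty val => ty.bounded k && checkType E ty && (infer E [] val (some ty)).isSome

end Decl

/-- Adds a list of declarations to an environment with `k` entries. -/
def Env.extend : Env → ℕ → List Decl → Env
  | E, _, [] => E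
  | E, k, d :: ds => (E.insert (d.entry E) k).extend (k + 1) ds

/-- Checks a list of declarations. -/
def Env.check : Env → ℕ → List Decl → Bool
  | _, _, [] => true
  | E, k, d :: ds => d.check E k && (E.insert (d.entry E) k).check (k + 1) ds

theorem Pre.bounded_mono {k k' : ℕ} (hk : k ≤ k') {t : Pre} (h : t.bounded k = true) :
    t.bounded k' = true := by
  induction t with
  | pi A B hA hB => simp only [bounded, Bool.and_eq_true] at h ⊢; exact ⟨hA h.1, hB h.2⟩
  | lam t ht => exact ht h
  | app A B hA hB => simp only [bounded, Bool.and_eq_true] at h ⊢; exact ⟨hA h.1, hB h.2⟩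
  | glob n l => exact Nat.ble_eq.mpr (lt_of_lt_of_le (Nat.ble_eq.mp h) hk)
  | _ => rfl

/-- Only entries below position `k` occur in the term, and insertion at `k` leaves those alone.
Facts about earlier entries therefore persist as the environment grows. -/
theorem Env.erase_insert {k : ℕ} (e : Entry) {t : Pre} (h : t.bounded k = true) :
    (E.insert e k).erase t = E.erase t := by
  induction t with
  | pi A B hA hB =>
    simp only [Pre.bounded, Bool.and_eq_true] at h
    simp only [erase, hA h.1, hB h.2]
  | lam t ht => simp only [erase, ht h]
  | app A B hA hB =>
    simp only [Pre.bounded, Bool.and_eq_true] at h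
    simp only [erase, hA h.1, hB h.2]
  | glob n l => simp only [erase, get_insert e E (Nat.ne_of_lt (Nat.ble_eq.mp h))]
  | _ => rfl

theorem Env.Valid.insert {k : ℕ} (hV : E.Valid k) {e : Entry} (hty : e.ty.bounded k = true)
    (hunf : ∀ v, e.unf = some v → v.bounded k = true ∧ E.erase v = e.tm)
    (h1 : HasType [] e.tm (E.erase e.ty)) (h2 : IsTy E [] e.ty) :
    (E.insert e k).Valid (k + 1) := by
  have key {n : ℕ} {e' : Entry} (h : (E.insert e k).get n = some e') :
      n = k ∧ e' = e ∨ E.get n = some e' := by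
    by_cases hn : n = k
    · subst hn
      exact (get_insert_self e E h).imp_left fun h => ⟨rfl, h⟩
    · rw [get_insert e E hn] at h
      exact .inr h
  have hb {n : ℕ} {e' : Entry} (h : (E.insert e k).get n = some e') : e'.ty.bounded k = true := by
    rcases key h with ⟨-, rfl⟩ | h
    · exact hty
    · exact hV.bounded_ty h
  have hv {n : ℕ} {e' : Entry} {v : Pre} (h : (E.insert e k).get n = some e')
      (h' : e'.unf = some v) : v.bounded k = true := by
    rcases key h with ⟨-, rfl⟩ | h
    · exact (hunf v h').1
    · exact hV.bounded_unf h h'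
  constructor
  · intro n e' h
    rcases key h with ⟨rfl, -⟩ | h
    · exact Nat.lt_succ_self _
    · exact Nat.lt_succ_of_lt (hV.lt h)
  · exact fun h => Pre.bounded_mono (Nat.le_succ k) (hb h)
  · exact fun h h' => Pre.bounded_mono (Nat.le_succ k) (hv h h')
  · intro n e' v h h'
    rw [erase_insert e (hv h h')]
    rcases key h with ⟨-, rfl⟩ | h
    · exact (hunf v h').2
    · exact hV.unfoldsTo n e' v h h'
  · intro n e' h
    rw [erase_insert e (hb h)]
    rcases key h with ⟨-, rfl⟩ | h
    · exact h1
    · exact hV.hasType h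
  · intro n e' h
    unfold IsTy
    rw [erase_insert e (hb h)]
    rcases key h with ⟨-, rfl⟩ | h
    · exact h2
    · exact hV.isTy h

theorem Decl.isTy_of_checkType {k : ℕ} (hV : E.Valid k) {A : Pre}
    (h : checkType E A = true) : IsTy E [] A := by
  unfold checkType at h
  split at h
  · rename_i U hA
    obtain ⟨i, hi⟩ := Option.isSome_iff_exists.mp h
    exact ⟨i, .conv (infer_sound hV hA trivial nofun).1
      (asUniv_sound hV.closed hV.unfoldsTo hi) (.univ _)⟩
  · cases h

theorem Decl.hasType_of_infer {k : ℕ} (hV : E.Valid k) {A t : Pre} (hA : IsTy E [] A)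
    (h : (infer E [] t (some A)).isSome = true) : HasType [] (E.erase t) (E.erase A) := by
  obtain ⟨B, hB⟩ := Option.isSome_iff_exists.mp h
  obtain ⟨h1, -, h3⟩ := infer_sound hV hB trivial fun _ h => Option.some.inj h ▸ hA
  rw [h3 _ rfl] at h1
  exact h1

theorem Decl.valid_insert {k : ℕ} (hV : E.Valid k) {d : Decl} (h : d.check E k = true) :
    (E.insert (d.entry E) k).Valid (k + 1) := by
  cases d with
  | const c i j ty =>
    simp only [check, Bool.and_eq_true] at h
    refine hV.insert h.1.1 nofun ?_ (isTy_of_checkType hV h.1.2)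
    simp only [entry, Tm.eq_of_beq h.2]
    exact .con c i j
  | defn ty val =>
    simp only [check, Bool.and_eq_true] at h
    have hA := isTy_of_checkType hV h.2.1.2
    exact hV.insert h.2.1.1 (fun v hv => Option.some.inj hv ▸ ⟨h.1, rfl⟩)
      (hasType_of_infer hV hA h.2.2) hA
  | thm ty val =>
    simp only [check, Bool.and_eq_true] at h
    have hA := isTy_of_checkType hV h.1.2
    exact hV.insert h.1.1 nofun (hasType_of_infer hV hA h.2) hA

/-- Each declaration is checked against the environment of its predecessors only, so validity
propagates along the list. -/
theorem Env.Valid.extend {k : ℕ} (hV : E.Valid k) {ds : List Decl} (h : E.check k ds = true) :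
    (E.extend k ds).Valid (k + ds.length) := by
  induction ds generalizing E k with
  | nil => exact hV
  | cons d ds ih =>
    rw [Env.check, Bool.and_eq_true] at h
    have := ih (Decl.valid_insert hV h.1) h.2
    rwa [Nat.add_right_comm] at this

theorem Env.Valid.leaf : Env.leaf.Valid 0 := by
  constructor <;> intros <;> simp_all [Env.get, Env.UnfoldsTo]

end HoTT

/-! ### Annotated expressions -/

namespace HoTT.Lib

open HoTT

/-- An annotated term as a function of the number of binders above it. -/
structure Ex : Type where
  atDepth : ℕ → Pre

namespace Ex

/-- The closed term that a closed expression denotes. -/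
def close (e : Ex) : Pre := e.atDepth 0

def app (t u : Ex) : Ex := ⟨fun d => .app (t.atDepth d) (u.atDepth d)⟩

/-- The variable bound at depth `d`. -/
def bound (d : ℕ) : Ex := ⟨fun e => .var (e - d - 1)⟩

/-- The same expression one universe higher. -/
def up (t : Ex) : Ex := ⟨fun d => (t.atDepth d).lvl 1⟩

instance : CoeFun Ex (fun _ => Ex → Ex) := ⟨app⟩

end Ex

def univ (i : ℕ) : Ex := ⟨fun _ => .univ i⟩

/-- `λ x. t x` -/
def lam (t : Ex → Ex) : Ex := ⟨fun d => .lam ((t (.bound d)).atDepth (d + 1))⟩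

def lam₂ (t : Ex → Ex → Ex) : Ex := lam fun x => lam (t x)
def lam₃ (t : Ex → Ex → Ex → Ex) : Ex := lam fun x => lam₂ (t x)
def lam₄ (t : Ex → Ex → Ex → Ex → Ex) : Ex := lam fun x => lam₃ (t x)
def lam₅ (t : Ex → Ex → Ex → Ex → Ex → Ex) : Ex := lam fun x => lam₄ (t x)
def lam₆ (t : Ex → Ex → Ex → Ex → Ex → Ex → Ex) : Ex := lam fun x => lam₅ (t x)

/-- `Π (x : A), B x` -/
def pi (A : Ex) (B : Ex → Ex) : Ex :=
  ⟨fun d => .pi (A.atDepth d) ((B (.bound d)).atDepth (d + 1))⟩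

/-- `A → B` -/
def arr (A B : Ex) : Ex := pi A fun _ => B

infixr:25 " ⇒ " => arr

/-- A term together with its type. -/
structure Typed : Type where
  ty : Ex
  tm : Ex

/-- Abstraction over a variable of type `A`. -/
def assume (A : Ex) (J : Ex → Typed) : Typed := ⟨pi A fun x => (J x).ty, lam fun x => (J x).tm⟩

/-- An entry of the library: the expression that refers to it and its declaration. -/
structure Item : Type where
  ex : Ex
  decl : Decl

instance : Coe Item Ex := ⟨Item.ex⟩
instance : CoeFun Item (fun _ => Ex → Ex) := ⟨fun a => a.ex.app⟩

/-- The same entry one universe higher. -/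
def Item.up (a : Item) : Ex := a.ex.up

/-- The `n`-th entry is the constant `c`. -/
def const (n : ℕ) (c : Con) (ty : Ex) (j : ℕ := 0) : Item :=
  ⟨⟨fun _ => .con c n 0⟩, .const c 0 j ty.close⟩

/-- The `n`-th entry is a definition. -/
def defn (n : ℕ) (J : Typed) : Item := ⟨⟨fun _ => .glob n 0⟩, .defn J.ty.close J.tm.close⟩

/-- The `n`-th entry is a theorem. -/
def thm (n : ℕ) (J : Typed) : Item := ⟨⟨fun _ => .glob n 0⟩, .thm J.ty.close J.tm.close⟩

/-- The types of the first universe. -/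
abbrev U : Ex := univ 0
/-- The types of the second universe. -/
abbrev U₁ : Ex := univ 1

/-! ### Constants and the definitions of the statement -/

/-- The number given to each item is meant to be its position in `library`. Soundness does not rely
on the numbering, since every reference is checked against the entry actually found. -/
def sig := const 0 .sig <| pi U fun A => (A ⇒ U) ⇒ U
def pair := const 1 .pair <| pi U fun A => pi (A ⇒ U) fun B => pi A fun a => B a ⇒ sig A B
def indSigTy (j : ℕ) : Ex := pi U fun A => pi (A ⇒ U) fun B => pi (sig A B ⇒ univ j) fun C =>
  (pi A fun a => pi (B a) fun b => C (pair A B a b)) ⇒ pi (sig A B) fun w => C w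
def indSig := const 2 .indSig (indSigTy 0)
def nat := const 3 .nat U
def zero := const 4 .zero nat
def succ := const 5 .succ (nat ⇒ nat)
def indNatTy (j : ℕ) : Ex := pi (nat ⇒ univ j) fun C => C zero ⇒
  (pi nat fun n => C n ⇒ C (succ n)) ⇒ pi nat fun n => C n
def indNat₁ := const 6 .indNat (indNatTy 1) 1
def idt := const 7 .idt <| pi U fun A => A ⇒ A ⇒ U
def refl := const 8 .refl <| pi U fun A => pi A fun a => idt A a a
-- Motives in `U₁` are needed besides those in `U`, because based path induction quantifies over
-- type families in its motive.
def indIdTy (j : ℕ) : Ex := pi U fun A =>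
  pi (pi A fun x => pi A fun y => idt A x y ⇒ univ j) fun C =>
  (pi A fun x => C x x (refl A x)) ⇒ pi A fun x => pi A fun y => pi (idt A x y) fun p => C x y p
def indId := const 9 .indId (indIdTy 0)
def indId₁ := const 10 .indId (indIdTy 1) 1
def trunc := const 11 .trunc (nat ⇒ U ⇒ U)
def tr := const 12 .tr <| pi nat fun k => pi U fun A => A ⇒ trunc k A

def fst := defn 13 <| assume U fun A => assume (A ⇒ U) fun B => assume (sig A B) fun w =>
  ⟨A, indSig A B (lam fun _ => A) (lam₂ fun a _ => a) w⟩

def snd := defn 14 <| assume U fun A => assume (A ⇒ U) fun B => assume (sig A B) fun w =>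
  ⟨B (fst A B w), indSig A B (lam fun w => B (fst A B w)) (lam₂ fun _ b => b) w⟩

def inv := defn 15 <| assume U fun A => assume A fun a => assume A fun b =>
  assume (idt A a b) fun p =>
  ⟨idt A b a, indId A (lam₃ fun x y _ => idt A y x) (lam fun x => refl A x) a b p⟩

def concat := defn 16 <| assume U fun A => assume A fun a => assume A fun b => assume A fun c =>
  assume (idt A a b) fun p => assume (idt A b c) fun q =>
  ⟨idt A a c, indId A (lam₃ fun x y _ => idt A y c ⇒ idt A x c) (lam₂ fun _ q => q) a b p q⟩

def ap := defn 17 <| assume U fun A => assume U fun B => assume (A ⇒ B) fun f =>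
  assume A fun a => assume A fun a' => assume (idt A a a') fun p =>
  ⟨idt B (f a) (f a'),
    indId A (lam₃ fun x y _ => idt B (f x) (f y)) (lam fun x => refl B (f x)) a a' p⟩

def invConcat := defn 18 <| assume U fun A => assume A fun a => assume A fun b =>
  assume (idt A a b) fun p =>
  ⟨idt (idt A b b) (concat A b a b (inv A a b p) p) (refl A b),
    indId A (lam₃ fun x y p => idt (idt A y y) (concat A y x y (inv A x y p) p) (refl A y))
      (lam fun x => refl (idt A x x) (refl A x)) a b p⟩

def isContr := defn 19 <| assume U fun A => ⟨U, sig A (lam fun a => pi A fun a' => idt A a a')⟩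

def fib := defn 20 <| assume U fun A => assume U fun B => assume (A ⇒ B) fun f =>
  assume B fun b => ⟨U, sig A (lam fun x => idt B (f x) b)⟩

def isEquiv := defn 21 <| assume U fun A => assume U fun B => assume (A ⇒ B) fun f =>
  ⟨U, pi B fun b => isContr (fib A B f b)⟩

def equiv := defn 22 <| assume U fun A => assume U fun B =>
  ⟨U, sig (A ⇒ B) (lam fun f => isEquiv A B f)⟩

def isType := defn 23 <| assume nat fun k =>
  ⟨U ⇒ U, indNat₁ (lam fun _ => U ⇒ U) isContr
    (lam₃ fun _ T A => pi A fun x => pi A fun y => T (idt A x y)) k⟩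

def idIsEquiv := defn 24 <| assume U fun A =>
  ⟨isEquiv A A (lam fun x => x), lam fun b =>
    let F : Ex → Ex := fun b => fib A A (lam fun x => x) b
    let mk : Ex → Ex → Ex → Ex := fun b x p => pair A (lam fun x => idt A x b) x p
    pair (F b) (lam fun w => pi (F b) fun w' => idt (F b) w w') (mk b b (refl A b))
      (lam fun w' => indSig A (lam fun x => idt A x b)
        (lam fun w' => idt (F b) (mk b b (refl A b)) w')
        (lam₂ fun x p => indId A
          (lam₃ fun x b p => idt (F b) (mk b b (refl A b)) (mk b x p))
          (lam fun x => refl (F x) (mk x x (refl A x))) x b p) w')⟩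

def idToEquiv := defn 25 <| assume U fun A => assume U fun B => assume (idt.up U A B) fun p =>
  ⟨equiv A B, indId.up U (lam₃ fun A B _ => equiv A B)
    (lam fun A => pair (A ⇒ A) (lam fun f => isEquiv A A f) (lam fun x => x) (idIsEquiv A)) A B p⟩

def happly := defn 26 <| assume U fun A => assume (A ⇒ U) fun B =>
  assume (pi A fun x => B x) fun f => assume (pi A fun x => B x) fun g =>
  assume (idt (pi A fun x => B x) f g) fun p =>
  ⟨pi A fun x => idt (B x) (f x) (g x),
    indId (pi A fun x => B x) (lam₃ fun f g _ => pi A fun x => idt (B x) (f x) (g x))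
      (lam₂ fun f x => refl (B x) (f x)) f g p⟩

def truncIsType := const 27 .truncIsType <| pi nat fun k => pi U fun A => isType k (trunc k A)

/-- The predicate `isType` depends on the universe of the motive, hence the parameter `isTy`. -/
def indTruncTy (j : ℕ) (isTy : Ex) : Ex := pi nat fun k => pi U fun A =>
  pi (trunc k A ⇒ univ j) fun C => (pi (trunc k A) fun u => isTy k (C u)) ⇒
  (pi A fun a => C (tr k A a)) ⇒ pi (trunc k A) fun u => C u
def indTrunc := const 28 .indTrunc (indTruncTy 0 isType)
def indTrunc₁ := const 29 .indTrunc (indTruncTy 1 isType.up) 1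

def funext := const 30 (.funext 0) <| pi U fun A => pi (A ⇒ U) fun B =>
  pi (pi A fun x => B x) fun f => pi (pi A fun x => B x) fun g =>
  isEquiv (idt (pi A fun x => B x) f g) (pi A fun x => idt (B x) (f x) (g x)) (happly A B f g)

def ua := const 31 (.ua 0) <| pi U fun A => pi U fun B =>
  isEquiv.up (idt.up U A B) (equiv A B) (idToEquiv A B)

def one := defn 32 ⟨nat, succ zero⟩
def two := defn 33 ⟨nat, succ one⟩

def prod := defn 34 <| assume U fun A => assume U fun B => ⟨U, sig A (lam fun _ => B)⟩

def iff := defn 35 <| assume U fun A => assume U fun B => ⟨U, prod (A ⇒ B) (B ⇒ A)⟩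

def isSurj := defn 36 <| assume U fun A => assume U fun B => assume (A ⇒ B) fun f =>
  ⟨U, pi B fun b => trunc one (fib A B f b)⟩

def truncMap := defn 37 <| assume nat fun k => assume U fun A => assume U fun B =>
  assume (A ⇒ B) fun f => assume (trunc k A) fun u =>
  ⟨trunc k B, indTrunc k A (lam fun _ => trunc k B) (lam fun _ => truncIsType k B)
    (lam fun a => tr k B (f a)) u⟩

def idIsType := defn 38 <| assume nat fun k =>
  ⟨pi U fun A => isType k A ⇒ pi A fun x => pi A fun y => isType k (idt A x y),
    indNat₁
    (lam fun k => pi U fun A => isType k A ⇒ (pi A fun x => pi A fun y => isType k (idt A x y)))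
    (lam₄ fun A h x y =>
      let P : Ex := lam fun a => pi A fun a' => idt A a a'
      let c : Ex := fst A P h
      let e : Ex := snd A P h
      let r : Ex → Ex → Ex := fun x y => concat A x c y (inv A c x (e x)) (e y)
      pair (idt A x y) (lam fun p => pi (idt A x y) fun q => idt (idt A x y) p q) (r x y)
        (lam fun q => indId A
          (lam₃ fun x y q => idt (idt A x y) (r x y) q)
          (lam fun x => invConcat A c x (e x)) x y q))
    (lam₂ fun _ H => lam₄ fun A h x y => lam₂ fun p q => H (idt A x y) (h x y) p q)
    k⟩

def modalFib := defn 39 <| assume nat fun k => assume U fun X => assume U fun Y =>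
  assume (X ⇒ Y) fun f => assume Y fun y =>
  ⟨U, fib (trunc k X) (trunc k Y) (truncMap k X Y f) (tr k Y y)⟩

def gamma := defn 40 <| assume nat fun k => assume U fun X => assume U fun Y =>
  assume (X ⇒ Y) fun f => assume Y fun y => assume (trunc k (fib X Y f y)) fun u =>
  let P : Ex := lam fun x => idt Y (f x) y
  let F : Ex := fib X Y f y
  let g : Ex → Ex := fun u => truncMap k F X (lam fun w => fst X P w) u
  ⟨modalFib k X Y f y,
    pair (trunc k X) (lam fun v => idt (trunc k Y) (truncMap k X Y f v) (tr k Y y)) (g u)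
    (indTrunc k F
      (lam fun u => idt (trunc k Y) (truncMap k X Y f (g u)) (tr k Y y))
      (lam fun u => idIsType k (trunc k Y) (truncIsType k Y)
        (truncMap k X Y f (g u)) (tr k Y y))
      (lam fun w => ap Y (trunc k Y) (tr k Y) (f (fst X P w)) y (snd X P w)) u)⟩

def isTruncFibration := defn 41 <| assume nat fun k => assume U fun X => assume U fun Y =>
  assume (X ⇒ Y) fun f =>
  ⟨U, pi Y fun y => isEquiv (trunc k (fib X Y f y)) (modalFib k X Y f y) (gamma k X Y f y)⟩

def loopSpace := defn 42 <| assume nat fun k =>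
  ⟨pi U fun A => A ⇒ U, indNat₁ (lam fun _ => pi U fun A => A ⇒ U)
    (lam₂ fun A _ => A) (lam₄ fun _ L A a => L (idt A a a) (refl A a)) k⟩

def loopMapTy (k : Ex) : Ex := pi U fun A => pi U fun B => pi A fun a => pi B fun b =>
  pi (A ⇒ B) fun f => idt B (f a) b ⇒ loopSpace k A a ⇒ loopSpace k B b

def loopMap := defn 43 <| assume nat fun k =>
  ⟨loopMapTy k,
    indNat₁ (lam loopMapTy) (lam₆ fun _ _ _ _ f _ => f)
      (lam₂ fun _ M => lam₆ fun A B a b f p =>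
        M (idt A a a) (idt B b b) (refl A a) (refl B b)
          (lam fun q => concat B b (f a) b (inv B (f a) b p)
            (concat B (f a) (f a) b (ap A B f a a q) p))
          (invConcat B (f a) b p))
      k⟩

def homotopyGroup := defn 44 <| assume nat fun k => assume U fun A => assume A fun a =>
  ⟨U, trunc two (loopSpace k A a)⟩

def homotopyGroupMap := defn 45 <| assume nat fun k => assume U fun A => assume U fun B =>
  assume A fun a => assume B fun b => assume (A ⇒ B) fun f => assume (idt B (f a) b) fun p =>
  ⟨homotopyGroup k A a ⇒ homotopyGroup k B b,
    truncMap two (loopSpace k A a) (loopSpace k B b) (loopMap k A B a b f p)⟩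

def isSurjOnHomotopyGroups := defn 46 <| assume nat fun k => assume U fun X => assume U fun Y =>
  assume (X ⇒ Y) fun f =>
  ⟨U, pi Y fun y => pi (fib X Y f y) fun w =>
    let P : Ex := lam fun x => idt Y (f x) y
    let x : Ex := fst X P w
    let p : Ex := snd X P w
    isSurj (homotopyGroup k X x) (homotopyGroup k Y y) (homotopyGroupMap k X Y x y f p)⟩

/-- The entries used in the statement. -/
def base : List Decl := [sig, pair, indSig, nat, zero, succ, indNat₁, idt, refl, indId,
  indId₁, trunc, tr, fst, snd, inv, concat, ap, invConcat, isContr, fib, isEquiv, equiv, isType,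
  idIsEquiv, idToEquiv, happly, truncIsType, indTrunc, indTrunc₁, funext, ua, one, two, prod, iff,
  isSurj, truncMap, idIsType, modalFib, gamma, isTruncFibration, loopSpace, loopMap,
  homotopyGroup, homotopyGroupMap, isSurjOnHomotopyGroups].map Item.decl

end HoTT.Lib

namespace HoTT.Lib

/-! ### Path induction -/

/-- A path, together with its endpoints. -/
structure Path : Type where
  A : Ex
  a : Ex
  b : Ex
  p : Ex

instance : Coe Path Ex := ⟨Path.p⟩

namespace Path

def symm (p : Path) : Path := ⟨p.A, p.b, p.a, inv p.A p.a p.b p⟩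
def trans (p q : Path) : Path := ⟨p.A, p.a, q.b, concat p.A p.a p.b q.b p q⟩
def map (p : Path) (B f : Ex) : Path := ⟨B, f p.a, f p.b, ap p.A B f p.a p.b p⟩

end Path

infixr:70 " ⬝ " => Path.trans

/-- A dependent sum `Σ (x : A), B x`. -/
structure Sg : Type where
  A : Ex
  B : Ex → Ex

namespace Sg

def fam (S : Sg) : Ex := lam S.B
def ty (S : Sg) : Ex := sig S.A S.fam
def mk' (S : Sg) (a b : Ex) : Ex := pair S.A S.fam a b
def fst (S : Sg) (w : Ex) : Ex := Lib.fst S.A S.fam w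
def snd (S : Sg) (w : Ex) : Ex := Lib.snd S.A S.fam w
/-- Induction for a dependent sum. -/
def ind (S : Sg) (C : Ex → Ex) (g : Ex → Ex → Ex) (w : Ex) : Ex :=
  indSig S.A S.fam (lam C) (lam₂ g) w

end Sg

/-- Path induction with a fixed left endpoint. -/
def indLeft := defn 47 <| assume U fun A => assume A fun a =>
  assume (pi A fun b => idt A a b ⇒ U) fun C => assume (C a (refl A a)) fun d =>
  assume A fun b => assume (idt A a b) fun p =>
  -- The family `C` starts at the fixed endpoint, so it is quantified inside the motive of unbased
  -- induction; this puts the motive in `U₁`.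
  ⟨C b p, indId₁ A
    (lam₃ fun x y p => pi (pi A fun b => idt A x b ⇒ U) fun C => C x (refl A x) ⇒ C y p)
    (lam₃ fun _ _ d => d) a b p C d⟩

/-- Path induction with a fixed right endpoint. -/
def indRight := defn 48 <| assume U fun A => assume A fun b =>
  assume (pi A fun a => idt A a b ⇒ U) fun C => assume (C b (refl A b)) fun d =>
  assume A fun a => assume (idt A a b) fun p =>
  ⟨C a p, indId₁ A
    (lam₃ fun x y p => pi (pi A fun a => idt A a y ⇒ U) fun C => C y (refl A y) ⇒ C x p)
    (lam₃ fun _ _ d => d) a b p C d⟩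

/-- Path induction on `p : a = b`, for a family over `b` and `p`. -/
def Path.ind (p : Path) (C : Ex → Ex → Ex) (d : Ex) : Ex := indLeft p.A p.a (lam₂ C) d p.b p

/-- Path induction on `p : a = b`, for a family over `a` and `p`. -/
def Path.indR (p : Path) (C : Ex → Ex → Ex) (d : Ex) : Ex := indRight p.A p.b (lam₂ C) d p.a p

def transport := defn 49 <| assume U fun A => assume (A ⇒ U) fun B => assume A fun x =>
  assume A fun y => assume (idt A x y) fun p => assume (B x) fun u =>
  ⟨B y, indId A (lam₃ fun x y _ => B x ⇒ B y) (lam₂ fun _ u => u) x y p u⟩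

/-- Transport in the family `B` along a path. -/
def Path.tp (p : Path) (B u : Ex) : Ex := transport p.A B p.a p.b p u

def concat_inv_concat := thm 50 <| assume U fun A => assume A fun a => assume A fun b =>
  assume A fun c => assume (idt A a b) fun p => assume (idt A a c) fun q =>
  let T : Ex → Ex → Ex := fun b p => pi (idt A a c) fun q =>
    idt (idt A a c) ((⟨A, a, b, p⟩ : Path) ⬝ (⟨A, a, b, p⟩ : Path).symm ⬝ ⟨A, a, c, q⟩).p q
  ⟨idt (idt A a c) ((⟨A, a, b, p⟩ : Path) ⬝ (⟨A, a, b, p⟩ : Path).symm ⬝ ⟨A, a, c, q⟩).p q,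
    (⟨A, a, b, p⟩ : Path).ind T (lam fun q => refl (idt A a c) q) q⟩

/-- Kept unfoldable: its value at `refl` has to reduce to `refl` in `isSurjOnLoops_succ`. -/
def concat_refl := defn 51 <| assume U fun A => assume A fun a => assume A fun b =>
  assume (idt A a b) fun p =>
  let T : Ex → Ex → Ex := fun b p => idt (idt A a b) (concat A a b b p (refl A b)) p
  ⟨T b p, (⟨A, a, b, p⟩ : Path).ind T (refl (idt A a a) (refl A a))⟩

/-! ### Retracts and equivalences -/

/-- Truncation levels descend to retracts by induction on `k`: `b = b'` is a retract of `s b = s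
b'`, with section `ap s` and retraction `q ↦ (e b)⁻¹ · (ap r q · e b')`. On `refl` the composite is
`(e b)⁻¹ · e b`. -/
def isType_retract := thm 52 <| assume nat fun k =>
  let T : Ex → Ex := fun k => pi U fun A => pi U fun B => pi (B ⇒ A) fun s => pi (A ⇒ B) fun r =>
    (pi B fun b => idt B (r (s b)) b) ⇒ isType k A ⇒ isType k B
  ⟨T k, indNat₁ (lam T)
    (lam₆ fun A B s r e h =>
      let C : Sg := ⟨A, fun a => pi A fun a' => idt A a a'⟩
      let c : Ex := C.fst h
      Sg.mk' ⟨B, fun b => pi B fun b' => idt B b b'⟩ (r c)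
        (lam fun b => ((⟨A, c, s b, C.snd h (s b)⟩ : Path).map B r ⬝ ⟨B, r (s b), b, e b⟩).p))
    (lam₂ fun _ H => lam₆ fun A B s r e h => lam₂ fun b b' =>
      let E : Ex → Path := fun b => ⟨B, r (s b), b, e b⟩
      let back : Ex → Ex → Path := fun b' p =>
        (E b).symm ⬝ (⟨A, s b, s b', p⟩ : Path).map B r ⬝ E b'
      H (idt A (s b) (s b')) (idt B b b') (lam fun q => ap B A s b b' q)
        (lam fun p => back b' p)
        (lam fun q => (⟨B, b, b', q⟩ : Path).ind
          (fun b' q => idt (idt B b b') (back b' (ap B A s b b' q)) q)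
          (invConcat B (r (s b)) b (e b)))
        (h (s b) (s b')))
    k⟩

/-- The type of the fiber of `f : A → B` over `b`. -/
def fibSg (A B f b : Ex) : Sg := ⟨A, fun x => idt B (f x) b⟩

/-- The type of proofs that `A` is contractible. -/
def contrSg (A : Ex) : Sg := ⟨A, fun a => pi A fun a' => idt A a a'⟩

def invEquiv := defn 53 <| assume U fun A => assume U fun B => assume (A ⇒ B) fun f =>
  assume (isEquiv A B f) fun h => assume B fun b =>
  ⟨A, (fibSg A B f b).fst ((contrSg (fib A B f b)).fst (h b))⟩

def invEquiv_right := thm 54 <| assume U fun A => assume U fun B => assume (A ⇒ B) fun f =>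
  assume (isEquiv A B f) fun h => assume B fun b =>
  ⟨idt B (f (invEquiv A B f h b)) b, (fibSg A B f b).snd ((contrSg (fib A B f b)).fst (h b))⟩

/-- The fiber over `f a` is contracted to its center; the path from the center to `(a, refl)`
projects to `A`. -/
def invEquiv_left := thm 55 <| assume U fun A => assume U fun B => assume (A ⇒ B) fun f =>
  assume (isEquiv A B f) fun h => assume A fun a =>
  let F : Ex := fib A B f (f a)
  let S : Sg := fibSg A B f (f a)
  let c : Ex := (contrSg F).fst (h (f a))
  let w : Ex := S.mk' a (refl B (f a))
  ⟨idt A (invEquiv A B f h (f a)) a,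
    ap F A (lam fun w => S.fst w) c w ((contrSg F).snd (h (f a)) w)⟩

def isContr_singleton := thm 56 <| assume U fun A => assume A fun a =>
  let S : Sg := ⟨A, fun x => idt A x a⟩
  let c : Ex := S.mk' a (refl A a)
  ⟨isContr S.ty, (contrSg S.ty).mk' c (lam fun w => S.ind (fun w => idt S.ty c w)
    (fun x p => (⟨A, x, a, p⟩ : Path).indR (fun x p => idt S.ty c (S.mk' x p)) (refl S.ty c)) w)⟩

def fib_path := thm 57 <| assume U fun A => assume U fun B => assume (A ⇒ B) fun f =>
  assume B fun b => assume A fun u => assume (idt B (f u) b) fun q =>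
  assume A fun x => assume (idt A u x) fun e => assume (idt B (f x) b) fun p =>
  let S : Sg := fibSg A B f b
  let H : Ex → Ex → Ex → Ex := fun x e p => idt (idt B (f u) b) q
    ((⟨A, u, x, e⟩ : Path).map B f ⬝ ⟨B, f x, b, p⟩).p
  let T : Ex → Ex → Ex := fun x e => pi (idt B (f x) b) fun p =>
    H x e p ⇒ idt S.ty (S.mk' u q) (S.mk' x p)
  ⟨H x e p ⇒ idt S.ty (S.mk' u q) (S.mk' x p),
    (⟨A, u, x, e⟩ : Path).ind T
      (lam₂ fun p h => ap (idt B (f u) b) S.ty (lam fun q => S.mk' u q) q p h) p⟩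

/-- The fiber over `b` is a retract of the singleton of points equal to `b`. No coherence between
`l` and `r` is needed: `there` inserts `(r (f x))⁻¹`, which cancels the `r (f x)` inserted by
`back`. -/
def isEquiv_of_inverse := thm 58 <| assume U fun A => assume U fun B => assume (A ⇒ B) fun f =>
  assume (B ⇒ A) fun g => assume (pi A fun a => idt A (g (f a)) a) fun l =>
  assume (pi B fun b => idt B (f (g b)) b) fun r =>
  ⟨isEquiv A B f, lam fun b =>
    let S : Sg := fibSg A B f b
    let S' : Sg := ⟨B, fun y => idt B y b⟩
    let R : Ex → Path := fun y => ⟨B, f (g y), y, r y⟩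
    let mid : Ex → Ex → Path := fun x p =>
      (⟨A, g (f x), x, l x⟩ : Path).map B f ⬝ ⟨B, f x, b, p⟩
    let there : Ex → Ex := fun w => S'.mk' (f (S.fst w))
      ((R (f (S.fst w))).symm ⬝ mid (S.fst w) (S.snd w)).p
    let back : Ex → Ex := fun w => S.mk' (g (S'.fst w))
      (R (S'.fst w) ⬝ ⟨B, S'.fst w, b, S'.snd w⟩).p
    isType_retract zero S'.ty S.ty (lam there) (lam back)
      (lam fun w => S.ind (fun w => idt S.ty (back (there w)) w)
        (fun x p => fib_path A B f b (g (f x))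
          (R (f x) ⬝ (R (f x)).symm ⬝ mid x p).p x (l x) p
          (concat_inv_concat B (f (g (f x))) (f x) b (r (f x)) (mid x p))) w)
      (isContr_singleton B b)⟩

/-! ### Paths in dependent sums -/

/-- A family `Q` over `A` with an operation that transports its elements along paths. -/
structure Fibration : Type where
  A : Ex
  Q : Ex → Ex
  tp : Path → Ex → Ex

namespace Fibration

def sg (D : Fibration) : Sg := ⟨D.A, D.Q⟩

/-- The description of the paths from `(x, b)` to `(y, c)`. -/
def code (D : Fibration) (x b y c : Ex) : Sg :=
  ⟨idt D.A x y, fun p => idt (D.Q y) (D.tp ⟨D.A, x, y, p⟩ b) c⟩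

/-- The description of the paths from `(x, b)` to `w`. -/
def codeAt (D : Fibration) (x b w : Ex) : Sg := D.code x b (D.sg.fst w) (D.sg.snd w)

def assumePoints (D : Fibration) (J : Ex → Ex → Ex → Typed) : Typed :=
  assume D.A fun x => assume (D.Q x) fun b => assume D.sg.ty fun w => J x b w

/-- The terms up to `equivTyped` use only that `tp` computes on `refl`, so they serve both a family
and its pullback. For a pullback along `f`, the second component of a path is then expressed by
transport in `B` along `ap f p`, as needed in `Lift.path`. -/
def outTyped (D : Fibration) : Typed := D.assumePoints fun x b w =>
  assume (idt D.sg.ty (D.sg.mk' x b) w) fun e =>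
  ⟨(D.codeAt x b w).ty,
    (⟨D.sg.ty, D.sg.mk' x b, w, e⟩ : Path).ind (fun w _ => (D.codeAt x b w).ty)
      ((D.code x b x b).mk' (refl D.A x) (refl (D.Q x) b))⟩

def inTyped (D : Fibration) : Typed := D.assumePoints fun x b w =>
  assume (D.codeAt x b w).ty fun c =>
  let S := D.sg
  let base := S.mk' x b
  ⟨idt S.ty base w,
    S.ind (fun w => (D.codeAt x b w).ty ⇒ idt S.ty base w) (fun y b' => lam fun c =>
      (D.code x b y b').ind (fun _ => idt S.ty base (S.mk' y b')) (fun p q =>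
        (⟨D.A, x, y, p⟩ : Path).ind (fun y p => pi (D.Q y) fun b' =>
          idt (D.Q y) (D.tp ⟨D.A, x, y, p⟩ b) b' ⇒ idt S.ty base (S.mk' y b'))
        (lam₂ fun b' q => (⟨D.Q x, b, b', q⟩ : Path).ind
          (fun b' _ => idt S.ty base (S.mk' x b')) (refl S.ty base)) b' q) c) w c⟩

def inOutTyped (D : Fibration) (inE outE : Ex) : Typed := D.assumePoints fun x b w =>
  let P := idt D.sg.ty (D.sg.mk' x b)
  assume (P w) fun e =>
  let T : Ex → Ex → Ex := fun w e => idt (P w) (inE x b w (outE x b w e)) e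
  ⟨T w e, (⟨D.sg.ty, D.sg.mk' x b, w, e⟩ : Path).ind T
    (refl (P (D.sg.mk' x b)) (refl D.sg.ty (D.sg.mk' x b)))⟩

def outInTyped (D : Fibration) (inE outE : Ex) : Typed := D.assumePoints fun x b w =>
  let C : Ex → Ex := fun w => (D.codeAt x b w).ty
  let T : Ex → Ex → Ex := fun w c => idt (C w) (outE x b w (inE x b w c)) c
  let S := D.sg
  ⟨pi (C w) fun c => T w c,
    S.ind (fun w => pi (C w) fun c => T w c) (fun y b' => lam fun c =>
      (D.code x b y b').ind (fun c => T (S.mk' y b') c) (fun p q =>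
        (⟨D.A, x, y, p⟩ : Path).ind (fun y p => pi (D.Q y) fun b' =>
          pi (idt (D.Q y) (D.tp ⟨D.A, x, y, p⟩ b) b') fun q =>
            T (S.mk' y b') ((D.code x b y b').mk' p q))
        (lam₂ fun b' q => (⟨D.Q x, b, b', q⟩ : Path).ind
          (fun b' q => T (S.mk' x b') ((D.code x b x b').mk' (refl D.A x) q))
          (refl (C (S.mk' x b)) ((D.code x b x b).mk' (refl D.A x) (refl (D.Q x) b)))) b' q) c) w⟩

def equivTyped (D : Fibration) (inE outE inOutE outInE : Ex) : Typed := D.assumePoints fun x b w =>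
  let P := idt D.sg.ty (D.sg.mk' x b) w
  let C := (D.codeAt x b w).ty
  ⟨isEquiv P C (outE x b w), isEquiv_of_inverse P C (outE x b w) (inE x b w)
    (inOutE x b w) (outInE x b w)⟩

/-- A type family with its transport. -/
def assumeFam (J : Fibration → (Ex → Ex) → Typed) : Typed :=
  assume U fun A => assume (A ⇒ U) fun B => J ⟨A, fun x => B x, fun p u => p.tp B u⟩ fun t => t A B

/-- The pullback of a type family `B` along a map `f`, with the transport in `B`. -/
def assumePullback (J : Fibration → (Ex → Ex) → Typed) : Typed :=
  assume U fun A => assume U fun A' => assume (A ⇒ A') fun f => assume (A' ⇒ U) fun B =>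
  J ⟨A, fun x => B (f x), fun p u => (p.map A' f).tp B u⟩ fun t => t A A' f B

end Fibration

open Fibration

def sigmaOut := defn 59 <| assumeFam fun D _ => D.outTyped
def sigmaIn := defn 60 <| assumeFam fun D _ => D.inTyped
def sigmaIn_out := thm 61 <| assumeFam fun D F => D.inOutTyped (F sigmaIn) (F sigmaOut)
def sigmaOut_in := thm 62 <| assumeFam fun D F => D.outInTyped (F sigmaIn) (F sigmaOut)
def sigmaOut_isEquiv := thm 63 <| assumeFam fun D F =>
  D.equivTyped (F sigmaIn) (F sigmaOut) (F sigmaIn_out) (F sigmaOut_in)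

def pullbackOut := defn 64 <| assumePullback fun D _ => D.outTyped
def pullbackIn := defn 65 <| assumePullback fun D _ => D.inTyped
def pullbackIn_out := thm 66 <| assumePullback fun D F =>
  D.inOutTyped (F pullbackIn) (F pullbackOut)
def pullbackOut_in := thm 67 <| assumePullback fun D F =>
  D.outInTyped (F pullbackIn) (F pullbackOut)
def pullbackOut_isEquiv := thm 68 <| assumePullback fun D F =>
  D.equivTyped (F pullbackIn) (F pullbackOut) (F pullbackIn_out) (F pullbackOut_in)

/-- The fibration given by a type family. -/
def famFib (A B : Ex) : Fibration := ⟨A, fun x => B x, fun p u => p.tp B u⟩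

/-! ### Closure properties of truncated types -/

/-- The path between two points of a contractible type. -/
def contrPath (A h x y : Ex) : Path :=
  ⟨A, x, y, (contrSg (idt A x y)).fst (idIsType zero A h x y)⟩

/-- In the inductive step a path type of the sum is a retract of a sum of path types, to which the
induction hypothesis applies. -/
def isType_sigma := thm 69 <| assume nat fun k =>
  let T : Ex → Ex := fun k => pi U fun A => pi (A ⇒ U) fun B =>
    isType k A ⇒ (pi A fun x => isType k (B x)) ⇒ isType k (sig A B)
  ⟨T k, indNat₁ (lam T)
    (lam₄ fun A B hA hB =>
      let S : Sg := ⟨A, fun x => B x⟩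
      let D := famFib A B
      let a : Ex := (contrSg A).fst hA
      let b : Ex := (contrSg (B a)).fst (hB a)
      (contrSg (sig A B)).mk' (S.mk' a b) (lam fun w =>
        let p : Path := ⟨A, a, S.fst w, (contrSg A).snd hA (S.fst w)⟩
        sigmaIn A B a b w ((D.codeAt a b w).mk' p
          (contrPath (B (S.fst w)) (hB (S.fst w)) (p.tp B b) (S.snd w)))))
    (lam₂ fun k H => lam₄ fun A B hA hB => lam fun w =>
      let S : Sg := ⟨A, fun x => B x⟩
      let D := famFib A B
      S.ind (fun w => pi S.ty fun w' => isType k (idt S.ty w w')) (fun x b => lam fun w' =>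
        let c := D.codeAt x b w'
        isType_retract k c.ty (idt S.ty (S.mk' x b) w') (sigmaOut A B x b w') (sigmaIn A B x b w')
          (sigmaIn_out A B x b w')
          (H c.A c.fam (hA x (S.fst w'))
            (lam fun p => hB (S.fst w') ((⟨A, x, S.fst w', p⟩ : Path).tp B b) (S.snd w')))) w)
    k⟩

/-- The type of pointwise paths between two functions. -/
def htpy (A B f g : Ex) : Ex := pi A fun x => idt (B x) (f x) (g x)

def assumeFns (J : Ex → Ex → Ex → Typed) : Typed :=
  assume U fun A => assume (A ⇒ U) fun B => assume (pi A fun x => B x) fun f => J A B f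

def funExt := defn 70 <| assumeFns fun A B f => assume (pi A fun x => B x) fun g =>
  assume (htpy A B f g) fun H =>
  let F := pi A fun x => B x
  ⟨idt F f g, invEquiv (idt F f g) (htpy A B f g) (happly A B f g) (Lib.funext A B f g) H⟩

/-- Function extensionality turns a homotopy into a path, where path induction applies; the result
is carried back along `happly (funExt H) = H`. -/
def htpyInd := thm 71 <| assumeFns fun A B f =>
  let F := pi A fun x => B x
  assume (pi F fun g => htpy A B f g ⇒ U) fun C =>
  assume (C f (lam fun x => refl (B x) (f x))) fun d => assume F fun g =>
  assume (htpy A B f g) fun H =>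
  let p := funExt A B f g H
  ⟨C g H, (⟨htpy A B f g, happly A B f g p, H,
      invEquiv_right (idt F f g) (htpy A B f g) (happly A B f g) (Lib.funext A B f g) H⟩ : Path).tp
    (C g) ((⟨F, f, g, p⟩ : Path).ind (fun g p => C g (happly A B f g p)) d)⟩

def isType_pi := thm 72 <| assume nat fun k =>
  let T : Ex → Ex := fun k => pi U fun A => pi (A ⇒ U) fun B =>
    (pi A fun x => isType k (B x)) ⇒ isType k (pi A fun x => B x)
  ⟨T k, indNat₁ (lam T)
    (lam₃ fun A B h =>
      let F := pi A fun x => B x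
      let c := lam fun x => (contrSg (B x)).fst (h x)
      (contrSg F).mk' c (lam fun g => funExt A B c g (lam fun x => (contrSg (B x)).snd (h x) (g x))))
    (lam₂ fun k H => lam₃ fun A B h => lam₂ fun f g =>
      let F := pi A fun x => B x
      isType_retract k (htpy A B f g) (idt F f g) (happly A B f g) (funExt A B f g)
        (invEquiv_left (idt F f g) (htpy A B f g) (happly A B f g) (Lib.funext A B f g))
        (H A (lam fun x => idt (B x) (f x) (g x)) (lam fun x => h x (f x) (g x))))
    k⟩

/-- `isContr A` is built from `A` and its identity types by sums and products, so it inherits the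
level of `A`. -/
def isType_isContr := thm 73 <| assume nat fun k => assume U fun A => assume (isType k A) fun h =>
  ⟨isType k (isContr A), isType_sigma k A (contrSg A).fam h (lam fun a =>
    isType_pi k A (lam fun a' => idt A a a') (lam fun a' => idIsType k A h a a'))⟩

def isType_isType := thm 74 <| assume nat fun k =>
  let T : Ex → Ex := fun k => pi U fun A => isType k A ⇒ isType k (isType k A)
  ⟨T k, indNat₁ (lam T) (lam₂ fun A h => isType_isContr zero A h)
    (lam₂ fun k H => lam₂ fun A h =>
      isType_pi (succ k) A (lam fun x => pi A fun y => isType k (idt A x y)) (lam fun x =>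
        isType_pi (succ k) A (lam fun y => isType k (idt A x y)) (lam fun y =>
          idIsType k (isType k (idt A x y)) (H (idt A x y) (h x y)))))
    k⟩

def isType_fib := thm 75 <| assume nat fun k => assume U fun A => assume U fun B =>
  assume (isType k A) fun hA => assume (isType k B) fun hB => assume (A ⇒ B) fun f =>
  assume B fun b =>
  ⟨isType k (fib A B f b), isType_sigma k A (fibSg A B f b).fam hA
    (lam fun x => idIsType k B hB (f x) b)⟩

def isType_equiv := thm 76 <| assume nat fun k => assume U fun A => assume U fun B =>
  assume (isType k A) fun hA => assume (isType k B) fun hB =>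
  ⟨isType k (equiv A B),
    isType_sigma k (A ⇒ B) (lam fun f => isEquiv A B f)
      (isType_pi k A (lam fun _ => B) (lam fun _ => hB))
      (lam fun f => isType_pi k B (lam fun b => isContr (fib A B f b))
        (lam fun b => isType_isContr k (fib A B f b) (isType_fib k A B hA hB f b)))⟩

/-- `isType` and `isType.up` are different raw terms, because their recursion motives name different
universes; induction on `k` compares them. -/
def isType_lift := thm 77 <| assume nat fun k =>
  let T : Ex → Ex := fun k => pi U fun A => isType k A ⇒ isType.up k A
  ⟨T k, indNat₁ (lam T) (lam₂ fun _ h => h)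
    (lam₂ fun _ H => lam₄ fun A h x y => H (idt A x y) (h x y)) k⟩

/-! ### Equivalence induction and the type of truncated types -/

def idToEquiv_isEquiv (A B : Ex) (F : Item) : Ex :=
  F.up (idt.up U A B) (equiv A B) (idToEquiv A B) (ua A B)

/-- Univalence reduces a statement about equivalences out of `A` to path induction in the universe.
-/
def equivInd := thm 78 <| assume U fun A => assume (pi U fun B => equiv A B ⇒ U) fun C =>
  assume (C A (pair (A ⇒ A) (lam fun f => isEquiv A A f) (lam fun x => x) (idIsEquiv A))) fun d =>
  assume U fun B => assume (equiv A B) fun e =>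
  let p := idToEquiv_isEquiv A B invEquiv e
  ⟨C B e, (⟨equiv A B, idToEquiv A B p, e, idToEquiv_isEquiv A B invEquiv_right e⟩ : Path).tp (C B)
    (indLeft.up U A (lam₂ fun B p => C B (idToEquiv A B p)) d B p)⟩

/-- The type of `(k - 2)`-types. -/
def kType := defn 79 <| assume nat fun k => ⟨U₁, sig.up U (lam fun A => isType k A)⟩

/-- By univalence `A = B` is a retract of the type of equivalences, which is a `(k - 2)`-type when
`A` and `B` are. The second components add only paths in a `(k - 2)`-type. Thus `truncCode` can be
defined by recursion on the next truncation. -/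
def isType_kType := thm 80 <| assume nat fun k =>
  let P := lam fun A => isType k A
  let K := kType k
  ⟨isType.up (succ k) K, lam fun w =>
    indSig.up U P (lam fun w => pi K fun w' => isType.up k (idt.up K w w')) (lam₂ fun A a =>
      lam fun w' =>
        let B := fst.up U P w'
        let b := snd.up U P w'
        let tp : Ex → Ex := fun p => transport.up U P A B p a
        let Q := lam fun p => idt (isType k B) (tp p) b
        isType_retract.up k (sig.up (idt.up U A B) Q) (idt.up K (pair.up U P A a) w')
          (sigmaOut.up U P A a w') (sigmaIn.up U P A a w') (sigmaIn_out.up U P A a w')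
          (isType_sigma.up k (idt.up U A B) Q
            (isType_retract.up k (equiv A B) (idt.up U A B) (idToEquiv A B)
              (idToEquiv_isEquiv A B invEquiv) (idToEquiv_isEquiv A B invEquiv_left)
              (isType_lift k (equiv A B) (isType_equiv k A B a b)))
            (lam fun p => idIsType.up k (isType k B)
              (isType_lift k (isType k B) (isType_isType k B b)) (tp p) b))) w⟩

/-! ### The identity types of a truncation -/

/-- The family of types `trunc k (x = x')` over `tr x' : trunc (k + 1) X`. -/
def truncCode := defn 81 <| assume nat fun k => assume U fun X => assume X fun x =>
  assume (trunc (succ k) X) fun u =>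
  ⟨kType k, indTrunc₁ (succ k) X (lam fun _ => kType k) (lam fun _ => isType_kType k)
    (lam fun x' => pair.up U (lam fun A => isType k A) (trunc k (idt X x x'))
      (truncIsType k (idt X x x'))) u⟩

def assumeTwo (J : Ex → Ex → Ex → Ex → Typed) : Typed :=
  assume nat fun k => assume U fun X => assume X fun x => assume X fun x' => J k X x x'

def truncEncode := defn 82 <| assumeTwo fun k X x x' =>
  let T := trunc (succ k) X
  let e := tr (succ k) X
  assume (idt T (e x) (e x')) fun p =>
  ⟨trunc k (idt X x x'), (⟨T, e x, e x', p⟩ : Path).ind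
    (fun u _ => fst.up U (lam fun A => isType k A) (truncCode k X x u))
    (tr k (idt X x x) (refl X x))⟩

def truncDecode := defn 83 <| assumeTwo fun k X x x' =>
  let T := trunc (succ k) X
  let e := tr (succ k) X
  assume (trunc k (idt X x x')) fun c =>
  ⟨idt T (e x) (e x'), indTrunc k (idt X x x') (lam fun _ => idt T (e x) (e x'))
    (lam fun _ => truncIsType (succ k) X (e x) (e x')) (ap X T e x x') c⟩

/-- Only this composite is needed: retracts suffice to transfer contractibility. -/
def truncEncode_decode := thm 84 <| assumeTwo fun k X x x' =>
  assume (trunc k (idt X x x')) fun c =>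
  let P : Ex → Ex := fun x' => trunc k (idt X x x')
  let ed : Ex → Ex → Ex := fun x' c => truncEncode k X x x' (truncDecode k X x x' c)
  ⟨idt (P x') (ed x' c) c, indTrunc k (idt X x x') (lam fun c => idt (P x') (ed x' c) c)
    (lam fun c => idIsType k (P x') (truncIsType k (idt X x x')) (ed x' c) c)
    (lam fun p => (⟨X, x, x', p⟩ : Path).ind
      (fun x' p => idt (P x') (ed x' (tr k (idt X x x') p)) (tr k (idt X x x') p))
      (refl (P x) (tr k (idt X x x) (refl X x)))) c⟩

/-- The entries for path induction, equivalences and the identity types of truncations. -/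
def paths : List Decl :=
  [indLeft, indRight, transport, concat_inv_concat, concat_refl, isType_retract, invEquiv,
  invEquiv_right, invEquiv_left, isContr_singleton, fib_path, isEquiv_of_inverse, sigmaOut,
  sigmaIn, sigmaIn_out, sigmaOut_in, sigmaOut_isEquiv, pullbackOut, pullbackIn, pullbackIn_out,
  pullbackOut_in, pullbackOut_isEquiv, isType_sigma, funExt, htpyInd, isType_pi, isType_isContr,
  isType_isType, isType_fib, isType_equiv, isType_lift, equivInd, kType, isType_kType,
  truncCode, truncEncode, truncDecode, truncEncode_decode].map Item.decl

end HoTT.Lib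

namespace HoTT.Lib

/-! ### Connected types and maps -/

/-- `isConn k A` says that `A` is `(k - 2)`-connected. -/
def isConn := defn 85 <| assume nat fun k => assume U fun A => ⟨U, isContr (trunc k A)⟩

/-- The center of the truncation of a connected type. -/
def connCenter (k A h : Ex) : Ex := (contrSg (trunc k A)).fst h

/-- The path from the center of the truncation of a connected type to another point. -/
def connPath (k A h u : Ex) : Path :=
  ⟨trunc k A, connCenter k A h, u, (contrSg (trunc k A)).snd h u⟩

/-- Recursion on the truncation of `A`, into a type `B` with `h : isType k B`. -/
def truncRec (k A B h : Ex) (f : Ex → Ex) (u : Ex) : Ex :=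
  indTrunc k A (lam fun _ => B) (lam fun _ => h) (lam f) u

/-- Induction on the truncation of `A` for the identities `l u = r u` in the truncation of `B`. -/
def truncIndPath (k A B : Ex) (l r : Ex → Ex) (f : Ex → Ex) (u : Ex) : Ex :=
  indTrunc k A (lam fun u => idt (trunc k B) (l u) (r u))
    (lam fun u => idIsType k (trunc k B) (truncIsType k B) (l u) (r u)) (lam f) u

def isConn_retract := thm 86 <| assume nat fun k => assume U fun A => assume U fun B =>
  assume (B ⇒ A) fun s => assume (A ⇒ B) fun r => assume (pi B fun b => idt B (r (s b)) b) fun e =>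
  assume (isConn k A) fun h =>
  let c := truncMap k A B r (connCenter k A h)
  ⟨isConn k B, (contrSg (trunc k B)).mk' c (lam fun v =>
    truncIndPath k B B (fun _ => c) (fun v => v) (fun b =>
      ((connPath k A h (tr k A (s b))).map (trunc k B) (truncMap k A B r) ⬝
        (⟨B, r (s b), b, e b⟩ : Path).map (trunc k B) (tr k B)).p) v)⟩

/-- `‖a = a'‖` is a retract of `|a| = |a'|`, an identity type of a contractible type. -/
def isConn_path := thm 87 <| assume nat fun k => assume U fun A => assume (isConn (succ k) A) fun h =>
  assume A fun a => assume A fun a' =>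
  let T := trunc (succ k) A
  let e := tr (succ k) A
  ⟨isConn k (idt A a a'), isType_retract zero (idt T (e a) (e a')) (trunc k (idt A a a'))
    (truncDecode k A a a') (truncEncode k A a a') (truncEncode_decode k A a a')
    (idIsType zero T h (e a) (e a'))⟩

def isType_of_isProp := thm 88 <| assume nat fun k =>
  let T : Ex → Ex := fun k => pi U fun P => isType one P ⇒ isType (succ k) P
  ⟨T k, indNat₁ (lam T) (lam₂ fun _ h => h)
    (lam₂ fun k H => lam₂ fun P h => idIsType (succ k) P (H P h)) k⟩

def isConn_inhabited := thm 89 <| assume nat fun k => assume U fun A =>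
  assume (isConn (succ k) A) fun h =>
  ⟨trunc one A, truncRec (succ k) A (trunc one A)
    (isType_of_isProp k (trunc one A) (truncIsType one A)) (fun a => tr one A a)
    (connCenter (succ k) A h)⟩

/-- A point `c` of `isContr A` makes `A`, hence `isContr A` itself, contractible. -/
def isProp_isContr := thm 90 <| assume U fun A => ⟨isType one (isContr A),
  lam₂ fun c c' => idIsType zero (isContr A) (isType_isContr zero A c) c c'⟩

/-- Contractibility is a proposition, so a point `a` may be chosen. Then `|a|` is a center, since
decoding the center of `‖a = a'‖` joins it to `|a'|`. -/
def isConn_of_path := thm 91 <| assume nat fun k => assume U fun A =>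
  assume (trunc one A) fun t => assume (pi A fun a => pi A fun a' => isConn k (idt A a a')) fun h =>
  let T := trunc (succ k) A
  ⟨isConn (succ k) A, truncRec one A (isContr T) (isProp_isContr T) (fun a =>
    (contrSg T).mk' (tr (succ k) A a) (lam fun u =>
      truncIndPath (succ k) A A (fun _ => tr (succ k) A a) (fun u => u)
        (fun a' => truncDecode k A a a' (connCenter k (idt A a a') (h a a'))) u)) t⟩

def isConn_one := thm 92 <| assume U fun A => assume (trunc one A) fun t =>
  let T := trunc one A
  ⟨isConn one A, (contrSg T).mk' t
    (lam fun u => (contrSg (idt T t u)).fst (truncIsType one A t u))⟩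

/-- `isConnMap k A B g` says that the fibers of `g` are `(k - 2)`-connected. -/
def isConnMap := defn 93 <| assume nat fun k => assume U fun A => assume U fun B =>
  assume (A ⇒ B) fun g => ⟨U, pi B fun b => isConn k (fib A B g b)⟩

/-! ### The fibers of the action of a map on paths -/

/-- The fiber of `ap g` over the path given by a point `w` of the fiber of `g` over `g a`. -/
def apFib (A B g a w : Ex) : Sg :=
  let S := fibSg A B g (g a)
  let x := S.fst w
  fibSg (idt A x a) (idt B (g x) (g a)) (ap A B g x a) (S.snd w)

/-- The canonical point of the fiber of `g` over `g a`. -/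
def fibPt (A B g a : Ex) : Ex := (fibSg A B g (g a)).mk' a (refl B (g a))

def assumeFibPt (J : Ex → Ex → Ex → Ex → Ex → Typed) : Typed :=
  assume U fun A => assume U fun B => assume (A ⇒ B) fun g => assume A fun a =>
  assume (fib A B g (g a)) fun w => J A B g a w

def apFibOut := defn 94 <| assumeFibPt fun A B g a w =>
  assume (idt (fib A B g (g a)) w (fibPt A B g a)) fun e =>
  ⟨(apFib A B g a w).ty,
    (⟨fib A B g (g a), w, fibPt A B g a, e⟩ : Path).indR (fun w _ => (apFib A B g a w).ty)
      ((apFib A B g a (fibPt A B g a)).mk' (refl A a)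
        (refl (idt B (g a) (g a)) (refl B (g a))))⟩

def apFibIn := defn 95 <| assumeFibPt fun A B g a w =>
  assume (apFib A B g a w).ty fun c =>
  let S := fibSg A B g (g a)
  let P : Ex → Ex := fun w => idt S.ty w (fibPt A B g a)
  ⟨P w, S.ind (fun w => (apFib A B g a w).ty ⇒ P w) (fun x p => lam fun c =>
    (fibSg (idt A x a) (idt B (g x) (g a)) (ap A B g x a) p).ind (fun _ => P (S.mk' x p))
      (fun r t => (⟨A, x, a, r⟩ : Path).indR
        (fun x r => pi (idt B (g x) (g a)) fun p =>
          idt (idt B (g x) (g a)) (ap A B g x a r) p ⇒ P (S.mk' x p))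
        (lam₂ fun p t => (⟨idt B (g a) (g a), refl B (g a), p, t⟩ : Path).ind
          (fun p _ => P (S.mk' a p)) (refl S.ty (fibPt A B g a))) p t) c) w c⟩

def apFibIn_out := thm 96 <| assumeFibPt fun A B g a w =>
  let S := fibSg A B g (g a)
  let P : Ex → Ex := fun w => idt S.ty w (fibPt A B g a)
  assume (P w) fun e =>
  let T : Ex → Ex → Ex := fun w e => idt (P w) (apFibIn A B g a w (apFibOut A B g a w e)) e
  ⟨T w e, (⟨S.ty, w, fibPt A B g a, e⟩ : Path).indR T
    (refl (P (fibPt A B g a)) (refl S.ty (fibPt A B g a)))⟩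

def apFibOut_in := thm 97 <| assumeFibPt fun A B g a w =>
  let S := fibSg A B g (g a)
  let F : Ex → Ex := fun w => (apFib A B g a w).ty
  let T : Ex → Ex → Ex := fun w c => idt (F w) (apFibOut A B g a w (apFibIn A B g a w c)) c
  ⟨pi (F w) fun c => T w c, S.ind (fun w => pi (F w) fun c => T w c) (fun x p => lam fun c =>
    (fibSg (idt A x a) (idt B (g x) (g a)) (ap A B g x a) p).ind (fun c => T (S.mk' x p) c)
      (fun r t => (⟨A, x, a, r⟩ : Path).indR
        (fun x r => pi (idt B (g x) (g a)) fun p =>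
          pi (idt (idt B (g x) (g a)) (ap A B g x a r) p) fun t =>
            T (S.mk' x p) ((apFib A B g a (S.mk' x p)).mk' r t))
        (lam₂ fun p t => (⟨idt B (g a) (g a), refl B (g a), p, t⟩ : Path).ind
          (fun p t => T (S.mk' a p) ((apFib A B g a (S.mk' a p)).mk' (refl A a) t))
          (refl (F (fibPt A B g a)) ((apFib A B g a (fibPt A B g a)).mk' (refl A a)
            (refl (idt B (g a) (g a)) (refl B (g a)))))) p t) c) w⟩

/-! ### Properties of connected maps -/

def assumeMap (J : Ex → Ex → Ex → Ex → Typed) : Typed :=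
  assume nat fun k => assume U fun A => assume U fun B => assume (A ⇒ B) fun g => J k A B g

/-- The fiber of `ap g` over `p` is a retract of the path type from `(a, p)` to `(a', refl)` in a
fiber of `g`, and path types of connected types are connected one level lower. -/
def isConnMap_ap := thm 98 <| assumeMap fun k A B g => assume (isConnMap (succ k) A B g) fun h =>
  assume A fun a => assume A fun a' =>
  let F := fib A B g (g a')
  let pt := fibPt A B g a'
  ⟨isConnMap k (idt A a a') (idt B (g a) (g a')) (ap A B g a a'), lam fun p =>
    let w := (fibSg A B g (g a')).mk' a p
    isConn_retract k (idt F w pt) (apFib A B g a' w).ty (apFibIn A B g a' w) (apFibOut A B g a' w)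
      (apFibOut_in A B g a' w) (isConn_path k F (h (g a')) w pt)⟩

def isConnMap_of_ap := thm 99 <| assumeMap fun k A B g => assume (isSurj A B g) fun s =>
  assume (pi A fun a => pi A fun a' =>
    isConnMap k (idt A a a') (idt B (g a) (g a')) (ap A B g a a')) fun h =>
  ⟨isConnMap (succ k) A B g, lam fun b =>
    let S : Ex → Sg := fun b => fibSg A B g b
    isConn_of_path k (S b).ty (s b) (lam₂ fun w w' =>
      (S b).ind (fun w' => pi (S b).ty fun w => isConn k (idt (S b).ty w w')) (fun a p =>
        -- It suffices to treat `b` of the form `g a` and the point `(a, refl)`, where the path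
        -- types are retracts of fibers of `ap g`.
        (⟨B, g a, b, p⟩ : Path).ind
          (fun b p => pi (S b).ty fun w => isConn k (idt (S b).ty w ((S b).mk' a p)))
          (lam fun w => isConn_retract k (apFib A B g a w).ty
            (idt (S (g a)).ty w (fibPt A B g a)) (apFibOut A B g a w) (apFibIn A B g a w)
            (apFibIn_out A B g a w) (h ((S (g a)).fst w) a ((S (g a)).snd w)))) w' w)⟩

/-- The underlying map of an equivalence. -/
def equivFn (A B e : Ex) : Ex := fst (A ⇒ B) (lam fun f => isEquiv A B f) e

/-- By equivalence induction the equivalence is the identity, and the composite is then convertible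
to `g` by `η`. -/
def isConnMap_comp_equiv := thm 100 <| assumeMap fun k A B g => assume (isConnMap k A B g) fun h =>
  assume U fun W => assume (equiv B W) fun e =>
  let T : Ex → Ex → Ex := fun W e => isConnMap k A W (lam fun a => equivFn B W e (g a))
  ⟨T W e, equivInd B (lam₂ T) h W e⟩

def isConnMap_of_comp_equiv := thm 101 <| assumeMap fun k A B g => assume U fun W =>
  assume (equiv B W) fun e =>
  let T : Ex → Ex → Ex := fun W e =>
    isConnMap k A W (lam fun a => equivFn B W e (g a)) ⇒ isConnMap k A B g
  ⟨T W e, equivInd B (lam₂ T) (lam fun h => h) W e⟩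

def isConnMap_htpy := thm 102 <| assumeMap fun k A B g => assume (A ⇒ B) fun g' =>
  assume (pi A fun a => idt B (g a) (g' a)) fun H => assume (isConnMap k A B g) fun h =>
  ⟨isConnMap k A B g', htpyInd A (lam fun _ => B) g (lam₂ fun g' _ => isConnMap k A B g') h g' H⟩

/-- Truncation induction on the base point gives a center over `u`, which over `|a|` is the class of
`(a, refl)`; path induction on the points of the fiber shows that it is a center. -/
def isConnMap_tr := thm 103 <| assume nat fun k => assume U fun A =>
  let T := trunc k A
  let S : Ex → Sg := fun u => fibSg A T (tr k A) u
  let c : Ex → Ex := fun u => indTrunc k A (lam fun u => trunc k (S u).ty)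
    (lam fun u => truncIsType k (S u).ty)
    (lam fun a => tr k (S (tr k A a)).ty (fibPt A T (tr k A) a)) u
  ⟨isConnMap k A T (tr k A), lam fun u => (contrSg (trunc k (S u).ty)).mk' (c u) (lam fun v =>
    truncIndPath k (S u).ty (S u).ty (fun _ => c u) (fun v => v) (fun w =>
      (S u).ind (fun w => idt (trunc k (S u).ty) (c u) (tr k (S u).ty w)) (fun a p =>
        (⟨T, tr k A a, u, p⟩ : Path).ind
          (fun u p => idt (trunc k (S u).ty) (c u) (tr k (S u).ty ((S u).mk' a p)))
          (refl (trunc k (S (tr k A a)).ty) (c (tr k A a)))) w) v)⟩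

def isConnMap_of_isEquiv := thm 104 <| assume nat fun k => assume U fun A => assume U fun B =>
  assume (trunc k A ⇒ B) fun f => assume (isEquiv (trunc k A) B f) fun h =>
  ⟨isConnMap k A B (lam fun a => f (tr k A a)),
    isConnMap_comp_equiv k A (trunc k A) (tr k A) (isConnMap_tr k A) B
      (pair (trunc k A ⇒ B) (lam fun f => isEquiv (trunc k A) B f) f h)⟩

/-- The inverse at `b` is the projection to `‖A‖` of the center of the truncated fiber of `d`. Over
`f |a|` this center equals the class of `(a, refl)`. The other composite is treated by induction
over the truncated fiber, as `B` is truncated. -/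
def isEquiv_of_isConnMap := thm 105 <| assume nat fun k => assume U fun A => assume U fun B =>
  assume (isType k B) fun hB => assume (trunc k A ⇒ B) fun f =>
  let d := lam fun a => f (tr k A a)
  assume (isConnMap k A B d) fun h =>
  let T := trunc k A
  let S : Ex → Sg := fun b => ⟨A, fun a => idt B (f (tr k A a)) b⟩
  let t : Ex → Ex := fun b => truncMap k (S b).ty A (lam fun w => (S b).fst w)
  let g : Ex → Ex := fun b => t b (connCenter k (S b).ty (h b))
  ⟨isEquiv T B f, isEquiv_of_inverse T B f (lam g)
    (lam fun u => truncIndPath k A A (fun u => g (f u)) (fun u => u) (fun a =>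
      let b := f (tr k A a)
      ((connPath k (S b).ty (h b) (tr k (S b).ty ((S b).mk' a (refl B b)))).map T (t b)).p) u)
    (lam fun b => indTrunc k (S b).ty (lam fun v => idt B (f (t b v)) b)
      (lam fun v => idIsType k B hB (f (t b v)) b) (lam fun w => (S b).snd w)
      (connCenter k (S b).ty (h b)))⟩

/-- The entries for connected maps. -/
def connectedMaps : List Decl :=
  [isConn, isConn_retract, isConn_path, isType_of_isProp, isConn_inhabited, isProp_isContr,
  isConn_of_path, isConn_one, isConnMap, apFibOut, apFibIn, apFibIn_out, apFibOut_in,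
  isConnMap_ap, isConnMap_of_ap, isConnMap_comp_equiv, isConnMap_of_comp_equiv, isConnMap_htpy,
  isConnMap_tr, isConnMap_of_isEquiv, isEquiv_of_isConnMap].map Item.decl

end HoTT.Lib

namespace HoTT.Lib

/-! ### Maps that are surjective on iterated path spaces -/

/-- For `m = 0`, `f` is surjective as soon as its domain has a point; for `m + 1`, the action of `f`
on all path spaces has the property for `m`. -/
def isSurjOnPaths := defn 106 <| assume nat fun m =>
  let T := pi U fun X => pi U fun Y => (X ⇒ Y) ⇒ U
  ⟨T, indNat₁ (lam fun _ => T)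
    (lam₃ fun X Y f => X ⇒ isSurj X Y f)
    (lam₂ fun _ R => lam₃ fun X Y f => pi X fun x => pi X fun x' =>
      R (idt X x x') (idt Y (f x) (f x')) (ap X Y f x x')) m⟩

/-- Logical equivalence from its two directions. -/
def iffIntro (A B u v : Ex) : Ex := pair (A ⇒ B) (lam fun _ => B ⇒ A) u v
def iffMp (A B h : Ex) : Ex := fst (A ⇒ B) (lam fun _ => B ⇒ A) h
def iffMpr (A B h : Ex) : Ex := snd (A ⇒ B) (lam fun _ => B ⇒ A) h

/-- A map `X → Σ (y : Y), B (η y)`, given by `f : X → Y` and `h`. -/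
structure Lift : Type where
  X : Ex
  Y : Ex
  Y' : Ex
  η : Ex
  B : Ex → Ex
  f : Ex
  h : Ex

namespace Lift

def assume (J : Lift → (Ex → Ex) → Typed) : Typed :=
  Lib.assume U fun X => Lib.assume U fun Y => Lib.assume U fun Y' => Lib.assume (Y ⇒ Y') fun η =>
  Lib.assume (Y' ⇒ U) fun B => Lib.assume (X ⇒ Y) fun f =>
  Lib.assume (pi X fun x => B (η (f x))) fun h => J ⟨X, Y, Y', η, B.app, f, h⟩ fun t => t X Y Y' η B f h

variable (L : Lift)

/-- `Σ (y' : Y'), B y'` -/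
def total : Sg := ⟨L.Y', L.B⟩

/-- `Σ (y : Y), B (η y)` -/
def pull : Sg := ⟨L.Y, fun y => L.B (L.η y)⟩

def toTotal (x : Ex) : Ex := L.total.mk' (L.η (L.f x)) (L.h x)
def toPull (x : Ex) : Ex := L.pull.mk' (L.f x) (L.h x)

/-- The fiber of `toTotal` over `z`. -/
def fibTotal (z : Ex) : Sg := ⟨L.X, fun x => idt L.total.ty (L.toTotal x) z⟩

/-- The fiber of `toPull` over `w`. -/
def fibPull (w : Ex) : Sg := ⟨L.X, fun x => idt L.pull.ty (L.toPull x) w⟩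

/-- Transport in `B` along a path in `Y'`. -/
def tp (y y' p b : Ex) : Ex := (⟨L.Y', y, y', p⟩ : Path).tp (lam L.B) b

/-- The action of the data on paths from `x` to `x'`, where `k` is the action on `h`. -/
def path (k x x' : Ex) : Lift where
  X := idt L.X x x'
  Y := idt L.Y (L.f x) (L.f x')
  Y' := idt L.Y' (L.η (L.f x)) (L.η (L.f x'))
  η := ap L.Y L.Y' L.η (L.f x) (L.f x')
  B := fun p => idt (L.B (L.η (L.f x'))) (L.tp (L.η (L.f x)) (L.η (L.f x')) p (L.h x)) (L.h x')
  f := ap L.X L.Y L.f x x'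
  h := k

def assumePoints (J : Ex → Ex → Typed) : Typed :=
  Lib.assume L.X fun x => Lib.assume L.X fun x' => J x x'

def connTotal (k : Ex) : Ex := isConnMap k L.X L.total.ty (lam L.toTotal)
def connPull (k : Ex) : Ex := isConnMap k L.X L.pull.ty (lam L.toPull)

end Lift

/-- The action on paths of the second component of a lift. -/
def liftPath := defn 107 <| Lift.assume fun L _ => L.assumePoints fun x x' =>
  assume (idt L.X x x') fun s =>
  let Q : Ex → Ex → Ex := fun x' s => idt (L.B (L.η (L.f x')))
    (L.tp (L.η (L.f x)) (L.η (L.f x'))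
      (ap L.Y L.Y' L.η (L.f x) (L.f x') (ap L.X L.Y L.f x x' s)) (L.h x)) (L.h x')
  ⟨Q x' s, (⟨L.X, x, x', s⟩ : Path).ind Q (refl (L.B (L.η (L.f x))) (L.h x))⟩

/-- Under the description of paths in a sum, the action of `toTotal` on paths is `toTotal` of the
path data. `pullPath_htpy` is the analogue for `toPull`; together they keep the induction within
lifts. -/
def totalPath_htpy := thm 108 <| Lift.assume fun L F => L.assumePoints fun x x' =>
  assume (idt L.X x x') fun s =>
  let P : Ex → Lift := fun x' => L.path (F liftPath x x') x x'
  let T : Ex → Ex → Ex := fun x' s => idt (P x').total.ty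
    (sigmaOut L.Y' (lam L.B) (L.η (L.f x)) (L.h x) (L.toTotal x')
      (ap L.X L.total.ty (lam L.toTotal) x x' s)) ((P x').toTotal s)
  ⟨T x' s, (⟨L.X, x, x', s⟩ : Path).ind T
    (refl (P x).total.ty ((P x).toTotal (refl L.X x)))⟩

def pullPath_htpy := thm 109 <| Lift.assume fun L F => L.assumePoints fun x x' =>
  assume (idt L.X x x') fun s =>
  let P : Ex → Lift := fun x' => L.path (F liftPath x x') x x'
  let T : Ex → Ex → Ex := fun x' s => idt (P x').pull.ty
    (pullbackOut L.Y L.Y' L.η (lam L.B) (L.f x) (L.h x) (L.toPull x')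
      (ap L.X L.pull.ty (lam L.toPull) x x' s)) ((P x').toPull s)
  ⟨T x' s, (⟨L.X, x, x', s⟩ : Path).ind T
    (refl (P x).pull.ty ((P x).toPull (refl L.X x)))⟩

def totalPath_isConnMap := thm 110 <| assume nat fun k => Lift.assume fun L F =>
  assume (L.connTotal (succ k)) fun c => L.assumePoints fun x x' =>
  let P := L.path (F liftPath x x') x x'
  let Q := idt L.total.ty (L.toTotal x) (L.toTotal x')
  let g := ap L.X L.total.ty (lam L.toTotal) x x'
  let out := sigmaOut L.Y' (lam L.B) (L.η (L.f x)) (L.h x) (L.toTotal x')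
  let e := pair (Q ⇒ P.total.ty) (lam fun f => isEquiv Q P.total.ty f) out
    (sigmaOut_isEquiv L.Y' (lam L.B) (L.η (L.f x)) (L.h x) (L.toTotal x'))
  ⟨P.connTotal k, isConnMap_htpy k P.X P.total.ty (lam fun s => out (g s)) (lam P.toTotal)
    (F totalPath_htpy x x')
    (isConnMap_comp_equiv k P.X Q g (isConnMap_ap k L.X L.total.ty (lam L.toTotal) c x x')
      P.total.ty e)⟩

def pullPath_iff := thm 111 <| assume nat fun k => Lift.assume fun L F => L.assumePoints fun x x' =>
  let P := L.path (F liftPath x x') x x'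
  let Q := idt L.pull.ty (L.toPull x) (L.toPull x')
  let g := ap L.X L.pull.ty (lam L.toPull) x x'
  let out := pullbackOut L.Y L.Y' L.η (lam L.B) (L.f x) (L.h x) (L.toPull x')
  let e := pair (Q ⇒ P.pull.ty) (lam fun f => isEquiv Q P.pull.ty f) out
    (pullbackOut_isEquiv L.Y L.Y' L.η (lam L.B) (L.f x) (L.h x) (L.toPull x'))
  let C := isConnMap k P.X Q g
  let H := F pullPath_htpy x x'
  let og := lam fun s => out (g s)
  ⟨iff C (P.connPull k), iffIntro C (P.connPull k)
    (lam fun c => isConnMap_htpy k P.X P.pull.ty og (lam P.toPull) H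
      (isConnMap_comp_equiv k P.X Q g c P.pull.ty e))
    (lam fun c => isConnMap_of_comp_equiv k P.X Q g P.pull.ty e
      (isConnMap_htpy k P.X P.pull.ty (lam P.toPull) og
        (lam fun s => inv P.pull.ty (out (g s)) (P.toPull s) (H s)) c))⟩

/-- Given `(y, b)`, some `x` has `(η (f x), h x) = (η y, b)`. The base component of this path merely
lifts along `ap η`, because `η` is at least 0-connected, and the lift gives `(f x, h x) = (y, b)`.
-/
def toPull_isSurj := thm 112 <| assume nat fun k => Lift.assume fun L _ =>
  assume (isConnMap (succ (succ k)) L.Y L.Y' L.η) fun cη =>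
  assume (L.connTotal (succ (succ k))) fun c =>
  let G : Ex → Sg := fun w => L.fibPull w
  let goal : Ex → Ex := fun w => trunc one (G w).ty
  let D : Sg := L.pull
  ⟨isSurj L.X D.ty (lam L.toPull), lam fun w => D.ind goal (fun y b =>
    let z := L.total.mk' (L.η y) b
    let E : Sg := L.fibTotal z
    truncRec one E.ty (goal (D.mk' y b)) (truncIsType one (G (D.mk' y b)).ty) (fun v =>
      let x := E.fst v
      let C : Sg := Fibration.code ⟨L.Y', L.B, fun p u => p.tp (lam L.B) u⟩ (L.η (L.f x)) (L.h x) (L.η y) b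
      let code := sigmaOut L.Y' (lam L.B) (L.η (L.f x)) (L.h x) z (E.snd v)
      let p' := C.fst code
      let A : Sg := fibSg (idt L.Y (L.f x) y) (idt L.Y' (L.η (L.f x)) (L.η y))
        (ap L.Y L.Y' L.η (L.f x) y) p'
      truncRec one A.ty (goal (D.mk' y b)) (truncIsType one (G (D.mk' y b)).ty) (fun r =>
        let p := A.fst r
        let ηp := ap L.Y L.Y' L.η (L.f x) y p
        let tpB : Ex → Ex := fun q => L.tp (L.η (L.f x)) (L.η y) q (L.h x)
        let C' : Sg := ⟨idt L.Y (L.f x) y, fun p =>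
          idt (L.B (L.η y)) (tpB (ap L.Y L.Y' L.η (L.f x) y p)) b⟩
        tr one (G (D.mk' y b)).ty ((G (D.mk' y b)).mk' x
          (pullbackIn L.Y L.Y' L.η (lam L.B) (L.f x) (L.h x) (D.mk' y b) (C'.mk' p
            (⟨L.B (L.η y), tpB ηp, tpB p',
              ap (idt L.Y' (L.η (L.f x)) (L.η y)) (L.B (L.η y)) (lam tpB) ηp p' (A.snd r)⟩ ⬝
              ⟨L.B (L.η y), L.tp (L.η (L.f x)) (L.η y) p' (L.h x), b, C.snd code⟩ : Path).p))))
        (isConn_inhabited k A.ty (isConnMap_ap (succ k) L.Y L.Y' L.η cη (L.f x) y p')))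
      (isConn_inhabited (succ k) E.ty (c z))) w⟩

/-- The hypotheses under which the connectivity of a lift is determined by `f`. -/
def Lift.assumeHyps (L : Lift) (k : Ex) (J : Ex → Ex → Ex → Ex → Typed) : Typed :=
  Lib.assume (isType k L.Y') fun hY => Lib.assume (pi L.Y' fun y => isType k (L.B y)) fun hB =>
  Lib.assume (isConnMap k L.Y L.Y' L.η) fun cη => Lib.assume (L.connTotal k) fun c => J hY hB cη c

/-- As `Y'` is a proposition, transporting `h x₀` gives a point of `B (η y)`; the pair of `y` with
it is merely hit by `toPull`. -/
def isSurj_of_connPull := thm 113 <| Lift.assume fun L _ => L.assumeHyps one fun hY _ _ _ =>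
  assume (L.connPull one) fun c => assume L.X fun x₀ =>
  ⟨isSurj L.X L.Y L.f, lam fun y =>
    let p := (contrSg (idt L.Y' (L.η (L.f x₀)) (L.η y))).fst (hY (L.η (L.f x₀)) (L.η y))
    let w := L.pull.mk' y (L.tp (L.η (L.f x₀)) (L.η y) p (L.h x₀))
    let G : Sg := L.fibPull w
    truncMap one G.ty (fib L.X L.Y L.f y) (lam fun v =>
      (fibSg L.X L.Y L.f y).mk' (G.fst v)
        (ap L.pull.ty L.Y (lam fun w => L.pull.fst w) (L.toPull (G.fst v)) w (G.snd v)))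
      (connCenter one G.ty (c w))⟩

/-- Connectedness of `toTotal` supplies the point of `X` that the hypothesis asks for. The second
components agree because `B` is a family of propositions. -/
def connPull_of_isSurj := thm 114 <| Lift.assume fun L _ => L.assumeHyps one fun _ hB _ c =>
  assume (L.X ⇒ isSurj L.X L.Y L.f) fun s =>
  let G : Ex → Sg := fun w => L.fibPull w
  ⟨L.connPull one, lam fun w => L.pull.ind (fun w => isConn one (G w).ty) (fun y b =>
    let z := L.total.mk' (L.η y) b
    let E : Sg := L.fibTotal z
    let F : Sg := fibSg L.X L.Y L.f y
    let w := L.pull.mk' y b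
    let T := trunc one (G w).ty
    isConn_one (G w).ty (truncRec one E.ty T (truncIsType one (G w).ty) (fun v =>
      truncMap one F.ty (G w).ty (lam fun v =>
        let x := F.fst v
        let p := F.snd v
        let tpB : Ex → Ex := fun p => L.tp (L.η (L.f x)) (L.η y)
          (ap L.Y L.Y' L.η (L.f x) y p) (L.h x)
        let C : Sg := ⟨idt L.Y (L.f x) y, fun p => idt (L.B (L.η y)) (tpB p) b⟩
        (G w).mk' x (pullbackIn L.Y L.Y' L.η (lam L.B) (L.f x) (L.h x) w (C.mk' p
          ((contrSg (idt (L.B (L.η y)) (tpB p) b)).fst (hB (L.η y) (tpB p) b)))))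
        (s (E.fst v) y))
      (connCenter one E.ty (c z)))) w⟩

def connPull_iff := thm 115 <| assume nat fun m =>
  let T : Ex → Ex := fun m => (Lift.assume fun L _ => L.assumeHyps (succ m) fun _ _ _ _ =>
    ⟨iff (L.connPull (succ m)) (isSurjOnPaths m L.X L.Y L.f), m⟩).ty
  ⟨T m, indNat₁ (lam T)
    (Lift.assume fun L F => L.assumeHyps one fun hY hB cη c =>
      ⟨U, iffIntro (L.connPull one) (L.X ⇒ isSurj L.X L.Y L.f)
        (F isSurj_of_connPull hY hB cη c) (F connPull_of_isSurj hY hB cη c)⟩).tm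
    (lam₂ fun m H => (Lift.assume fun L F => L.assumeHyps (succ (succ m)) fun hY hB cη c =>
      let R : Ex := isSurjOnPaths (succ m) L.X L.Y L.f
      let P : Ex → Ex → Lift := fun x x' => L.path (F liftPath x x') x x'
      let C : Ex → Ex → Ex := fun x x' => isConnMap (succ m) (P x x').X
        (idt L.pull.ty (L.toPull x) (L.toPull x')) (ap L.X L.pull.ty (lam L.toPull) x x')
      let C' : Ex → Ex → Ex := fun x x' => (P x x').connPull (succ m)
      let R' : Ex → Ex → Ex := fun x x' => isSurjOnPaths m (P x x').X (P x x').Y (P x x').f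
      let IH : Ex → Ex → Ex := fun x x' =>
        let Q := P x x'
        let η := L.η
        -- The path data satisfy the hypotheses one level lower: identity types drop a level, and
        -- the two connected maps stay connected on path spaces.
        H Q.X Q.Y Q.Y' Q.η (lam Q.B) Q.f Q.h (hY (η (L.f x)) (η (L.f x')))
          (lam fun p => hB (η (L.f x')) (L.tp (η (L.f x)) (η (L.f x')) p (L.h x)) (L.h x'))
          (isConnMap_ap (succ m) L.Y L.Y' η cη (L.f x) (L.f x'))
          (totalPath_isConnMap (succ m) L.X L.Y L.Y' η (lam L.B) L.f L.h c x x')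
      let E : Ex → Ex → Ex := fun x x' =>
        pullPath_iff (succ m) L.X L.Y L.Y' L.η (lam L.B) L.f L.h x x'
      ⟨U, iffIntro (L.connPull (succ (succ m))) R
        (lam fun d => lam₂ fun x x' => iffMp (C' x x') (R' x x') (IH x x')
          (iffMp (C x x') (C' x x') (E x x')
            (isConnMap_ap (succ m) L.X L.pull.ty (lam L.toPull) d x x')))
        (lam fun r => isConnMap_of_ap (succ m) L.X L.pull.ty (lam L.toPull)
          (toPull_isSurj m L.X L.Y L.Y' L.η (lam L.B) L.f L.h cη c)
          (lam₂ fun x x' => iffMpr (C x x') (C' x x') (E x x')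
            (iffMpr (C' x x') (R' x x') (IH x x') (r x x'))))⟩).tm) m⟩

/-- The entries for surjectivity on iterated path spaces. -/
def lifts : List Decl :=
  [isSurjOnPaths, liftPath, totalPath_htpy, pullPath_htpy, totalPath_isConnMap, pullPath_iff,
  toPull_isSurj, isSurj_of_connPull, connPull_of_isSurj, connPull_iff].map Item.decl

end HoTT.Lib

namespace HoTT.Lib

/-! ### Fibrations for a truncation and connected maps -/

def iffTrans (A B C h h' : Ex) : Ex := iffIntro A C
  (lam fun a => iffMp B C h' (iffMp A B h a)) (lam fun c => iffMpr A B h (iffMpr B C h' c))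

/-- The canonical point of the fiber of `truncMap k X Y f` over `tr k Y (f x)`. -/
def modalPt := defn 116 <| assume nat fun k => assume U fun X => assume U fun Y =>
  assume (X ⇒ Y) fun f => assume X fun x =>
  ⟨modalFib k X Y f (f x),
    (fibSg (trunc k X) (trunc k Y) (truncMap k X Y f) (tr k Y (f x))).mk' (tr k X x)
      (refl (trunc k Y) (tr k Y (f x)))⟩

/-- The fibers of the truncation of `f`, with their canonical points. -/
def modalLift (k X Y f : Ex) : Lift where
  X := X
  Y := Y
  Y' := trunc k Y
  η := tr k Y
  B := fib (trunc k X) (trunc k Y) (truncMap k X Y f)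
  f := f
  h := modalPt k X Y f

/-- The composition of `gamma` with the unit of the truncation. -/
def delta (k X Y f y w : Ex) : Ex := gamma k X Y f y (tr k (fib X Y f y) w)

/-- The fiber of `delta` over `v`. -/
def deltaFib (k X Y f y v : Ex) : Sg :=
  ⟨fib X Y f y, fun w => idt (modalFib k X Y f y) (delta k X Y f y w) v⟩

/-- The fiber of `delta` over the second component of `v`. -/
def deltaFibAt (k X Y f v : Ex) : Sg :=
  let S := (modalLift k X Y f).pull
  deltaFib k X Y f (S.fst v) (S.snd v)

def assumeXY (J : Ex → Ex → Ex → Ex → Typed) : Typed :=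
  assume nat fun k => assume U fun X => assume U fun Y => assume (X ⇒ Y) fun f => J k X Y f

/-- Summing the fibers of `‖f‖` over all of `‖Y‖` gives back `‖X‖`. Under this equivalence `toTotal`
is convertible to the unit of `X`. -/
def modalLift_connTotal := thm 117 <| assumeXY fun k X Y f =>
  let TX := trunc k X
  let TY := trunc k Y
  let f' := truncMap k X Y f
  let L := modalLift k X Y f
  let S : Ex → Sg := fun y => fibSg TX TY f' y
  let there : Ex → Ex := fun u => L.total.mk' (f' u) ((S (f' u)).mk' u (refl TY (f' u)))
  let back : Ex → Ex := fun w => (S (L.total.fst w)).fst (L.total.snd w)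
  let T : Ex → Ex := fun w => idt L.total.ty (there (back w)) w
  let e := isEquiv_of_inverse TX L.total.ty (lam there) (lam back) (lam fun u => refl TX u)
    (lam fun w => L.total.ind T (fun y v => (S y).ind (fun v => T (L.total.mk' y v)) (fun u q =>
      (⟨TY, f' u, y, q⟩ : Path).ind (fun y q => T (L.total.mk' y ((S y).mk' u q)))
        (refl L.total.ty (there u))) v) w)
  ⟨L.connTotal k, isConnMap_comp_equiv k X TX (tr k X) (isConnMap_tr k X) L.total.ty
    (pair (TX ⇒ L.total.ty) (lam fun f => isEquiv TX L.total.ty f) (lam there) e)⟩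

/-- Together with `deltaIn` it identifies the fiber of `δ` over `v` with the fiber of `toPull` over
`(y, v)`. The path inductions work because `δ (x, refl)` is convertible to `modalPt` at `x`. -/
def deltaOut := defn 118 <| assumeXY fun k X Y f =>
  let L := modalLift k X Y f
  assume L.pull.ty fun V => assume (deltaFibAt k X Y f V).ty fun c =>
  ⟨(L.fibPull V).ty,
    L.pull.ind (fun V => (deltaFibAt k X Y f V).ty ⇒ (L.fibPull V).ty) (fun y v => lam fun c =>
      let G : Ex → Ex → Ex → Ex := fun y w v =>
        idt (modalFib k X Y f y) (delta k X Y f y w) v ⇒ (L.fibPull (L.pull.mk' y v)).ty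
      (deltaFib k X Y f y v).ind (fun _ => (L.fibPull (L.pull.mk' y v)).ty) (fun w q =>
        (fibSg X Y f y).ind (fun w => pi (modalFib k X Y f y) fun v => G y w v) (fun x p =>
          (⟨Y, f x, y, p⟩ : Path).ind
            (fun y p => pi (modalFib k X Y f y) fun v => G y ((fibSg X Y f y).mk' x p) v)
            (lam₂ fun v q => (⟨modalFib k X Y f (f x), modalPt k X Y f x, v, q⟩ : Path).ind
              (fun v _ => (L.fibPull (L.pull.mk' (f x) v)).ty)
              ((L.fibPull (L.toPull x)).mk' x (refl L.pull.ty (L.toPull x))))) w v q) c) V c⟩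

def deltaIn := defn 119 <| assumeXY fun k X Y f =>
  let L := modalLift k X Y f
  assume L.pull.ty fun V => assume (L.fibPull V).ty fun c =>
  ⟨(deltaFibAt k X Y f V).ty, (L.fibPull V).ind (fun _ => (deltaFibAt k X Y f V).ty) (fun x e =>
    (⟨L.pull.ty, L.toPull x, V, e⟩ : Path).ind (fun V _ => (deltaFibAt k X Y f V).ty)
      ((deltaFibAt k X Y f (L.toPull x)).mk' (fibPt X Y f x)
        (refl (modalFib k X Y f (f x)) (modalPt k X Y f x)))) c⟩

def deltaOut_in := thm 120 <| assumeXY fun k X Y f =>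
  let L := modalLift k X Y f
  assume L.pull.ty fun V => assume (L.fibPull V).ty fun c =>
  let T : Ex → Ex → Ex := fun V c =>
    idt (L.fibPull V).ty (deltaOut k X Y f V (deltaIn k X Y f V c)) c
  ⟨T V c, (L.fibPull V).ind (T V) (fun x e => (⟨L.pull.ty, L.toPull x, V, e⟩ : Path).ind
    (fun V e => T V ((L.fibPull V).mk' x e))
    (refl (L.fibPull (L.toPull x)).ty
      ((L.fibPull (L.toPull x)).mk' x (refl L.pull.ty (L.toPull x))))) c⟩

def deltaIn_out := thm 121 <| assumeXY fun k X Y f =>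
  let L := modalLift k X Y f
  assume L.pull.ty fun V => assume (deltaFibAt k X Y f V).ty fun c =>
  let C : Ex → Ex := fun V => (deltaFibAt k X Y f V).ty
  let T : Ex → Ex → Ex := fun V c => idt (C V) (deltaIn k X Y f V (deltaOut k X Y f V c)) c
  ⟨T V c, L.pull.ind (fun V => pi (C V) fun c => T V c) (fun y v => lam fun c =>
    let M : Ex → Ex := fun y => modalFib k X Y f y
    let G : Ex → Ex → Ex := fun y w => pi (M y) fun v => pi (idt (M y) (delta k X Y f y w) v)
      fun q => T (L.pull.mk' y v) ((deltaFib k X Y f y v).mk' w q)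
    (deltaFib k X Y f y v).ind (T (L.pull.mk' y v)) (fun w q =>
      (fibSg X Y f y).ind (G y) (fun x p => (⟨Y, f x, y, p⟩ : Path).ind
        (fun y p => G y ((fibSg X Y f y).mk' x p))
        (lam₂ fun v q => (⟨M (f x), modalPt k X Y f x, v, q⟩ : Path).ind
          (fun v q => T (L.pull.mk' (f x) v) ((deltaFib k X Y f (f x) v).mk' (fibPt X Y f x) q))
          (refl (C (L.toPull x)) ((deltaFib k X Y f (f x) (modalPt k X Y f x)).mk'
            (fibPt X Y f x) (refl (M (f x)) (modalPt k X Y f x)))))) w v q) c) V c⟩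

def isTruncFibration_iff_connPull := thm 122 <| assumeXY fun k X Y f =>
  let L := modalLift k X Y f
  let F : Ex → Ex := fun y => fib X Y f y
  let M : Ex → Ex := fun y => modalFib k X Y f y
  ⟨iff (isTruncFibration k X Y f) (L.connPull k),
    iffIntro (isTruncFibration k X Y f) (L.connPull k)
      (lam₂ fun h V => L.pull.ind (fun V => isConn k (L.fibPull V).ty) (fun y v =>
        let W := L.pull.mk' y v
        isConn_retract k (deltaFib k X Y f y v).ty (L.fibPull W).ty (deltaIn k X Y f W)
          (deltaOut k X Y f W) (deltaOut_in k X Y f W)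
          (isConnMap_of_isEquiv k (F y) (M y) (gamma k X Y f y) (h y) v)) V)
      (lam₂ fun h y => isEquiv_of_isConnMap k (F y) (M y)
        (isType_fib k (trunc k X) (trunc k Y) (truncIsType k X) (truncIsType k Y)
          (truncMap k X Y f) (tr k Y y))
        (gamma k X Y f y) (lam fun v =>
          let W := L.pull.mk' y v
          isConn_retract k (L.fibPull W).ty (deltaFib k X Y f y v).ty (deltaOut k X Y f W)
            (deltaIn k X Y f W) (deltaIn_out k X Y f W) (h W)))⟩

def isTruncFibration_iff := thm 123 <| assumeXY fun m X Y f =>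
  let k := succ m
  let L := modalLift k X Y f
  ⟨iff (isTruncFibration k X Y f) (isSurjOnPaths m X Y f),
    iffTrans (isTruncFibration k X Y f) (L.connPull k) (isSurjOnPaths m X Y f)
      (isTruncFibration_iff_connPull k X Y f)
      (connPull_iff m X Y L.Y' L.η (lam L.B) f L.h (truncIsType k Y)
        (lam fun y => isType_fib k (trunc k X) (trunc k Y) (truncIsType k X) (truncIsType k Y)
          (truncMap k X Y f) y)
        (isConnMap_tr k Y) (modalLift_connTotal k X Y f))⟩

/-! ### Surjectivity on homotopy groups -/

/-- For the converse, a path `|f a| = |b|` in the set truncation encodes to a mere path `f a = b`,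
which suffices as the goal is a proposition. -/
def isSurj_truncMap_iff := thm 124 <| assume U fun A => assume U fun B => assume (A ⇒ B) fun f =>
  let TA := trunc two A
  let TB := trunc two B
  let f' := truncMap two A B f
  let F : Ex → Sg := fun b => fibSg A B f b
  let F' : Ex → Sg := fun v => fibSg TA TB f' v
  let P : Ex → Ex := fun b => trunc one (F b).ty
  let set : Ex → Ex := fun A => isType_of_isProp one (trunc one A) (truncIsType one A)
  ⟨iff (isSurj A B f) (isSurj TA TB f'), iffIntro (isSurj A B f) (isSurj TA TB f')
    (lam₂ fun s v => indTrunc two B (lam fun v => trunc one (F' v).ty)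
      (lam fun v => set (F' v).ty)
      (lam fun b => truncMap one (F b).ty (F' (tr two B b)).ty
        (lam fun w => (F' (tr two B b)).mk' (tr two A ((F b).fst w))
          (ap B TB (tr two B) (f ((F b).fst w)) b ((F b).snd w))) (s b)) v)
    (lam₂ fun s b =>
      let v := tr two B b
      truncRec one (F' v).ty (P b) (truncIsType one (F b).ty) (fun w => (F' v).ind (fun _ => P b)
        (fun u q => indTrunc two A (lam fun u => idt TB (f' u) v ⇒ P b)
          (lam fun u => isType_pi two (idt TB (f' u) v) (lam fun _ => P b)
            (lam fun _ => set (F b).ty))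
          (lam₂ fun a q => truncMap one (idt B (f a) b) (F b).ty (lam fun p => (F b).mk' a p)
            (truncEncode one B (f a) b q)) u q) w) (s v))⟩

/-- The action of `f` on the `m`-fold loop spaces at `x` and `f x` is surjective. -/
def isSurjOnLoops := defn 125 <| assumeXY fun m X Y f => assume X fun x =>
  ⟨U, isSurj (loopSpace m X x) (loopSpace m Y (f x))
    (loopMap m X Y x (f x) f (refl Y (f x)))⟩

def isSurjOnHomotopyGroups_iff := thm 126 <| assumeXY fun m X Y f =>
  let G := isSurjOnHomotopyGroups m X Y f
  let S := pi X fun x => isSurjOnLoops m X Y f x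
  let H : Ex → Ex → Ex → Ex := fun x y p =>
    isSurj (homotopyGroup m X x) (homotopyGroup m Y y) (homotopyGroupMap m X Y x y f p)
  let E : Ex → Ex := fun x => isSurj_truncMap_iff (loopSpace m X x) (loopSpace m Y (f x))
    (loopMap m X Y x (f x) f (refl Y (f x)))
  ⟨iff G S, iffIntro G S
    (lam₂ fun g x => iffMpr (isSurjOnLoops m X Y f x) (H x (f x) (refl Y (f x))) (E x)
      (g (f x) (fibPt X Y f x)))
    (lam₃ fun s y w =>
      let F := fibSg X Y f y
      -- Path induction moves the base point to `f x`, so that only the pointed map with `refl` has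
      -- to be treated.
      F.ind (fun w => H (F.fst w) y (F.snd w)) (fun x p => (⟨Y, f x, y, p⟩ : Path).ind (H x)
        (iffMp (isSurjOnLoops m X Y f x) (H x (f x) (refl Y (f x))) (E x) (s x))) w)⟩

/-- Surjectivity of the action on loops, for maps of identity types. -/
def isSurjOnLoops_succ := thm 127 <| assumeXY fun m X Y f => assume X fun x =>
  let A := idt X x x
  let B := idt Y (f x) (f x)
  let r := refl Y (f x)
  let T : Ex → Ex → Ex := fun g p => isSurj (loopSpace m A (refl X x)) (loopSpace m B r)
    (loopMap m A B (refl X x) r g p)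
  let g := ap X Y f x x
  let g' := lam fun q => concat Y (f x) (f x) (f x) (g q) r
  let T' : Ex → Ex → Ex := fun g' H => T g' (inv B r (g' (refl X x)) (H (refl X x)))
  ⟨iff (isSurjOnLoops m A B g (refl X x)) (isSurjOnLoops (succ m) X Y f x),
    htpyInd A (lam fun _ => B) g
      (lam₂ fun g' H => iff (isSurjOnLoops m A B g (refl X x)) (T' g' H))
      (iffIntro (T g (refl B r)) (T g (refl B r)) (lam fun t => t) (lam fun t => t)) g'
      -- Unfolding one loop space replaces `ap f` by `q ↦ ap f q · refl`. This homotopy removes the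
      -- extra factor and reduces to `refl` at the base point, so the pointings agree.
      (lam fun q => inv B (concat Y (f x) (f x) (f x) (g q) r) (g q)
        (concat_refl Y (f x) (f x) (g q)))⟩

/-- Induction on `m`: the hypothesis for `ap f` concerns loops at each path `q : x = x'`, and path
induction reduces these to loops at `refl`. -/
def isSurjOnLoops_iff := thm 128 <| assume nat fun m =>
  let S : Ex → Ex → Ex → Ex → Ex := fun m X Y f => pi X fun x => isSurjOnLoops m X Y f x
  let R : Ex → Ex → Ex → Ex → Ex := fun m X Y f => isSurjOnPaths m X Y f
  let T : Ex → Ex := fun m => pi U fun X => pi U fun Y => pi (X ⇒ Y) fun f =>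
    iff (S m X Y f) (R m X Y f)
  ⟨T m, indNat₁ (lam T)
    (lam₃ fun X Y f => iffIntro (S zero X Y f) (R zero X Y f) (lam fun s => s) (lam fun s => s))
    (lam₂ fun m H => lam₃ fun X Y f =>
      let A : Ex → Ex → Ex := fun x x' => idt X x x'
      let B : Ex → Ex → Ex := fun x x' => idt Y (f x) (f x')
      let g : Ex → Ex → Ex := fun x x' => ap X Y f x x'
      let S' : Ex → Ex → Ex := fun x x' => S m (A x x') (B x x') (g x x')
      let R' : Ex → Ex → Ex := fun x x' => R m (A x x') (B x x') (g x x')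
      let L : Ex → Ex → Ex → Ex := fun x x' q => isSurjOnLoops m (A x x') (B x x') (g x x') q
      iffIntro (S (succ m) X Y f) (R (succ m) X Y f)
        (lam₃ fun s x x' => iffMp (S' x x') (R' x x') (H (A x x') (B x x') (g x x'))
          (lam fun q => (⟨X, x, x', q⟩ : Path).ind (L x)
            (iffMpr (L x x (refl X x)) (isSurjOnLoops (succ m) X Y f x)
              (isSurjOnLoops_succ m X Y f x) (s x))))
        (lam₂ fun r x => iffMp (L x x (refl X x)) (isSurjOnLoops (succ m) X Y f x)
          (isSurjOnLoops_succ m X Y f x)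
          (iffMpr (S' x x) (R' x x) (H (A x x) (B x x) (g x x)) (r x x) (refl X x)))) m⟩

/-- The entries for the comparison of fibrations with surjectivity on homotopy groups. -/
def comparison : List Decl :=
  [modalPt, modalLift_connTotal, deltaOut, deltaIn, deltaOut_in, deltaIn_out,
  isTruncFibration_iff_connPull, isTruncFibration_iff, isSurj_truncMap_iff, isSurjOnLoops,
  isSurjOnHomotopyGroups_iff, isSurjOnLoops_succ, isSurjOnLoops_iff].map Item.decl

/-- A surjection is a fibration for the truncation at `m + 1` if and only if it is surjective on the
homotopy groups of index `m`. -/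
def fibrationCriterion : Typed := assumeXY fun m X Y f => assume (isSurj X Y f) fun _ =>
  let F := isTruncFibration (succ m) X Y f
  let G := isSurjOnHomotopyGroups m X Y f
  let S := pi X fun x => isSurjOnLoops m X Y f x
  let R := isSurjOnPaths m X Y f
  let GR := iffTrans G S R (isSurjOnHomotopyGroups_iff m X Y f) (isSurjOnLoops_iff m X Y f)
  ⟨iff F G, iffTrans F R G (isTruncFibration_iff m X Y f)
    (iffIntro R G (lam fun r => iffMpr G R GR r) (lam fun g => iffMp G R GR g))⟩

end HoTT.Lib

/-! ### Running the checker and passing to all universes -/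

namespace HoTT

theorem Decl.hasType_of_thm {E : Env} {k : ℕ} (hV : E.Valid k) {A t : Pre}
    (h : (Decl.thm A t).check E k = true) : HasType [] (E.erase t) (E.erase A) := by
  simp only [check, Bool.and_eq_true] at h
  exact hasType_of_infer hV (isTy_of_checkType hV h.1.2) h.2

namespace Lib

/-- The entries that the main theorem depends on. -/
def library : List Decl := base ++ paths ++ connectedMaps ++ lifts ++ comparison

/-- The environment with these entries. -/
def env : Env := Env.leaf.extend 0 library

theorem library_check : Env.leaf.check 0 library = true := by decide +kernel

theorem fibrationCriterion_check :
    (Decl.thm fibrationCriterion.ty.close fibrationCriterion.tm.close).check env library.length =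
      true := by
  decide +kernel

end Lib

end HoTT

/-- In the theory, `m : ℕ` stands for `n + 1` with `n ≥ -1`, so that the truncation at level `n` is
`trunc (m + 1)`. -/
theorem mainTheorem2 (i : ℕ) :
    HoTT.Provable
      (.pi HoTT.nat fun m => .pi (.univ i) fun X => .pi (.univ i) fun Y => .pi (.arr X Y) fun f =>
        .arr (HoTT.isSurj X Y f)
          (HoTT.iff (HoTT.isTruncFibration i (HoTT.succ m) X Y f)
            (HoTT.isSurjOnHomotopyGroups i m X Y f))) := by
  let S (i : ℕ) : HoTT.Exp :=
    .pi HoTT.nat fun m => .pi (.univ i) fun X => .pi (.univ i) fun Y => .pi (.arr X Y) fun f =>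
      .arr (HoTT.isSurj X Y f)
        (HoTT.iff (HoTT.isTruncFibration i (HoTT.succ m) X Y f)
          (HoTT.isSurjOnHomotopyGroups i m X Y f))
  -- Levels are raised as `i + 0`, which reduces to `i`, so the shifted statement is the statement
  -- at level `i` by computation.
  have hS : (S 0).close.lvl i = (S i).close := rfl
  -- With all entries inserted, the library form of the statement is syntactically the one built
  -- from the original definitions.
  have hE : (HoTT.Lib.env.erase HoTT.Lib.fibrationCriterion.ty.close).beq (S 0).close = true := by
    decide +kernel
  have h := (HoTT.Decl.hasType_of_thm (HoTT.Env.Valid.leaf.extend HoTT.Lib.library_check)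
    (Nat.zero_add HoTT.Lib.library.length ▸ HoTT.Lib.fibrationCriterion_check)).lvl i
  exact ⟨_, hS ▸ HoTT.Tm.eq_of_beq hE ▸ h⟩
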